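/- Let $\alpha,\nu>0$, $0<T\le+\infty$, and let $\mathbf u_0\in L^2(\mathbb R^3)^3$ satisfy $\operatorname{div}\mathbf u_0=0$ in the sense of distributions. For a function $\psi$ on $\mathbb R^3$ put $\overline\psi=H_\alpha\star\psi$, where $H_\alpha(\mathbf x)=\frac{1}{4\pi\alpha^2}\frac{e^{-|\mathbf x|/\alpha}}{|\mathbf x|}$ is the fundamental solution of $-\alpha^2\Delta+1$. A pair $(\mathbf u,p)$, with values in $\mathbb R^3\times\mathbb R$, is a \emph{regular solution} over $[0,T)$ of the Bardina model $$\partial_t\mathbf u+\operatorname{div}(\overline{\mathbf u\otimes\mathbf u})-\nu\Delta\mathbf u+\nabla p=0,\qquad \operatorname{div}\mathbf u=0,\qquad \mathbf u|_{t=0}=\overline{\mathbf u_0}$$ if (i) $\mathbf u,\partial_t\mathbf u,\nabla\mathbf u,D^2\mathbf u,p,\nabla p$ are well defined and continuous on $[0,T)\times\mathbb R^3$ (with the one-sided time derivative at $t=0$) and the first two equations hold in $\mathbb R^3$ for all $t\in(0,T)$; (ii) $\mathbf u(0,\mathbf x)=\overline{\mathbf u_0}(\mathbf x)$ for every $\mathbf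 x\in\mathbb R^3$; (iii) $\mathbf u\in C([0,\tau];H^2(\mathbb R^3)^3)$ for every $0<\tau<T$. Let $(\mathbf u,p)$ be a regular solution over $[0,T)$. Then: 1. The limit $c(t)=\lim_{|\mathbf x|\to\infty}p(t,\mathbf x)$ exists for every $t\in[0,T)$, the function $c$ is continuous on $[0,T)$, and $p-c\in C([0,\tau];H^4(\mathbb R^3))$ for every $0<\tau<T$. Consequently, if for every $t\in[0,T)$ the pressure $p(t,\cdot)$ belongs to $L^2(\mathbb R^3)$ or tends to $0$ at infinity, then $p\in C([0,\tau];H^4(\mathbb R^3))$ for every $0<\tau<T$. 2. $\partial_t\mathbf u\in C([0,\tau];L^2(\mathbb R^3)^3)$ for every $0<\tau<T$. 3. For every $t\in[0,T)$ all the integrals below converge, and $$\frac12\Big(\alpha^2\|\nabla\mathbf u(t)\|_{L^2}^2+\|\mathbf u(t)\|_{L^2}^2\Big)+\int_0^t\Big(\nu\alpha^2\|\Delta\mathbf u(s)\|_{L^2}^2+\nu\|\nabla\mathbf u(s)\|_{L^2}^2\Big)\,ds=\frac12\Big(\alpha^2\|\nabla\overline{\mathbf u_0}\|_{L^2}^2+\|\overline{\mathbf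 u_0}\|_{L^2}^2\Big).$$ -/

import Mathlib

open MeasureTheory Filter Topology
open scoped ContDiff

namespace Bardina

noncomputable section

/-- The physical space `ℝ³` with its Euclidean norm and Lebesgue measure `volume`. -/
abbrev Space3 : Type := EuclideanSpace ℝ (Fin 3)

/-- The `j`-th vector of the canonical basis of `ℝ³`. -/
def basisVec (j : Fin 3) : Space3 := EuclideanSpace.single j 1

/-! ### Sobolev spaces through weak derivatives -/

/-- `g` is the weak partial derivative `∂_{I 0} ∂_{I 1} ⋯ ∂_{I (n-1)} f` of order `n` of `f`. -/
def HasWeakDeriv {n : ℕ} (I : Fin n → Fin 3) (f g : Space3 → ℝ) : Prop :=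
  LocallyIntegrable f ∧ LocallyIntegrable g ∧
    ∀ φ : Space3 → ℝ, ContDiff ℝ ∞ φ → HasCompactSupport φ →
      ∫ x, f x * iteratedFDeriv ℝ n φ x (fun k => basisVec (I k)) = (-1) ^ n * ∫ x, g x * φ x

/-- `f ∈ C(S; L²(ℝ³))` : every `f t`, `t ∈ S`, is in `L²`, and `t ↦ f t` is continuous on `S` for
the `L²` norm. -/
def ContinuousIntoL2 (S : Set ℝ) (f : ℝ → Space3 → ℝ) : Prop :=
  ∀ t ∈ S, MemLp (f t) 2 volume ∧
    Tendsto (fun s => eLpNorm (f s - f t) 2 volume) (𝓝[S] t) (𝓝 0)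

/-- `f ∈ C(S; H^m(ℝ³))`, where `H^m` is the space of the functions whose weak derivatives of order
at most `m` are in `L²`, with the norm `∑ ‖D^I f‖_{L²}` over these derivatives. Since weak
derivatives are unique (as elements of `L²`), this says that each weak derivative of order at most
`m` of `f t` exists and is in `C(S; L²(ℝ³))`. -/
def ContinuousIntoSobolev (m : ℕ) (S : Set ℝ) (f : ℝ → Space3 → ℝ) : Prop :=
  ∀ n ≤ m, ∀ I : Fin n → Fin 3, ∃ g : ℝ → Space3 → ℝ,
    (∀ t ∈ S, HasWeakDeriv I (f t) (g t)) ∧ ContinuousIntoL2 S g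

/-- `div v = 0` in the sense of distributions. -/
def IsWeaklyDivFree (v : Space3 → Space3) : Prop :=
  ∀ φ : Space3 → ℝ, ContDiff ℝ ∞ φ → HasCompactSupport φ →
    ∫ x, inner ℝ (v x) (gradient φ x) = 0

/-! ### The Helmholtz filter -/

/-- The kernel `H_α(x) = exp(-|x|/α) / (4 π α² |x|)`, `x ≠ 0`, the fundamental solution of
`-α² Δ + 1`. -/
def helmholtzKernel (α : ℝ) (x : Space3) : ℝ :=
  1 / (4 * Real.pi * α ^ 2) * (Real.exp (-(‖x‖ / α)) / ‖x‖)

/-- The filtered function `H_α ⋆ ψ` (for scalar or vector fields `ψ`). -/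
def filtered {F : Type*} [NormedAddCommGroup F] [NormedSpace ℝ F]
    (α : ℝ) (ψ : Space3 → F) (x : Space3) : F :=
  ∫ y, helmholtzKernel α (x - y) • ψ y

/-! ### The model -/

/-- Divergence of a vector field. -/
def divergence (v : Space3 → Space3) (x : Space3) : ℝ :=
  ∑ j, fderiv ℝ v x (basisVec j) j

/-- The `i`-th component `∑ⱼ ∂ⱼ (H_α ⋆ (vᵢ vⱼ))` of the divergence of the filtered tensor `v ⊗ v`. -/
def divFilteredTensor (α : ℝ) (v : Space3 → Space3) (i : Fin 3) (x : Space3) : ℝ :=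
  ∑ j, fderiv ℝ (filtered α (fun y => v y i * v y j)) x (basisVec j)

/-- The time derivative of `u` on `[0, ∞)` (one-sided at `t = 0`). -/
def timeDeriv (u : ℝ → Space3 → Space3) (t : ℝ) (x : Space3) : Space3 :=
  derivWithin (fun s => u s x) (Set.Ici 0) t

/-- The time interval `[0, T)`, where `T` may be `+∞`. -/
def timeInterval (T : EReal) : Set ℝ := {t | 0 ≤ t ∧ (t : EReal) < T}

/-- `(u, p)` is a regular solution over `[0, T)` of the Bardina model
`∂ₜ u + div (filtered (u ⊗ u)) - ν Δ u + ∇ p = 0`, `div u = 0`, `u(0) = filtered u₀`. -/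
structure IsRegularSolution (α ν : ℝ) (T : EReal) (u₀ : Space3 → Space3)
    (u : ℝ → Space3 → Space3) (p : ℝ → Space3 → ℝ) : Prop where
  timeDiff : ∀ t ∈ timeInterval T, ∀ x,
    DifferentiableWithinAt ℝ (fun s => u s x) (Set.Ici 0) t
  spaceDiff_u : ∀ t ∈ timeInterval T, ContDiff ℝ 2 (u t)
  spaceDiff_p : ∀ t ∈ timeInterval T, ContDiff ℝ 1 (p t)
  cont_u : ContinuousOn (fun z : ℝ × Space3 => u z.1 z.2) (timeInterval T ×ˢ Set.univ)
  cont_timeDeriv :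
    ContinuousOn (fun z : ℝ × Space3 => timeDeriv u z.1 z.2) (timeInterval T ×ˢ Set.univ)
  cont_grad_u :
    ContinuousOn (fun z : ℝ × Space3 => fderiv ℝ (u z.1) z.2) (timeInterval T ×ˢ Set.univ)
  cont_hess_u :
    ContinuousOn (fun z : ℝ × Space3 => iteratedFDeriv ℝ 2 (u z.1) z.2)
      (timeInterval T ×ˢ Set.univ)
  cont_p : ContinuousOn (fun z : ℝ × Space3 => p z.1 z.2) (timeInterval T ×ˢ Set.univ)
  cont_grad_p :
    ContinuousOn (fun z : ℝ × Space3 => gradient (p z.1) z.2) (timeInterval T ×ˢ Set.univ)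
  momentum : ∀ t ∈ timeInterval T, 0 < t → ∀ x i,
    timeDeriv u t x i + divFilteredTensor α (u t) i x
      - ν * (Laplacian.laplacian (u t) x) i + gradient (p t) x i = 0
  incompressible : ∀ t ∈ timeInterval T, 0 < t → ∀ x, divergence (u t) x = 0
  initial : ∀ x, u 0 x = filtered α u₀ x
  sobolev : ∀ τ : ℝ, 0 < τ → (τ : EReal) < T →
    ∀ i, ContinuousIntoSobolev 2 (Set.Icc 0 τ) (fun t x => u t x i)

/-! ### Energy -/

/-- `|∇v(x)|² = ∑ᵢⱼ (∂ⱼ vᵢ(x))²`. -/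
def gradSq (v : Space3 → Space3) (x : Space3) : ℝ := ∑ j, ‖fderiv ℝ v x (basisVec j)‖ ^ 2

/-- `E_α(v) = α² ∫ |∇v|² + ∫ |v|²`. -/
def energy (α : ℝ) (v : Space3 → Space3) : ℝ :=
  α ^ 2 * (∫ x, gradSq v x) + ∫ x, ‖v x‖ ^ 2

end

end Bardina

/-! The proof works on the Fourier side. Let `U` be the spatial transform of the velocity.
Membership in H² means that (1 + |ξ|²) U is in L². In dimension three this makes `U` integrable, and
the weighted space is stable under convolution, the Fourier form of the algebra property of H². The
Helmholtz kernel is a superposition of Gaussians, so the filter is the multiplier 1/(1 + 4π²α²|ξ|²),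
which gains two derivatives: the filtered tensor is a continuous curve in H⁴. Applying minus the
products of Riesz multipliers to it gives a canonical pressure π, continuous into H⁴ and vanishing
at infinity by the Riemann–Lebesgue lemma. With this π the field a = νΔu − div(filtered u ⊗ u) − ∇π
is a continuous curve of solenoidal L² fields.

The main point is that the given pressure p differs from π by a function of time only. The equation
reads ∂ₜu = a − ∇(p − π), but neither ∂ₜu nor ∇p is known to be in L², and p has no prescribed
growth, so no Liouville argument applies at a fixed time. After integration over [s, r], however,
the field u(s) − u(r) + ∫ a is in L², is solenoidal, and is the time integral of ∇(p − π), hence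
curl free in the weak sense. Its Fourier transform is both orthogonal and parallel to ξ, so it
vanishes (`ae_eq_zero_of_div_curl`). Differentiating in r at r = s gives ∇(p − π) = 0
(`fderiv_eq_zero_and_integral_eq`). Thus p = π + c(t) and ∂ₜu = a, which settles the pressure and
the time derivative. If p is in L² or tends to zero, then c = 0.

For the energy write A = 1 − α²Δ, so that the energy is ⟨Au, u⟩. The curve Au is only continuous
into L², while u has a right derivative a in L². Symmetry of A gives E(s) − E(t) = ⟨Au(s) + Au(t),
u(s) − u(t)⟩, where only the second factor has to be differentiated; the right derivative of E is
therefore 2⟨Au, a⟩. In this pairing A cancels the filter, leaving ∫ div(u ⊗ u)·u = 0; the pressure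
is orthogonal to Au because Au is solenoidal; the viscous term gives the dissipation. Integrating
the right derivative of the continuous function E gives the equality. -/

namespace Bardina
open scoped FourierTransform SchwartzMap LineDeriv ENNReal ComplexConjugate

/-! ### The L² Fourier transform, symbols of derivatives, and weakly solenoidal fields. -/

/-- `U` is the `L²` Fourier transform of `f`. -/
def IsFT (f U : Space3 → ℂ) : Prop :=
  ∃ (hf : MemLp f 2 volume) (hU : MemLp U 2 volume), 𝓕 (hf.toLp f) = hU.toLp U

lemma IsFT.memLp {f U : Space3 → ℂ} (h : IsFT f U) : MemLp f 2 volume := h.1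

lemma IsFT.memLp_ft {f U : Space3 → ℂ} (h : IsFT f U) : MemLp U 2 volume := h.2.1

lemma _root_.MeasureTheory.MemLp.exists_isFT {f : Space3 → ℂ} (hf : MemLp f 2 volume) :
    ∃ U, IsFT f U :=
  ⟨_, hf, Lp.memLp (𝓕 (hf.toLp f)), by simp⟩

lemma _root_.MeasureTheory.MemLp.exists_isFT_inv {U : Space3 → ℂ} (hU : MemLp U 2 volume) :
    ∃ f, IsFT f U :=
  ⟨_, Lp.memLp (𝓕⁻ (hU.toLp U)), hU, by simp⟩

lemma IsFT.congr {f U f' U' : Space3 → ℂ} (h : IsFT f U) (hf : f =ᵐ[volume] f')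
    (hU : U =ᵐ[volume] U') : IsFT f' U' := by
  obtain ⟨h1, h2, h3⟩ := h
  refine ⟨(memLp_congr_ae hf).1 h1, (memLp_congr_ae hU).1 h2, ?_⟩
  rw [← MemLp.toLp_congr h1 _ hf, h3, MemLp.toLp_congr h2 _ hU]

lemma IsFT.add {f U g V : Space3 → ℂ} (h : IsFT f U) (h' : IsFT g V) :
    IsFT (fun x => f x + g x) (fun x => U x + V x) := by
  obtain ⟨h1, h2, h3⟩ := h
  obtain ⟨h1', h2', h3'⟩ := h'
  refine ⟨h1.add h1', h2.add h2', ?_⟩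
  have e1 := MemLp.toLp_add h1 h1'
  have e2 := MemLp.toLp_add h2 h2'
  refine (congrArg _ e1).trans ?_
  rw [FourierTransform.fourier_add, h3, h3', ← e2]
  rfl

lemma IsFT.const_mul {f U : Space3 → ℂ} (h : IsFT f U) (c : ℂ) :
    IsFT (fun x => c * f x) (fun x => c * U x) := by
  obtain ⟨h1, h2, h3⟩ := h
  refine ⟨h1.const_smul c, h2.const_smul c, ?_⟩
  have e1 := MemLp.toLp_const_smul c h1
  have e2 := MemLp.toLp_const_smul c h2
  refine (congrArg _ e1).trans ?_
  rw [FourierTransform.fourier_smul, h3, ← e2]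
  rfl

lemma IsFT.zero : IsFT (fun _ => 0) (fun _ => 0) := by
  obtain ⟨U, hU⟩ := (MemLp.zero (p := 2) (μ := (volume : Measure Space3)) (ε := ℂ)).exists_isFT
  simpa using hU.const_mul 0

lemma IsFT.neg {f U : Space3 → ℂ} (h : IsFT f U) : IsFT (fun x => -f x) (fun x => -U x) := by
  simpa using h.const_mul (-1)

lemma IsFT.sub {f U g V : Space3 → ℂ} (h : IsFT f U) (h' : IsFT g V) :
    IsFT (fun x => f x - g x) (fun x => U x - V x) := by
  simpa [sub_eq_add_neg] using h.add h'.neg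

lemma IsFT.sum {ι : Type*} (s : Finset ι) {f U : ι → Space3 → ℂ} (h : ∀ i ∈ s, IsFT (f i) (U i)) :
    IsFT (fun x => ∑ i ∈ s, f i x) (fun x => ∑ i ∈ s, U i x) := by
  classical
  induction s using Finset.induction_on with
  | empty => simpa using IsFT.zero
  | insert a s ha ih =>
    simp only [Finset.sum_insert ha]
    exact (h a (by simp)).add (ih fun i hi => h i (by simp [hi]))

/-- Plancherel. Through this isometry, continuity in time passes between a curve and its transform.
-/
lemma IsFT.eLpNorm_eq {f U : Space3 → ℂ} (h : IsFT f U) :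
    eLpNorm f 2 volume = eLpNorm U 2 volume := by
  obtain ⟨h1, h2, h3⟩ := h
  rw [← Lp.enorm_toLp h1, ← Lp.enorm_toLp h2, ← h3, ← ofReal_norm, ← ofReal_norm,
    Lp.norm_fourier_eq]

lemma IsFT.integral_mul_conj {f U g V : Space3 → ℂ} (h : IsFT f U) (h' : IsFT g V) :
    ∫ x, f x * conj (g x) = ∫ x, U x * conj (V x) := by
  obtain ⟨h1, h2, h3⟩ := h
  obtain ⟨h1', h2', h3'⟩ := h'
  have key := Lp.inner_fourier_eq (h1'.toLp g) (h1.toLp f)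
  rw [h3, h3', L2.inner_def, L2.inner_def] at key
  refine Eq.trans ?_ (key.symm.trans ?_)
  · refine integral_congr_ae ?_
    filter_upwards [h1.coeFn_toLp, h1'.coeFn_toLp] with x e1 e2
    rw [e1, e2]; rfl
  · refine integral_congr_ae ?_
    filter_upwards [h2.coeFn_toLp, h2'.coeFn_toLp] with x e1 e2
    rw [e1, e2]; rfl

/-- The defining duality of the Fourier transform of tempered distributions. -/
lemma isFT_iff {f U : Space3 → ℂ} (hf : MemLp f 2 volume) (hU : MemLp U 2 volume) :
    IsFT f U ↔ ∀ ψ : 𝓢(Space3, ℂ), ∫ x, (𝓕 ψ) x * f x = ∫ x, ψ x * U x := by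
  have e1 : ∀ ψ : 𝓢(Space3, ℂ),
      ((𝓕 (hf.toLp f) : Lp ℂ 2 (volume : Measure Space3)) : 𝓢'(Space3, ℂ)) ψ
        = ∫ x, (𝓕 ψ) x * f x := by
    intro ψ
    rw [← Lp.fourier_toTemperedDistribution_eq, TemperedDistribution.fourier_apply,
      Lp.toTemperedDistribution_apply]
    refine integral_congr_ae ?_
    filter_upwards [hf.coeFn_toLp] with x hx
    rw [hx, smul_eq_mul]
  have e2 : ∀ ψ : 𝓢(Space3, ℂ),
      ((hU.toLp U : Lp ℂ 2 (volume : Measure Space3)) : 𝓢'(Space3, ℂ)) ψ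
        = ∫ x, ψ x * U x := by
    intro ψ
    rw [Lp.toTemperedDistribution_apply]
    refine integral_congr_ae ?_
    filter_upwards [hU.coeFn_toLp] with x hx
    rw [hx, smul_eq_mul]
  constructor
  · rintro ⟨h1, h2, h3⟩ ψ
    rw [← e1, ← e2, h3]
  · intro h
    refine ⟨hf, hU, ?_⟩
    -- An L² class is determined by the tempered distribution it defines, so the identity only has
    -- to be tested on Schwartz functions.
    have hinj := LinearMap.ker_eq_bot.1
      (Lp.ker_toTemperedDistributionCLM_eq_bot (F := ℂ) (μ := (volume : Measure Space3)) (p := 2))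
    apply hinj
    ext ψ
    exact (e1 ψ).trans ((h ψ).trans (e2 ψ).symm)

/-- The symbol `2πi ξⱼ` of the partial derivative `∂ⱼ`. -/
noncomputable def symb (j : Fin 3) (ξ : Space3) : ℂ := 2 * Real.pi * Complex.I * (ξ j : ℝ)

lemma continuous_symb (j : Fin 3) : Continuous (symb j) := by
  unfold symb; fun_prop

lemma inner_basisVec (ξ : Space3) (j : Fin 3) : inner ℝ ξ (basisVec j) = ξ j := by
  simp [basisVec, EuclideanSpace.inner_single_right]

lemma conj_symb (j : Fin 3) (ξ : Space3) : conj (symb j ξ) = -symb j ξ := by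
  have h2 : conj (2 : ℂ) = 2 := Complex.conj_ofReal 2
  simp [symb, Complex.conj_ofReal, h2]

lemma norm_symb_le (j : Fin 3) (ξ : Space3) : ‖symb j ξ‖ ≤ 2 * Real.pi * ‖ξ‖ := by
  have := EuclideanSpace.norm_eq ξ
  have h2 : ‖ξ j‖ ≤ ‖ξ‖ := PiLp.norm_apply_le ξ j
  simp only [symb, norm_mul, Complex.norm_I, Complex.norm_real, Complex.norm_ofNat, mul_one]
  rw [Real.norm_of_nonneg Real.pi_pos.le]
  gcongr

lemma symb_mul_symb (i j : Fin 3) (ξ : Space3) :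
    symb i ξ * symb j ξ = ((-(4 * Real.pi ^ 2 * (ξ i * ξ j)) : ℝ) : ℂ) := by
  simp only [symb]
  push_cast
  linear_combination (4 * (Real.pi : ℂ) ^ 2 * ξ i * ξ j) * Complex.I_sq

/-- The sign is that of the inverse transform. It combines with the sign from integration by parts,
so that a derivative of an L² function carries the symbol `symb j` itself. -/
lemma fourierInv_lineDeriv_apply (φ : 𝓢(Space3, ℂ)) (j : Fin 3) (ξ : Space3) :
    (𝓕⁻ (∂_{basisVec j} φ) : 𝓢(Space3, ℂ)) ξ = -symb j ξ * (𝓕⁻ φ : 𝓢(Space3, ℂ)) ξ := by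
  have hg : (inner ℝ · (basisVec j) : Space3 → ℝ).HasTemperateGrowth := by fun_prop
  rw [SchwartzMap.fourierInv_lineDerivOp_eq, smul_apply,
    SchwartzMap.smulLeftCLM_apply_apply hg, inner_basisVec]
  simp only [symb, smul_eq_mul, Complex.real_smul]
  ring

lemma fourierInv_iteratedLineDeriv_apply {n : ℕ} (φ : 𝓢(Space3, ℂ)) (I : Fin n → Fin 3)
    (ξ : Space3) :
    (𝓕⁻ (∂^{fun k => basisVec (I k)} φ) : 𝓢(Space3, ℂ)) ξ
      = (-1) ^ n * (∏ k, symb (I k) ξ) * (𝓕⁻ φ : 𝓢(Space3, ℂ)) ξ := by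
  induction n with
  | zero => simp
  | succ n ih =>
    have e : ∂^{fun k => basisVec (I k)} φ
        = ∂_{basisVec (I 0)} (∂^{fun k : Fin n => basisVec (I k.succ)} φ) :=
      LineDeriv.iteratedLineDerivOp_succ_left _ _
    rw [e, fourierInv_lineDeriv_apply, ih, Fin.prod_univ_succ, pow_succ]
    ring

/-- A real test function as a complex Schwartz function. -/
noncomputable def testSchwartz (φ : Space3 → ℝ) (h1 : ContDiff ℝ ∞ φ) (h2 : HasCompactSupport φ) :
    𝓢(Space3, ℂ) :=
  HasCompactSupport.toSchwartzMap (f := fun x => (φ x : ℂ)) (h2.comp_left Complex.ofReal_zero)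
    (Complex.ofRealCLM.contDiff.comp h1)

lemma testSchwartz_apply (φ : Space3 → ℝ) (h1 : ContDiff ℝ ∞ φ) (h2 : HasCompactSupport φ)
    (x : Space3) : testSchwartz φ h1 h2 x = φ x := rfl

lemma iteratedLineDeriv_testSchwartz {n : ℕ} (φ : Space3 → ℝ) (h1 : ContDiff ℝ ∞ φ)
    (h2 : HasCompactSupport φ) (m : Fin n → Space3) (x : Space3) :
    (∂^{m} (testSchwartz φ h1 h2)) x = (iteratedFDeriv ℝ n φ x m : ℝ) := by
  rw [SchwartzMap.iteratedLineDerivOp_eq_iteratedFDeriv]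
  have := ContinuousLinearMap.iteratedFDeriv_comp_left Complex.ofRealCLM
    (h1.contDiffAt (x := x)) (i := n) (by exact_mod_cast le_top)
  have e : (testSchwartz φ h1 h2 : Space3 → ℂ) = Complex.ofRealCLM ∘ φ := rfl
  rw [e, this]
  rfl

/-- The duality `isFT_iff`, applied to the inverse transform of the test function. This form turns
identities in x into identities in ξ. -/
lemma IsFT.integral_schwartz_mul {f U : Space3 → ℂ} (h : IsFT f U) (ψ : 𝓢(Space3, ℂ)) :
    ∫ x, ψ x * f x = ∫ ξ, (𝓕⁻ ψ : 𝓢(Space3, ℂ)) ξ * U ξ := by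
  rw [← (isFT_iff h.memLp h.memLp_ft).1 h (𝓕⁻ ψ), FourierTransform.fourier_fourierInv_eq]

/-- Multiplication by the symbols on the Fourier side is weak differentiation. -/
lemma IsFT.integral_mul_iteratedFDeriv {n : ℕ} {I : Fin n → Fin 3} {f U g : Space3 → ℂ}
    (h : IsFT f U) (hg : IsFT g (fun ξ => (∏ k, symb (I k) ξ) * U ξ)) {φ : Space3 → ℝ}
    (h1 : ContDiff ℝ ∞ φ) (h2 : HasCompactSupport φ) :
    ∫ x, f x * (iteratedFDeriv ℝ n φ x (fun k => basisVec (I k)) : ℝ)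
      = (-1) ^ n * ∫ x, g x * φ x := by
  have e1 := h.integral_schwartz_mul (∂^{fun k => basisVec (I k)} (testSchwartz φ h1 h2))
  have e2 := hg.integral_schwartz_mul (testSchwartz φ h1 h2)
  simp only [iteratedLineDeriv_testSchwartz, fourierInv_iteratedLineDeriv_apply,
    testSchwartz_apply] at e1 e2
  calc _ = ∫ x, (iteratedFDeriv ℝ n φ x (fun k => basisVec (I k)) : ℝ) * f x := by
        simp only [mul_comm]
    _ = _ := e1
    _ = (-1) ^ n * ∫ ξ, (𝓕⁻ (testSchwartz φ h1 h2) : 𝓢(Space3, ℂ)) ξ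
          * ((∏ k, symb (I k) ξ) * U ξ) := by
        rw [← integral_const_mul]
        congr 1; ext ξ; ring
    _ = _ := by rw [← e2]; simp only [mul_comm]

lemma iteratedFDeriv_one_basis (φ : Space3 → ℝ) (x : Space3) (v : Fin 1 → Space3) :
    iteratedFDeriv ℝ 1 φ x v = fderiv ℝ φ x (v 0) := by
  rw [iteratedFDeriv_one_apply]

lemma lineDeriv_testSchwartz (φ : Space3 → ℝ) (h1 : ContDiff ℝ ∞ φ) (h2 : HasCompactSupport φ)
    (v : Space3) (x : Space3) :
    (∂_{v} (testSchwartz φ h1 h2)) x = ((fderiv ℝ φ x v : ℝ) : ℂ) := by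
  have := iteratedLineDeriv_testSchwartz φ h1 h2 (fun _ : Fin 1 => v) x
  rwa [LineDeriv.iteratedLineDerivOp_one, iteratedFDeriv_one_basis] at this

/-- A field whose Fourier transform is orthogonal to `ξ` is weakly divergence free. -/
lemma sum_integral_mul_fderiv_eq_zero {a A : Fin 3 → Space3 → ℂ} (h : ∀ k, IsFT (a k) (A k))
    (hA : ∀ᵐ ξ, ∑ k, symb k ξ * A k ξ = 0) {φ : Space3 → ℝ} (h1 : ContDiff ℝ ∞ φ)
    (h2 : HasCompactSupport φ) :
    ∑ k, ∫ x, a k x * (fderiv ℝ φ x (basisVec k) : ℝ) = 0 := by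
  have e : ∀ k, ∫ x, a k x * (fderiv ℝ φ x (basisVec k) : ℝ)
      = ∫ ξ, (𝓕⁻ (∂_{basisVec k} (testSchwartz φ h1 h2)) : 𝓢(Space3, ℂ)) ξ * A k ξ := by
    intro k
    rw [← (h k).integral_schwartz_mul]
    simp only [lineDeriv_testSchwartz, mul_comm]
  simp only [e]
  rw [← integral_finsetSum]
  · refine integral_eq_zero_of_ae ?_
    filter_upwards [hA] with ξ hξ
    simp only [fourierInv_lineDeriv_apply, Pi.zero_apply]
    have : ∑ k, -symb k ξ * (𝓕⁻ (testSchwartz φ h1 h2) : 𝓢(Space3, ℂ)) ξ * A k ξ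
      = -(𝓕⁻ (testSchwartz φ h1 h2) : 𝓢(Space3, ℂ)) ξ * ∑ k, symb k ξ * A k ξ := by
      rw [Finset.mul_sum]; congr 1; ext k; ring
    rw [this, hξ, mul_zero]
  · intro k _
    exact (SchwartzMap.memLp (𝓕⁻ (∂_{basisVec k} (testSchwartz φ h1 h2))) 2
      volume).integrable_mul (h k).memLp_ft

lemma IsFT.unique {f U V : Space3 → ℂ} (h : IsFT f U) (h' : IsFT f V) : U =ᵐ[volume] V := by
  obtain ⟨h1, h2, h3⟩ := h
  obtain ⟨h1', h2', h3'⟩ := h'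
  exact (MemLp.toLp_eq_toLp_iff h2 h2').1 (h3.symm.trans h3')

lemma IsFT.unique_inv {f g U : Space3 → ℂ} (h : IsFT f U) (h' : IsFT g U) : f =ᵐ[volume] g := by
  obtain ⟨h1, h2, h3⟩ := h
  obtain ⟨h1', h2', h3'⟩ := h'
  refine (MemLp.toLp_eq_toLp_iff h1 h1').1 ?_
  have := congrArg (fun z => 𝓕⁻ z) (h3.trans h3'.symm)
  simpa using this

/-- Smooth cutoff functions equal to one on larger and larger balls. -/
lemma exists_cutoff : ∃ (χ : ℕ → Space3 → ℝ) (C : ℝ), (∀ n, ContDiff ℝ ∞ (χ n)) ∧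
    (∀ n, HasCompactSupport (χ n)) ∧ (∀ n x, ‖χ n x‖ ≤ 1) ∧
    (∀ x, Tendsto (fun n => χ n x) atTop (𝓝 1)) ∧
    (∀ n x v, ‖fderiv ℝ (χ n) x v‖ ≤ C * ‖v‖) ∧
    (∀ x v, Tendsto (fun n => fderiv ℝ (χ n) x v) atTop (𝓝 0)) := by
  let b : ContDiffBump (0 : Space3) := ⟨1, 2, one_pos, one_lt_two⟩
  let r : ℕ → ℝ := fun n => 1 / ((n : ℝ) + 1)
  have hr : ∀ n, 0 < r n := fun n => by positivity
  have hr1 : ∀ n, r n ≤ 1 := fun n => by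
    simp only [r]; rw [div_le_one (by positivity)]; linarith [Nat.cast_nonneg (α := ℝ) n]
  have hr0 : Tendsto r atTop (𝓝 0) := tendsto_one_div_add_atTop_nhds_zero_nat
  have hb : ContDiff ℝ ∞ (b : Space3 → ℝ) := b.contDiff
  have hbc : HasCompactSupport (b : Space3 → ℝ) := b.hasCompactSupport
  obtain ⟨C, hC⟩ := (hbc.fderiv (𝕜 := ℝ)).exists_bound_of_continuous
    (hb.continuous_fderiv (by simp))
  have hC0 : 0 ≤ C := (norm_nonneg _).trans (hC 0)
  -- Rescaling by 1/(n+1) puts this factor on the gradient: it gives both the uniform bound and the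
  -- decay to zero.
  have hfd : ∀ n x v, fderiv ℝ (fun x => b (r n • x)) x v = r n * fderiv ℝ b (r n • x) v := by
    intro n x v
    have h1 : HasFDerivAt (fun x : Space3 => r n • x) (r n • ContinuousLinearMap.id ℝ Space3) x :=
      (hasFDerivAt_id x).const_smul (r n)
    have h2 := ((hb.differentiable (by simp)) (r n • x)).hasFDerivAt.comp x h1
    rw [show (fun x => b (r n • x)) = (b : Space3 → ℝ) ∘ fun x => r n • x from rfl, h2.fderiv]
    simp
  have hbd : ∀ n x v, ‖fderiv ℝ (fun x => b (r n • x)) x v‖ ≤ r n * (C * ‖v‖) := by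
    intro n x v
    rw [hfd, norm_mul, Real.norm_of_nonneg (hr n).le]
    exact mul_le_mul_of_nonneg_left (((fderiv ℝ b (r n • x)).le_opNorm v).trans
      (mul_le_mul_of_nonneg_right (hC _) (norm_nonneg _))) (hr n).le
  refine ⟨fun n x => b (r n • x), C, fun n => hb.comp (contDiff_const_smul _), fun n =>
    hbc.comp_smul (hr n).ne', fun n x => ?_, fun x => ?_, fun n x v => ?_, fun x v => ?_⟩
  · rw [Real.norm_of_nonneg b.nonneg]; exact b.le_one
  · have h : Tendsto (fun n => b (r n • x)) atTop (𝓝 (b ((0 : ℝ) • x))) :=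
      (hb.continuous.tendsto _).comp (hr0.smul_const x)
    rwa [zero_smul, b.one_of_mem_closedBall (by simp [b])] at h
  · exact (hbd n x v).trans (mul_le_of_le_one_left (by positivity) (hr1 n))
  · refine squeeze_zero_norm (hbd · x v) ?_
    simpa using hr0.mul_const (C * ‖v‖)

/-- An integral identity against the derivatives of compactly supported test functions extends to
Schwartz functions. -/
lemma sum_integral_lineDeriv_eq_zero {a : Fin 3 → Space3 → ℂ} (ha : ∀ k, MemLp (a k) 2 volume)
    (h : ∀ φ : Space3 → ℝ, ContDiff ℝ ∞ φ → HasCompactSupport φ →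
      ∑ k, ∫ x, a k x * (fderiv ℝ φ x (basisVec k) : ℝ) = 0) (ψ : 𝓢(Space3, ℂ)) :
    ∑ k, ∫ x, (∂_{basisVec k} ψ) x * a k x = 0 := by
  obtain ⟨χ, C, hχ, hχc, hχ1, hχt, hχd, hχdt⟩ := exists_cutoff
  have hψ : ContDiff ℝ ∞ (ψ : Space3 → ℂ) := ψ.smooth'
  have hdψ : ∀ x v, (∂_{v} ψ) x = fderiv ℝ ψ x v := fun x v => rfl
  have hψd : ∀ x, DifferentiableAt ℝ ψ x := fun x => hψ.differentiable (by simp) x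
  have hχdiff : ∀ n x, DifferentiableAt ℝ (χ n) x := fun n x => (hχ n).differentiable (by simp) x
  -- the derivative of a product of the cutoff and a real linear image of `ψ`
  have hL : ∀ (L : ℂ →L[ℝ] ℝ) n x v, fderiv ℝ (fun x => χ n x * L (ψ x)) x v
      = χ n x * L ((∂_{v} ψ) x) + fderiv ℝ (χ n) x v * L (ψ x) := by
    intro L n x v
    have h1 := ((hχdiff n x).hasFDerivAt).mul (L.hasFDerivAt.comp x (hψd x).hasFDerivAt)
    have h2 := h1.fderiv
    simp only [Function.comp_def] at h2
    rw [show (fun x => χ n x * L (ψ x)) = χ n * fun x => L (ψ x) from rfl, h2]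
    simp [hdψ, mul_comm]
  have hint1 : ∀ k, Integrable (fun x => (∂_{basisVec k} ψ) x * a k x) := fun k =>
    (SchwartzMap.memLp (∂_{basisVec k} ψ) 2 volume).integrable_mul (ha k)
  have hint0 : ∀ k, Integrable (fun x => ψ x * a k x) := fun k =>
    (SchwartzMap.memLp ψ 2 volume).integrable_mul (ha k)
  have hn : ∀ n, ∑ k, ∫ x, ((χ n x : ℂ) * (∂_{basisVec k} ψ) x
      + (fderiv ℝ (χ n) x (basisVec k) : ℝ) * ψ x) * a k x = 0 := by
    intro n
    -- Only real compactly supported test functions are allowed, so the cut-off Schwartz function is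
    -- tested through its real and imaginary parts, recombined below as p + i q.
    have hre := h (fun x => χ n x * Complex.reCLM (ψ x))
      ((hχ n).mul (Complex.reCLM.contDiff.comp hψ)) ((hχc n).mul_right)
    have him := h (fun x => χ n x * Complex.imCLM (ψ x))
      ((hχ n).mul (Complex.imCLM.contDiff.comp hψ)) ((hχc n).mul_right)
    have hI : ∀ (φ : Space3 → ℝ), ContDiff ℝ ∞ φ → HasCompactSupport φ → ∀ k,
        Integrable (fun x => a k x * (fderiv ℝ φ x (basisVec k) : ℝ)) := by
      intro φ h1 h2 k
      have := (SchwartzMap.memLp (∂_{basisVec k} (testSchwartz φ h1 h2)) 2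
        volume).integrable_mul (ha k)
      refine this.congr (ae_of_all _ fun x => ?_)
      simp only [Pi.mul_apply, lineDeriv_testSchwartz, mul_comm]
    have hsum := congrArg₂ (fun p q : ℂ => p + Complex.I * q) hre him
    simp only [mul_zero, add_zero, Finset.mul_sum, ← Finset.sum_add_distrib] at hsum
    rw [← hsum]
    refine Finset.sum_congr rfl fun k _ => ?_
    rw [← integral_const_mul, ← integral_add]
    · congr 1; ext x
      rw [hL, hL]
      simp only [Complex.reCLM_apply, Complex.imCLM_apply]
      push_cast
      have e1 := Complex.re_add_im (ψ x)
      have e2 := Complex.re_add_im ((∂_{basisVec k} ψ) x)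
      linear_combination (-(a k x * χ n x)) * e2
        - (a k x * ((fderiv ℝ (χ n) x (basisVec k) : ℝ) : ℂ)) * e1
    · exact hI _ ((hχ n).mul (Complex.reCLM.contDiff.comp hψ)) ((hχc n).mul_right) k
    · exact (hI _ ((hχ n).mul (Complex.imCLM.contDiff.comp hψ)) ((hχc n).mul_right) k).const_mul _
  have hlim : Tendsto (fun n => ∑ k, ∫ x, ((χ n x : ℂ) * (∂_{basisVec k} ψ) x
      + (fderiv ℝ (χ n) x (basisVec k) : ℝ) * ψ x) * a k x) atTop
      (𝓝 (∑ k, ∫ x, (∂_{basisVec k} ψ) x * a k x)) := by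
    refine tendsto_finsetSum _ fun k _ => ?_
    refine tendsto_integral_of_dominated_convergence (fun x => ‖(∂_{basisVec k} ψ) x * a k x‖
      + C * ‖basisVec k‖ * ‖ψ x * a k x‖) (fun n => ?_) ?_ (fun n => ?_) ?_
    · refine AEStronglyMeasurable.mul ?_ (ha k).1
      refine Continuous.aestronglyMeasurable ?_
      have c1 : Continuous (χ n) := (hχ n).continuous
      have c2 : Continuous fun x => fderiv ℝ (χ n) x (basisVec k) :=
        ((hχ n).continuous_fderiv (by simp)).clm_apply continuous_const
      have c3 : Continuous fun x => (∂_{basisVec k} ψ) x := SchwartzMap.continuous _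
      have c4 : Continuous ψ := SchwartzMap.continuous _
      fun_prop
    · exact (hint1 k).norm.add ((hint0 k).norm.const_mul _)
    · refine ae_of_all _ fun x => ?_
      rw [add_mul]
      refine (norm_add_le _ _).trans (add_le_add ?_ ?_)
      · rw [mul_assoc, norm_mul, Complex.norm_real]
        exact mul_le_of_le_one_left (norm_nonneg _) (hχ1 n x)
      · rw [mul_assoc, norm_mul, Complex.norm_real]
        exact mul_le_mul_of_nonneg_right (hχd n x _) (norm_nonneg _)
    · refine ae_of_all _ fun x => ?_
      have t1 : Tendsto (fun n => (χ n x : ℂ)) atTop (𝓝 ((1 : ℝ) : ℂ)) :=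
        (Complex.continuous_ofReal.tendsto _).comp (hχt x)
      have t2 : Tendsto (fun n => ((fderiv ℝ (χ n) x (basisVec k) : ℝ) : ℂ)) atTop
          (𝓝 ((0 : ℝ) : ℂ)) :=
        (Complex.continuous_ofReal.tendsto _).comp (hχdt x _)
      have := ((t1.mul_const ((∂_{basisVec k} ψ) x)).add (t2.mul_const (ψ x))).mul_const (a k x)
      simpa using this
  simp only [hn] at hlim
  exact (tendsto_nhds_unique hlim tendsto_const_nhds)

lemma ae_eq_zero_of_forall_integral_schwartz {A : Space3 → ℂ} (hA : LocallyIntegrable A)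
    (h : ∀ ψ : 𝓢(Space3, ℂ), ∫ ξ, ψ ξ * A ξ = 0) : ∀ᵐ ξ, A ξ = 0 := by
  refine ae_eq_zero_of_integral_contDiff_smul_eq_zero hA fun φ h1 h2 => ?_
  have := h (testSchwartz φ h1 h2)
  simpa [testSchwartz_apply] using this

/-- The Fourier transform of a weakly divergence free field is orthogonal to `ξ`. -/
lemma sum_symb_mul_eq_zero {a A : Fin 3 → Space3 → ℂ} (hA : ∀ k, IsFT (a k) (A k))
    (h : ∀ φ : Space3 → ℝ, ContDiff ℝ ∞ φ → HasCompactSupport φ →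
      ∑ k, ∫ x, a k x * (fderiv ℝ φ x (basisVec k) : ℝ) = 0) :
    ∀ᵐ ξ, ∑ k, symb k ξ * A k ξ = 0 := by
  have hloc : ∀ k, LocallyIntegrable (A k) := fun k =>
    (hA k).memLp_ft.locallyIntegrable (by norm_num)
  refine ae_eq_zero_of_forall_integral_schwartz ?_ fun ψ => ?_
  · refine locallyIntegrable_finsetSum _ fun k _ => ?_
    have := (hloc k).smul_continuous (continuous_symb k)
    refine this.congr (ae_of_all _ fun ξ => ?_)
    simp [mul_comm]
  -- Testing with a Fourier transform makes `ψ` itself appear on the frequency side.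
  · have h0 := sum_integral_lineDeriv_eq_zero (fun k => (hA k).memLp) h (𝓕 ψ)
    have e : ∀ k, ∫ x, (∂_{basisVec k} (𝓕 ψ)) x * a k x = ∫ ξ, -(ψ ξ * (symb k ξ * A k ξ)) := by
      intro k
      rw [(hA k).integral_schwartz_mul]
      congr 1; ext ξ
      rw [fourierInv_lineDeriv_apply, FourierTransform.fourierInv_fourier_eq]
      ring
    simp only [e] at h0
    rw [← integral_finsetSum] at h0
    · rw [← neg_eq_zero, ← h0, ← integral_neg]
      congr 1; ext ξ
      rw [Finset.mul_sum, Finset.sum_neg_distrib]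
    · intro k _
      have hg : (inner ℝ · (basisVec k) : Space3 → ℝ).HasTemperateGrowth := by fun_prop
      have := (SchwartzMap.memLp ((-(2 * Real.pi * Complex.I)) •
        SchwartzMap.smulLeftCLM ℂ (inner ℝ · (basisVec k)) ψ) 2 volume).integrable_mul
          (hA k).memLp_ft
      refine this.congr (ae_of_all _ fun ξ => ?_)
      rw [Pi.mul_apply, smul_apply, SchwartzMap.smulLeftCLM_apply_apply hg, inner_basisVec]
      simp only [symb, smul_eq_mul, Complex.real_smul]
      ring

end Bardina

/-! ### Inverse Fourier integrals of integrable functions. -/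

namespace Bardina
open scoped FourierTransform SchwartzMap LineDeriv ENNReal ComplexConjugate

/-- The sign of the inverse transform is absorbed into the bilinear form, so that the general theory
of `VectorFourier` applies to it. -/
lemma fourierInv_eq_vector (U : Space3 → ℂ) : (𝓕⁻ U : Space3 → ℂ)
    = VectorFourier.fourierIntegral 𝐞 volume (-innerSL ℝ : Space3 →L[ℝ] Space3 →L[ℝ] ℝ).toLinearMap₁₂
      U := by
  rfl

lemma continuous_fourierInv {U : Space3 → ℂ} (hU : Integrable U) : Continuous (𝓕⁻ U) := by
  rw [fourierInv_eq_vector]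
  exact VectorFourier.fourierIntegral_continuous Real.continuous_fourierChar
    (by simp; fun_prop) hU

lemma norm_fourierInv_le (U : Space3 → ℂ) (x : Space3) : ‖(𝓕⁻ U : Space3 → ℂ) x‖ ≤ ∫ ξ, ‖U ξ‖ := by
  rw [fourierInv_eq_vector]
  exact VectorFourier.norm_fourierIntegral_le_integral_norm _ _ _ _ _

lemma fourierInv_add {U V : Space3 → ℂ} (hU : Integrable U) (hV : Integrable V) (x : Space3) :
    (𝓕⁻ (fun ξ => U ξ + V ξ) : Space3 → ℂ) x = (𝓕⁻ U : Space3 → ℂ) x + (𝓕⁻ V : Space3 → ℂ) x := by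
  have := VectorFourier.fourierIntegral_add (μ := (volume : Measure Space3))
    (L := (-innerSL ℝ : Space3 →L[ℝ] Space3 →L[ℝ] ℝ).toLinearMap₁₂)
    Real.continuous_fourierChar (by simp; fun_prop) hU hV
  exact congrFun this.symm x |>.symm

lemma fourierInv_const_mul (c : ℂ) (U : Space3 → ℂ) (x : Space3) :
    (𝓕⁻ (fun ξ => c * U ξ) : Space3 → ℂ) x = c * (𝓕⁻ U : Space3 → ℂ) x := by
  simp only [Real.fourierInv_eq', smul_eq_mul]
  rw [← integral_const_mul]
  congr 1; ext ξ; ring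

lemma fourierInv_sub {U V : Space3 → ℂ} (hU : Integrable U) (hV : Integrable V) (x : Space3) :
    (𝓕⁻ (fun ξ => U ξ - V ξ) : Space3 → ℂ) x = (𝓕⁻ U : Space3 → ℂ) x - (𝓕⁻ V : Space3 → ℂ) x := by
  have e : (fun ξ => U ξ - V ξ) = fun ξ => U ξ + (-1) * V ξ := by ext; ring
  rw [e, fourierInv_add hU (hV.const_mul _), fourierInv_const_mul]; ring

lemma fourierInv_sum {ι : Type*} (s : Finset ι) {U : ι → Space3 → ℂ}
    (hU : ∀ i ∈ s, Integrable (U i)) (x : Space3) :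
    (𝓕⁻ (fun ξ => ∑ i ∈ s, U i ξ) : Space3 → ℂ) x = ∑ i ∈ s, (𝓕⁻ (U i) : Space3 → ℂ) x := by
  classical
  induction s using Finset.induction_on with
  | empty => simp [Real.fourierInv_eq']
  | insert a s ha ih =>
    simp only [Finset.sum_insert ha]
    rw [fourierInv_add (hU a (by simp)) (integrable_finsetSum _ fun i hi => hU i (by simp [hi])),
      ih fun i hi => hU i (by simp [hi])]

lemma integral_mul_fourierInv {f U : Space3 → ℂ} (hf : Integrable f) (hU : Integrable U) :
    ∫ x, f x * (𝓕⁻ U : Space3 → ℂ) x = ∫ ξ, (𝓕⁻ f : Space3 → ℂ) ξ * U ξ := by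
  have := VectorFourier.integral_fourierIntegral_smul_eq_flip
    (L := (-innerSL ℝ : Space3 →L[ℝ] Space3 →L[ℝ] ℝ).toLinearMap₁₂)
    Real.continuous_fourierChar (by simp; fun_prop) hf hU
  have e : (-innerSL ℝ : Space3 →L[ℝ] Space3 →L[ℝ] ℝ).toLinearMap₁₂.flip
    = (-innerSL ℝ : Space3 →L[ℝ] Space3 →L[ℝ] ℝ).toLinearMap₁₂ := by
    ext x y; simp [real_inner_comm]
  rw [e] at this
  exact this.symm

/-- The Riemann–Lebesgue lemma, composed with x ↦ −x. It makes the canonical pressure vanish at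
infinity. -/
lemma tendsto_fourierInv_cocompact (U : Space3 → ℂ) :
    Tendsto (𝓕⁻ U : Space3 → ℂ) (cocompact Space3) (𝓝 0) := by
  have h := tendsto_integral_exp_inner_smul_cocompact U
  have h2 := h.comp (Homeomorph.neg Space3).isClosedEmbedding.tendsto_cocompact
  refine h2.congr fun x => ?_
  simp only [Function.comp_apply, Real.fourierInv_eq]
  congr 1; ext v
  simp

/-- The honest inverse Fourier integral of a function in `L¹ ∩ L²` is its `L²` inverse Fourier
transform. -/
lemma isFT_fourierInv {U : Space3 → ℂ} (h1 : Integrable U) (h2 : MemLp U 2 volume) :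
    IsFT (𝓕⁻ U) U := by
  obtain ⟨g, hg⟩ := h2.exists_isFT_inv
  refine hg.congr ?_ (ae_eq_refl _)
  have hg1 : LocallyIntegrable g := hg.memLp.locallyIntegrable (by norm_num)
  have hc : LocallyIntegrable (𝓕⁻ U : Space3 → ℂ) := (continuous_fourierInv h1).locallyIntegrable
  have hbd : ∀ ψ : 𝓢(Space3, ℂ), Integrable fun x => ψ x * (𝓕⁻ U : Space3 → ℂ) x := fun ψ =>
    (SchwartzMap.integrable ψ).mul_bdd (c := ∫ ξ, ‖U ξ‖) (continuous_fourierInv h1).aestronglyMeasurable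
      (ae_of_all _ fun x => norm_fourierInv_le U x)
  have := ae_eq_zero_of_forall_integral_schwartz (hg1.sub hc) fun ψ => by
    have e : ∀ ξ, ψ ξ * (g - 𝓕⁻ U) ξ = ψ ξ * g ξ - ψ ξ * (𝓕⁻ U : Space3 → ℂ) ξ := fun ξ => by
      rw [Pi.sub_apply, mul_sub]
    have hi : Integrable fun x => ψ x * g x :=
      (SchwartzMap.memLp ψ 2 volume).integrable_mul hg.memLp
    simp only [e]
    rw [integral_sub hi (hbd ψ),
      hg.integral_schwartz_mul, integral_mul_fourierInv (SchwartzMap.integrable ψ) h1,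
      SchwartzMap.fourierInv_coe, sub_self]
  filter_upwards [this] with x hx
  exact sub_eq_zero.1 hx

/-- Both functions are continuous and agree almost everywhere, hence everywhere. This is how
pointwise statements about the classical solution become available on the Fourier side. -/
lemma IsFT.eq_fourierInv {f U : Space3 → ℂ} (h : IsFT f U) (hf : Continuous f)
    (hU : Integrable U) : f = 𝓕⁻ U :=
  (hf.ae_eq_iff_eq volume (continuous_fourierInv hU)).1
    (h.unique_inv (isFT_fourierInv hU h.memLp_ft))

lemma hasFDerivAt_fourierInv {U : Space3 → ℂ} (h0 : Integrable U)
    (h1 : Integrable fun ξ => ‖ξ‖ * ‖U ξ‖) (x : Space3) :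
    DifferentiableAt ℝ (𝓕⁻ U : Space3 → ℂ) x ∧ ∀ j, fderiv ℝ (𝓕⁻ U : Space3 → ℂ) x (basisVec j)
      = (𝓕⁻ (fun ξ => symb j ξ * U ξ) : Space3 → ℂ) x := by
  have h := VectorFourier.hasFDerivAt_fourierIntegral
    (-innerSL ℝ : Space3 →L[ℝ] Space3 →L[ℝ] ℝ) h0 h1 x
  refine ⟨h.differentiableAt, fun j => ?_⟩
  have hm : Integrable (VectorFourier.fourierSMulRight
      (-innerSL ℝ : Space3 →L[ℝ] Space3 →L[ℝ] ℝ) U) := by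
    refine (h1.const_mul (2 * Real.pi)).mono' h0.1.fourierSMulRight (ae_of_all _ fun ξ => ?_)
    refine (VectorFourier.norm_fourierSMulRight_le _ _ _).trans ?_
    have h2 : ‖(-innerSL ℝ : Space3 →L[ℝ] Space3 →L[ℝ] ℝ)‖ ≤ 1 := by
      refine ContinuousLinearMap.opNorm_le_bound₂ _ zero_le_one fun x y => ?_
      simpa using abs_real_inner_le_norm x y
    calc _ ≤ 2 * Real.pi * 1 * ‖ξ‖ * ‖U ξ‖ := by gcongr
      _ = _ := by ring
  rw [fourierInv_eq_vector, h.fderiv, Real.fourierIntegral_continuousLinearMap_apply' hm, fourierInv_eq_vector]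
  congr 1; ext ξ
  have e : innerSL ℝ ξ (basisVec j) = ξ j := inner_basisVec ξ j
  simp [VectorFourier.fourierSMulRight_apply, symb, e]
  ring

lemma contDiff_one_fourierInv {U : Space3 → ℂ} (h0 : Integrable U)
    (h1 : Integrable fun ξ => ‖ξ‖ * ‖U ξ‖) : ContDiff ℝ 1 (𝓕⁻ U : Space3 → ℂ) := by
  rw [fourierInv_eq_vector]
  refine VectorFourier.contDiff_fourierIntegral (N := 1)
    (-innerSL ℝ : Space3 →L[ℝ] Space3 →L[ℝ] ℝ) fun n hn => ?_
  have hn : n ≤ 1 := by exact_mod_cast hn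
  interval_cases n
  · simpa using h0.norm
  · simpa using h1

end Bardina

/-! ### The Helmholtz kernel as a mixture of Gaussians, and its Fourier multiplier. -/

namespace Bardina
open scoped FourierTransform SchwartzMap LineDeriv ENNReal ComplexConjugate

/-- `∫₀^∞ σ⁻² exp(-σ² - b²/σ²) dσ = √π exp(-2b) / (2b)`. -/
lemma integral_inv_sq_mul_exp {b : ℝ} (hb : 0 < b) :
    ∫ σ in Set.Ioi (0 : ℝ), 2 * b / σ ^ 2 * Real.exp (-σ ^ 2 - b ^ 2 / σ ^ 2)
      = √Real.pi * Real.exp (-(2 * b)) := by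
  let Φ : ℝ → ℝ := fun x => ∫ y in (0 : ℝ)..x, Real.exp (-y ^ 2)
  have hcont : Continuous fun y : ℝ => Real.exp (-y ^ 2) := by fun_prop
  have hΦ : ∀ x, HasDerivAt Φ (Real.exp (-x ^ 2)) x := fun x =>
    intervalIntegral.integral_hasDerivAt_right (hcont.intervalIntegrable _ _)
      (hcont.stronglyMeasurableAtFilter _ _) hcont.continuousAt
  have hint : Integrable fun y : ℝ => Real.exp (-y ^ 2) := by
    simpa using integrable_exp_neg_mul_sq one_pos
  have hΦtop : Tendsto Φ atTop (𝓝 (√Real.pi / 2)) := by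
    have := intervalIntegral_tendsto_integral_Ioi 0 hint.integrableOn tendsto_id
    have e : ∫ y in Set.Ioi (0 : ℝ), Real.exp (-y ^ 2) = √Real.pi / 2 := by
      simpa using integral_gaussian_Ioi 1
    rwa [e] at this
  have hΦodd : ∀ x, Φ (-x) = -Φ x := by
    intro x
    have := intervalIntegral.integral_comp_neg (a := 0) (b := x)
      (fun y : ℝ => Real.exp (-y ^ 2))
    simp only [neg_zero, even_two, Even.neg_pow] at this
    simp only [Φ]
    rw [intervalIntegral.integral_symm, ← this]
  have hΦbot : Tendsto Φ atBot (𝓝 (-(√Real.pi / 2))) := by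
    have := (hΦtop.comp tendsto_neg_atBot_atTop).neg
    refine this.congr fun x => ?_
    simp [hΦodd]
  -- An antiderivative of the integrand: since (σ ∓ b/σ)² = σ² + b²/σ² ∓ 2b, the two Gaussian
  -- primitives at σ ∓ b/σ, with weights exp(∓2b), have derivatives whose combination is the
  -- integrand. The first branch is the limit as σ → 0⁺, which makes `g` right continuous at 0,
  -- where b/σ would take its default value.
  let g : ℝ → ℝ := fun σ => if σ ≤ 0 then
      Real.exp (-(2 * b)) * (-(√Real.pi / 2)) - Real.exp (2 * b) * (√Real.pi / 2) else
    Real.exp (-(2 * b)) * Φ (σ - b / σ) - Real.exp (2 * b) * Φ (σ + b / σ)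
  have hgpos : ∀ σ, 0 < σ → g σ
      = Real.exp (-(2 * b)) * Φ (σ - b / σ) - Real.exp (2 * b) * Φ (σ + b / σ) :=
    fun σ hσ => if_neg hσ.not_ge
  have hinf : Tendsto (fun σ : ℝ => b / σ) atTop (𝓝 0) :=
    tendsto_const_nhds.div_atTop tendsto_id
  have h0 : Tendsto (fun σ : ℝ => b / σ) (𝓝[>] 0) atTop := by
    simpa [div_eq_mul_inv] using tendsto_inv_nhdsGT_zero.const_mul_atTop hb
  have hid : Tendsto (fun σ : ℝ => σ) (𝓝[>] 0) (𝓝 0) := tendsto_id.mono_left nhdsWithin_le_nhds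
  have hderiv : ∀ σ ∈ Set.Ioi (0 : ℝ), HasDerivAt g
      (2 * b / σ ^ 2 * Real.exp (-σ ^ 2 - b ^ 2 / σ ^ 2)) σ := by
    intro σ hσ
    have hσ' : σ ≠ 0 := (ne_of_gt hσ)
    have hd : HasDerivAt (fun s : ℝ => b / s) (-(b / σ ^ 2)) σ := by
      have := (hasDerivAt_inv hσ').const_mul b
      simpa [div_eq_mul_inv] using this
    have d1 := ((hΦ (σ - b / σ)).comp σ ((hasDerivAt_id σ).sub hd)).const_mul (Real.exp (-(2 * b)))
    have d2 := ((hΦ (σ + b / σ)).comp σ ((hasDerivAt_id σ).add hd)).const_mul (Real.exp (2 * b))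
    have d := d1.sub d2
    have e1 : Real.exp (-(2 * b)) * Real.exp (-(σ - b / σ) ^ 2)
        = Real.exp (-σ ^ 2 - b ^ 2 / σ ^ 2) := by
      rw [← Real.exp_add]; congr 1; field_simp; ring
    have e2 : Real.exp (2 * b) * Real.exp (-(σ + b / σ) ^ 2)
        = Real.exp (-σ ^ 2 - b ^ 2 / σ ^ 2) := by
      rw [← Real.exp_add]; congr 1; field_simp; ring
    have hval : Real.exp (-(2 * b)) * (Real.exp (-(σ - b / σ) ^ 2) * (1 - -(b / σ ^ 2)))
        - Real.exp (2 * b) * (Real.exp (-(σ + b / σ) ^ 2) * (1 + -(b / σ ^ 2)))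
        = 2 * b / σ ^ 2 * Real.exp (-σ ^ 2 - b ^ 2 / σ ^ 2) := by
      rw [← mul_assoc, ← mul_assoc, e1, e2]; ring
    rw [← hval]
    refine d.congr_of_eventuallyEq ?_
    filter_upwards [lt_mem_nhds hσ] with s hs
    rw [hgpos s hs]
    simp
  have hcw : ContinuousWithinAt g (Set.Ici 0) 0 := by
    rw [← continuousWithinAt_Ioi_iff_Ici]
    have hg0 : g 0 = Real.exp (-(2 * b)) * (-(√Real.pi / 2))
        - Real.exp (2 * b) * (√Real.pi / 2) := if_pos le_rfl
    have t : Tendsto (fun σ => Real.exp (-(2 * b)) * Φ (σ - b / σ)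
        - Real.exp (2 * b) * Φ (σ + b / σ)) (𝓝[>] 0) (𝓝 (g 0)) := by
      rw [hg0]
      refine ((hΦbot.comp ?_).const_mul _).sub ((hΦtop.comp ?_).const_mul _)
      · simpa [sub_eq_add_neg] using hid.add_atBot (tendsto_neg_atTop_atBot.comp h0)
      · exact hid.add_atTop h0
    refine t.congr' ?_
    filter_upwards [self_mem_nhdsWithin] with σ hσ
    exact (hgpos σ hσ).symm
  have htop : Tendsto g atTop (𝓝 (Real.exp (-(2 * b)) * (√Real.pi / 2)
      - Real.exp (2 * b) * (√Real.pi / 2))) := by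
    have t : Tendsto (fun σ => Real.exp (-(2 * b)) * Φ (σ - b / σ)
        - Real.exp (2 * b) * Φ (σ + b / σ)) atTop (𝓝 (Real.exp (-(2 * b)) * (√Real.pi / 2)
      - Real.exp (2 * b) * (√Real.pi / 2))) := by
      refine ((hΦtop.comp ?_).const_mul _).sub ((hΦtop.comp ?_).const_mul _)
      · simpa [sub_eq_add_neg] using tendsto_id.atTop_add hinf.neg
      · exact tendsto_id.atTop_add hinf
    refine t.congr' ?_
    filter_upwards [eventually_gt_atTop 0] with σ hσ
    exact (hgpos σ hσ).symm
  rw [integral_Ioi_of_hasDerivAt_of_nonneg hcw hderiv (fun σ hσ => by positivity) htop]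
  have hg0 : g 0 = Real.exp (-(2 * b)) * (-(√Real.pi / 2))
        - Real.exp (2 * b) * (√Real.pi / 2) := if_pos le_rfl
  rw [hg0]; ring

/-- The heat kernel mixture whose integral over `σ > 0` is the Helmholtz kernel. -/
noncomputable def heatMixture (α σ : ℝ) (x : Space3) : ℝ :=
  2 / ((2 * √Real.pi * α) ^ 3 * σ ^ 2) * Real.exp (-σ ^ 2 - ‖x‖ ^ 2 / (4 * α ^ 2 * σ ^ 2))

lemma integral_heatMixture {α : ℝ} (hα : 0 < α) {x : Space3} (hx : x ≠ 0) :
    ∫ σ in Set.Ioi (0 : ℝ), heatMixture α σ x = helmholtzKernel α x := by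
  have hx' : 0 < ‖x‖ := norm_pos_iff.2 hx
  have hb : 0 < ‖x‖ / (2 * α) := by positivity
  have hpi : √Real.pi ^ 2 = Real.pi := Real.sq_sqrt Real.pi_pos.le
  have hs : 0 < √Real.pi := Real.sqrt_pos.2 Real.pi_pos
  have e : ∀ σ : ℝ, heatMixture α σ x = (2 / ((2 * √Real.pi * α) ^ 3) / (2 * (‖x‖ / (2 * α))))
      * (2 * (‖x‖ / (2 * α)) / σ ^ 2
        * Real.exp (-σ ^ 2 - (‖x‖ / (2 * α)) ^ 2 / σ ^ 2)) := by
    intro σ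
    have : ‖x‖ ^ 2 / (4 * α ^ 2 * σ ^ 2) = (‖x‖ / (2 * α)) ^ 2 / σ ^ 2 := by
      rw [div_pow, mul_pow, div_div]; norm_num
    rw [heatMixture, this]
    field_simp
  simp only [e]
  rw [integral_const_mul, integral_inv_sq_mul_exp hb, helmholtzKernel,
    show 2 * (‖x‖ / (2 * α)) = ‖x‖ / α by field_simp]
  field_simp
  rw [hpi]
  ring

/-- The Fourier multiplier of the Helmholtz filter. -/
noncomputable def helmholtzSymb (α : ℝ) (ξ : Space3) : ℝ :=
  1 / (1 + 4 * Real.pi ^ 2 * α ^ 2 * ‖ξ‖ ^ 2)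

/-- For fixed σ this is a Gaussian with β = 1/(4α²σ²), whose integral over ℝ³ is (2√π α σ)³; the
normalisation of `heatMixture` reduces the prefactor to 2σ. -/
lemma fourier_heatMixture {α σ : ℝ} (hα : 0 < α) (hσ : 0 < σ) (ξ : Space3) :
    Integrable (heatMixture α σ) ∧
    ∫ x, 𝐞 (-inner ℝ x ξ) • (heatMixture α σ x : ℂ)
      = ((2 * σ * Real.exp (-(1 + 4 * Real.pi ^ 2 * α ^ 2 * ‖ξ‖ ^ 2) * σ ^ 2) : ℝ) : ℂ) := by
  have hs : 0 < √Real.pi := Real.sqrt_pos.2 Real.pi_pos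
  have hpi : √Real.pi ^ 2 = Real.pi := Real.sq_sqrt Real.pi_pos.le
  set β : ℝ := 1 / (4 * α ^ 2 * σ ^ 2) with hβ
  have hβ0 : 0 < β := by positivity
  have hβ' : 0 < ((β : ℝ) : ℂ).re := by simpa using hβ0
  have e : ∀ x : Space3, (heatMixture α σ x : ℂ)
      = ((2 / ((2 * √Real.pi * α) ^ 3 * σ ^ 2) * Real.exp (-σ ^ 2) : ℝ) : ℂ)
        * Complex.exp (-(β : ℂ) * ‖x‖ ^ 2) := by
    intro x
    have h1 : Complex.exp (-(β : ℂ) * ‖x‖ ^ 2) = ((Real.exp (-β * ‖x‖ ^ 2) : ℝ) : ℂ) := by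
      push_cast; rfl
    rw [h1, ← Complex.ofReal_mul, heatMixture, mul_assoc _ (Real.exp _), ← Real.exp_add]
    congr 3
    rw [hβ]; ring
  have hI : Integrable fun x : Space3 => (heatMixture α σ x : ℂ) := by
    simp only [e]
    have := GaussianFourier.integrable_cexp_neg_mul_sq_norm_add hβ' 0 (0 : Space3)
    simp only [zero_mul, add_zero] at this
    exact this.const_mul _
  refine ⟨by simpa using hI.re, ?_⟩
  have hF := fourier_gaussian_innerProductSpace hβ' ξ
  rw [Real.fourier_eq] at hF
  have e2 : ∀ x : Space3, 𝐞 (-inner ℝ x ξ) • (heatMixture α σ x : ℂ)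
      = ((2 / ((2 * √Real.pi * α) ^ 3 * σ ^ 2) * Real.exp (-σ ^ 2) : ℝ) : ℂ)
        * (𝐞 (-inner ℝ x ξ) • Complex.exp (-(β : ℂ) * ‖x‖ ^ 2)) := by
    intro x
    rw [e, Circle.smul_def, Circle.smul_def, smul_eq_mul, smul_eq_mul]; ring
  simp only [e2]
  rw [integral_const_mul, hF]
  have hpow : ((Real.pi : ℂ) / β) ^ ((Module.finrank ℝ Space3 : ℂ) / 2)
      = (((2 * √Real.pi * α * σ) ^ 3 : ℝ) : ℂ) := by
    have h1 : (Real.pi : ℂ) / β = (((2 * √Real.pi * α * σ) ^ 2 : ℝ) : ℂ) := by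
      rw [← Complex.ofReal_div]
      congr 1
      rw [hβ, mul_pow, mul_pow, mul_pow, hpi]; field_simp; norm_num
    have h2 : ((Module.finrank ℝ Space3 : ℂ) / 2) = (((3 / 2 : ℝ)) : ℂ) := by
      simp
    rw [h1, h2, ← Complex.ofReal_cpow (by positivity)]
    congr 1
    rw [← Real.rpow_natCast (_) 2, ← Real.rpow_mul (by positivity)]
    norm_num
  have hexp : Complex.exp (-(Real.pi : ℂ) ^ 2 * ‖ξ‖ ^ 2 / β)
      = ((Real.exp (-(4 * Real.pi ^ 2 * α ^ 2 * ‖ξ‖ ^ 2) * σ ^ 2) : ℝ) : ℂ) := by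
    rw [Complex.ofReal_exp]
    congr 1
    rw [hβ]; push_cast; field_simp
  rw [hpow, hexp, ← Complex.ofReal_mul, ← Complex.ofReal_mul]
  congr 1
  rw [show -(1 + 4 * Real.pi ^ 2 * α ^ 2 * ‖ξ‖ ^ 2) * σ ^ 2
    = -σ ^ 2 + -(4 * Real.pi ^ 2 * α ^ 2 * ‖ξ‖ ^ 2) * σ ^ 2 by ring, Real.exp_add]
  field_simp

lemma integral_two_mul_exp {c : ℝ} (hc : 0 < c) :
    IntegrableOn (fun σ => 2 * σ * Real.exp (-c * σ ^ 2)) (Set.Ioi 0) ∧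
    ∫ σ in Set.Ioi (0 : ℝ), 2 * σ * Real.exp (-c * σ ^ 2) = 1 / c := by
  have hd : ∀ σ ∈ Set.Ici (0 : ℝ), HasDerivAt (fun σ => -(1 / c) * Real.exp (-c * σ ^ 2))
      (2 * σ * Real.exp (-c * σ ^ 2)) σ := by
    intro σ _
    have h1 : HasDerivAt (fun σ : ℝ => -c * σ ^ 2) (-c * (2 * σ)) σ := by
      simpa using (hasDerivAt_pow 2 σ).const_mul (-c)
    have h2 := h1.exp.const_mul (-(1 / c))
    have e : -(1 / c) * (Real.exp (-c * σ ^ 2) * (-c * (2 * σ)))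
        = 2 * σ * Real.exp (-c * σ ^ 2) := by field_simp
    rwa [e] at h2
  have ht : Tendsto (fun σ => -(1 / c) * Real.exp (-c * σ ^ 2)) atTop (𝓝 0) := by
    have h1 : Tendsto (fun σ : ℝ => -c * σ ^ 2) atTop atBot :=
      (tendsto_pow_atTop two_ne_zero).const_mul_atTop_of_neg (by linarith)
    simpa using (Real.tendsto_exp_atBot.comp h1).const_mul (-(1 / c))
  have hp : ∀ σ ∈ Set.Ioi (0 : ℝ), 0 ≤ 2 * σ * Real.exp (-c * σ ^ 2) := fun σ hσ => by
    have : 0 < σ := hσ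
    positivity
  refine ⟨integrableOn_Ioi_deriv_of_nonneg' hd hp ht, ?_⟩
  rw [integral_Ioi_of_hasDerivAt_of_nonneg' hd hp ht]
  simp

/-- The mixture is nonnegative for σ > 0, so its L¹ norm in x is its transform at ξ = 0, namely 2σ
exp(−σ²), which is integrable in σ. -/
lemma integrable_prod_heatMixture {α : ℝ} (hα : 0 < α) :
    Integrable (fun z : ℝ × Space3 => (heatMixture α z.1 z.2 : ℂ))
      ((volume.restrict (Set.Ioi 0)).prod volume) := by
  have hm : Measurable fun z : ℝ × Space3 => (heatMixture α z.1 z.2 : ℂ) := by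
    unfold heatMixture; fun_prop
  rw [integrable_prod_iff hm.aestronglyMeasurable]
  constructor
  · refine (ae_restrict_iff' measurableSet_Ioi).2 (ae_of_all _ fun σ hσ => ?_)
    exact (fourier_heatMixture hα hσ 0).1.ofReal
  · have h1 := (integral_two_mul_exp one_pos).1
    refine h1.congr ?_
    refine (ae_restrict_iff' measurableSet_Ioi).2 (ae_of_all _ fun σ hσ => ?_)
    have h2 := (fourier_heatMixture hα hσ 0).2
    have hnn : ∀ x, 0 ≤ heatMixture α σ x := fun x => by
      have : 0 < σ := hσ
      unfold heatMixture; positivity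
    simp only [inner_zero_right, neg_zero, AddChar.map_zero_eq_one, one_smul, norm_zero, ne_eq,
      OfNat.ofNat_ne_zero, not_false_eq_true, zero_pow, mul_zero, add_zero] at h2
    rw [integral_complex_ofReal] at h2
    have h3 := Complex.ofReal_injective h2
    refine h3.symm.trans ?_
    refine integral_congr_ae (ae_of_all _ fun x => ?_)
    simp [abs_of_nonneg (hnn x)]

lemma helmholtzKernel_ae {α : ℝ} (hα : 0 < α) :
    (fun x => ∫ σ in Set.Ioi (0 : ℝ), (heatMixture α σ x : ℂ))
      =ᵐ[volume] fun x => (helmholtzKernel α x : ℂ) := by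
  have : ∀ᵐ x : Space3, x ≠ 0 := by
    simp [ae_iff]
  filter_upwards [this] with x hx
  rw [integral_complex_ofReal, integral_heatMixture hα hx]

lemma integrable_helmholtzKernel {α : ℝ} (hα : 0 < α) :
    Integrable fun x => (helmholtzKernel α x : ℂ) :=
  (integrable_prod_heatMixture hα).integral_prod_right.congr (helmholtzKernel_ae hα)

/-- By Fubini the transform is the integral over σ of the Gaussian transforms 2σ exp(−cσ²), with c =
1 + 4π²α²|ξ|²; this integral is 1/c. -/
lemma fourier_helmholtzKernel {α : ℝ} (hα : 0 < α) (ξ : Space3) :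
    (𝓕 (fun x => (helmholtzKernel α x : ℂ)) : Space3 → ℂ) ξ = (helmholtzSymb α ξ : ℂ) := by
  rw [← Real.fourier_congr_ae (helmholtzKernel_ae hα), Real.fourier_eq]
  have hI : Integrable (fun z : ℝ × Space3 => 𝐞 (-inner ℝ z.2 ξ) • (heatMixture α z.1 z.2 : ℂ))
      ((volume.restrict (Set.Ioi 0)).prod volume) := by
    refine (integrable_prod_heatMixture hα).mono ?_ (ae_of_all _ fun z => by simp)
    have hc : Continuous fun z : ℝ × Space3 => -inner ℝ z.2 ξ := by fun_prop
    exact (Real.continuous_fourierChar.comp hc).aestronglyMeasurable.smul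
      (integrable_prod_heatMixture hα).1
  have e : ∀ x : Space3, 𝐞 (-inner ℝ x ξ) • ∫ σ in Set.Ioi (0 : ℝ), (heatMixture α σ x : ℂ)
      = ∫ σ in Set.Ioi (0 : ℝ), 𝐞 (-inner ℝ x ξ) • (heatMixture α σ x : ℂ) := by
    intro x
    simp only [Circle.smul_def]
    rw [integral_smul]
  simp only [e]
  rw [← integral_integral_swap hI]
  have hc : 0 < 1 + 4 * Real.pi ^ 2 * α ^ 2 * ‖ξ‖ ^ 2 := by positivity
  rw [helmholtzSymb, ← (integral_two_mul_exp hc).2, ← integral_complex_ofReal]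
  refine setIntegral_congr_fun measurableSet_Ioi fun σ hσ => ?_
  exact (fourier_heatMixture hα hσ ξ).2

/-- The Helmholtz filter acts on the Fourier side as a multiplier. -/
lemma filtered_eq_fourierInv {α : ℝ} (hα : 0 < α) {ψ : Space3 → ℝ} {N : Space3 → ℂ}
    (hN : Integrable N) (hψ : ∀ x, (ψ x : ℂ) = (𝓕⁻ N : Space3 → ℂ) x) (x : Space3) :
    ((filtered α ψ x : ℝ) : ℂ) = (𝓕⁻ (fun ξ => (helmholtzSymb α ξ : ℂ) * N ξ) : Space3 → ℂ) x := by
  have h1 : ((filtered α ψ x : ℝ) : ℂ) = ∫ z, (helmholtzKernel α z : ℂ) * (𝓕⁻ N : Space3 → ℂ) (x - z) := by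
    rw [filtered, ← integral_complex_ofReal, ← integral_sub_left_eq_self _ volume x]
    refine integral_congr_ae (ae_of_all _ fun z => ?_)
    simp only [sub_sub_cancel, smul_eq_mul, Complex.ofReal_mul, hψ]
  have hM : Integrable fun ξ : Space3 => 𝐞 (-inner ℝ ξ x) • N (-ξ) := by
    refine hN.comp_neg.mono ?_ (ae_of_all _ fun z => by simp)
    have hc : Continuous fun ξ : Space3 => -inner ℝ ξ x := by fun_prop
    exact (Real.continuous_fourierChar.comp hc).aestronglyMeasurable.smul hN.comp_neg.1
  -- The translate and reflection in z is again an inverse transform, of a modulated and reflected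
  -- `N`; the multiplication formula then applies to the convolution.
  have h2 : ∀ z, (𝓕⁻ N : Space3 → ℂ) (x - z)
      = (𝓕⁻ (fun ξ : Space3 => 𝐞 (-inner ℝ ξ x) • N (-ξ)) : Space3 → ℂ) z := by
    intro z
    rw [Real.fourierInv_eq, Real.fourierInv_eq, ← integral_neg_eq_self]
    refine integral_congr_ae (ae_of_all _ fun ξ => ?_)
    simp only [smul_smul, ← AddChar.map_add_eq_mul]
    congr 2
    simp [inner_sub_right]; ring
  simp only [h2] at h1
  rw [h1, integral_mul_fourierInv (integrable_helmholtzKernel hα) hM, Real.fourierInv_eq,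
    ← integral_neg_eq_self]
  refine integral_congr_ae (ae_of_all _ fun ξ => ?_)
  simp only [Real.fourierInv_eq_fourier_neg, fourier_helmholtzKernel hα, neg_neg, inner_neg_left,
    helmholtzSymb, Circle.smul_def, smul_eq_mul]
  ring

end Bardina

/-! ### Convolution in weighted L²: the algebra property of H². -/

namespace Bardina
open scoped FourierTransform SchwartzMap LineDeriv ENNReal NNReal ComplexConjugate

/-- Cauchy–Schwarz after writing b as b^{1/2} b^{1/2} and giving one factor to a. -/
lemma sq_lintegral_mul_le {X : Type*} [MeasurableSpace X] (μ : Measure X) {a b : X → ℝ≥0∞}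
    (ha : AEMeasurable a μ) (hb : AEMeasurable b μ) :
    (∫⁻ x, a x * b x ∂μ) ^ 2 ≤ (∫⁻ x, a x ^ 2 * b x ∂μ) * ∫⁻ x, b x ∂μ := by
  have h := ENNReal.lintegral_mul_le_Lp_mul_Lq μ (p := 2) (q := 2)
    Real.HolderConjugate.two_two (f := fun x => a x * b x ^ (1 / 2 : ℝ))
    (g := fun x => b x ^ (1 / 2 : ℝ)) (ha.mul (hb.pow_const _)) (hb.pow_const _)
  have hsq : ∀ y : ℝ≥0∞, (y ^ (1 / 2 : ℝ)) ^ (2 : ℝ) = y := fun y => by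
    rw [← ENNReal.rpow_mul]; norm_num
  have hmul : ∀ y : ℝ≥0∞, y ^ (1 / 2 : ℝ) * y ^ (1 / 2 : ℝ) = y := fun y => by
    rw [← ENNReal.rpow_add_of_nonneg _ _ (by norm_num) (by norm_num)]; norm_num
  have e1 : ∀ x, ((fun x => a x * b x ^ (1 / 2 : ℝ)) * fun x => b x ^ (1 / 2 : ℝ)) x
      = a x * b x := fun x => by
    simp only [Pi.mul_apply]
    rw [mul_assoc, hmul]
  have e2 : ∀ x, (a x * b x ^ (1 / 2 : ℝ)) ^ (2 : ℝ) = a x ^ 2 * b x := fun x => by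
    rw [ENNReal.mul_rpow_of_nonneg _ _ (by norm_num), hsq, ENNReal.rpow_two]
  simp only [e1, e2, hsq] at h
  calc _ ≤ ((∫⁻ x, a x ^ 2 * b x ∂μ) ^ (1 / 2 : ℝ) * (∫⁻ x, b x ∂μ) ^ (1 / 2 : ℝ)) ^ 2 := by
        gcongr
    _ = _ := by
        rw [mul_pow, ← ENNReal.rpow_two, ← ENNReal.rpow_two, hsq, hsq]

/-- Young's inequality `L² ⋆ L¹ ⊂ L²`. -/
lemma lintegral_sq_convolution_le {a b : Space3 → ℝ≥0∞} (ha : AEMeasurable a volume)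
    (hb : AEMeasurable b volume) :
    ∫⁻ ξ, (∫⁻ t, a t * b (ξ - t)) ^ 2 ≤ (∫⁻ t, b t) ^ 2 * ∫⁻ t, a t ^ 2 := by
  have hbsub : ∀ ξ : Space3, AEMeasurable (fun t => b (ξ - t)) volume := fun ξ =>
    hb.comp_quasiMeasurePreserving (quasiMeasurePreserving_sub_left volume ξ)
  have hint : ∀ ξ : Space3, ∫⁻ t, b (ξ - t) = ∫⁻ t, b t := fun ξ =>
    lintegral_sub_left_eq_self b ξ
  have hjoint : AEMeasurable (fun z : Space3 × Space3 => a z.2 ^ 2 * b (z.1 - z.2))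
      (volume.prod volume) := by
    refine ((ha.comp_quasiMeasurePreserving Measure.quasiMeasurePreserving_snd).pow_const 2).mul ?_
    exact hb.comp_quasiMeasurePreserving (quasiMeasurePreserving_sub_of_right_invariant _ _)
  calc ∫⁻ ξ, (∫⁻ t, a t * b (ξ - t)) ^ 2
      ≤ ∫⁻ ξ, (∫⁻ t, a t ^ 2 * b (ξ - t)) * ∫⁻ t, b t := by
        refine lintegral_mono fun ξ => ?_
        have := sq_lintegral_mul_le volume ha (hbsub ξ)
        rwa [hint] at this
    _ ≤ (∫⁻ ξ, ∫⁻ t, a t ^ 2 * b (ξ - t)) * ∫⁻ t, b t := by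
        rw [lintegral_mul_const'' _ hjoint.lintegral_prod_right']
    _ = (∫⁻ t, a t ^ 2 * ∫⁻ ξ, b (ξ - t)) * ∫⁻ t, b t := by
        rw [lintegral_lintegral_swap hjoint]
        congr 1
        refine lintegral_congr fun t => ?_
        rw [lintegral_const_mul'']
        exact hb.comp_quasiMeasurePreserving (measurePreserving_sub_right volume t).quasiMeasurePreserving
    _ = _ := by
        simp only [lintegral_sub_right_eq_self b]
        rw [lintegral_mul_const'' _ (ha.pow_const 2)]
        ring

/-- The weight `1 + |ξ|²`. -/
noncomputable def wt (ξ : Space3) : ℝ := 1 + ‖ξ‖ ^ 2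

lemma wt_pos (ξ : Space3) : 0 < wt ξ := by unfold wt; positivity

lemma one_le_wt (ξ : Space3) : 1 ≤ wt ξ := by unfold wt; nlinarith [norm_nonneg ξ]

lemma norm_le_wt (ξ : Space3) : ‖ξ‖ ≤ wt ξ := by unfold wt; nlinarith [norm_nonneg ξ]

lemma continuous_wt : Continuous wt := by unfold wt; fun_prop

lemma wt_ne_zero (ξ : Space3) : (wt ξ : ℂ) ≠ 0 := by exact_mod_cast (wt_pos ξ).ne'

/-- This inequality lets the weight of a convolution be carried by one factor at a time. -/
lemma wt_le (ξ t : Space3) : wt ξ ≤ 2 * (wt t + wt (ξ - t)) := by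
  have h : ‖ξ‖ ≤ ‖t‖ + ‖ξ - t‖ := by simpa using norm_add_le t (ξ - t)
  unfold wt
  nlinarith [sq_nonneg (‖t‖ - ‖ξ - t‖), norm_nonneg ξ]

/-- Here the dimension enters: (1 + |ξ|²)⁻² decays like |ξ|⁻⁴, which is integrable at infinity
because 4 > 3. -/
lemma memLp_inv_wt : MemLp (fun ξ => (wt ξ : ℂ)⁻¹) 2 (volume : Measure Space3) := by
  have hc : Continuous fun ξ => (wt ξ : ℂ)⁻¹ :=
    (Complex.continuous_ofReal.comp continuous_wt).inv₀ wt_ne_zero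
  rw [memLp_two_iff_integrable_sq_norm hc.aestronglyMeasurable]
  have h := integrable_rpow_neg_one_add_norm_sq (E := Space3) (μ := volume) (r := 4) (by simp; norm_num)
  refine h.congr (ae_of_all _ fun ξ => ?_)
  have e : ‖(wt ξ : ℂ)⁻¹‖ = (wt ξ)⁻¹ := by
    rw [norm_inv, Complex.norm_real, Real.norm_of_nonneg (wt_pos ξ).le]
  simp only [e]
  rw [show (-(4 : ℝ) / 2) = -((2 : ℕ) : ℝ) by norm_num, Real.rpow_neg (by positivity),
    Real.rpow_natCast, inv_pow]
  rfl

/-- The `L²` norm of the inverse weight. -/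
noncomputable def wtConst : ℝ≥0∞ := eLpNorm (fun ξ => (wt ξ : ℂ)⁻¹) 2 (volume : Measure Space3)

lemma wtConst_ne_top : wtConst ≠ ⊤ := memLp_inv_wt.eLpNorm_ne_top

/-- Hölder with the square-integrable inverse weight: on the Fourier side, the embedding of H² into
bounded continuous functions. -/
lemma eLpNorm_one_le_of_wt {U : Space3 → ℂ} (h : AEStronglyMeasurable U volume) :
    eLpNorm U 1 volume ≤ wtConst * eLpNorm (fun ξ => wt ξ * U ξ) 2 volume := by
  have hc : Continuous fun ξ => (wt ξ : ℂ) := Complex.continuous_ofReal.comp continuous_wt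
  have := eLpNorm_smul_le_mul_eLpNorm (p := 2) (q := 2) (r := 1) (μ := (volume : Measure Space3))
    (hc.aestronglyMeasurable.mul h) memLp_inv_wt.1
  refine le_trans (le_of_eq ?_) this
  refine eLpNorm_congr_ae (ae_of_all _ fun ξ => ?_)
  exact (inv_mul_cancel_left₀ (wt_ne_zero ξ) (U ξ)).symm

lemma aestronglyMeasurable_of_wt {U : Space3 → ℂ}
    (h : AEStronglyMeasurable (fun ξ => wt ξ * U ξ) volume) : AEStronglyMeasurable U volume := by
  have := memLp_inv_wt.1.mul h
  refine this.congr (ae_of_all _ fun ξ => ?_)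
  exact inv_mul_cancel_left₀ (wt_ne_zero ξ) (U ξ)

lemma integrable_of_wt {U : Space3 → ℂ} (h : MemLp (fun ξ => wt ξ * U ξ) 2 volume) :
    Integrable U := by
  have hm := aestronglyMeasurable_of_wt h.1
  rw [← memLp_one_iff_integrable]
  exact ⟨hm, (eLpNorm_one_le_of_wt hm).trans_lt
    (ENNReal.mul_lt_top wtConst_ne_top.lt_top h.eLpNorm_lt_top)⟩

lemma memLp_of_wt {U : Space3 → ℂ} (h : MemLp (fun ξ => wt ξ * U ξ) 2 volume) :
    MemLp U 2 volume := by
  refine h.of_le (aestronglyMeasurable_of_wt h.1) (ae_of_all _ fun ξ => ?_)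
  rw [norm_mul, Complex.norm_real, Real.norm_of_nonneg (wt_pos ξ).le]
  exact le_mul_of_one_le_left (norm_nonneg _) (one_le_wt ξ)

/-- The convolution of two functions of the frequency. -/
noncomputable def conv (U V : Space3 → ℂ) (ξ : Space3) : ℂ := ∫ t, U t * V (ξ - t)

lemma integrable_mul_sub {U V : Space3 → ℂ} (hU : MemLp U 2 volume) (hV : MemLp V 2 volume)
    (ξ : Space3) : Integrable fun t => U t * V (ξ - t) :=
  hU.integrable_mul (hV.comp_measurePreserving (Measure.measurePreserving_sub_left volume ξ))

lemma integrable_conv {U V : Space3 → ℂ} (hU : Integrable U) (hV : Integrable V) :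
    Integrable (conv U V) :=
  hU.integrable_convolution (ContinuousLinearMap.mul ℂ ℂ) hV

lemma fourierInv_conv {U V : Space3 → ℂ} (hU : Integrable U) (hV : Integrable V) (x : Space3) :
    (𝓕⁻ (conv U V) : Space3 → ℂ) x = (𝓕⁻ U : Space3 → ℂ) x * (𝓕⁻ V : Space3 → ℂ) x := by
  simp only [Real.fourierInv_eq_fourier_neg]
  exact Real.fourier_mul_convolution_eq hU hV (-x)

/-- Bilinearity in the form needed for continuity in time. Square integrability ensures that every
convolution integral converges at every ξ, so the identity is pointwise. -/
lemma conv_sub_conv {U V U' V' : Space3 → ℂ} (hU : MemLp U 2 volume) (hV : MemLp V 2 volume)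
    (hU' : MemLp U' 2 volume) (hV' : MemLp V' 2 volume) (ξ : Space3) :
    conv U V ξ - conv U' V' ξ = conv (U - U') V ξ + conv U' (V - V') ξ := by
  simp only [conv]
  rw [← integral_sub (integrable_mul_sub hU hV ξ) (integrable_mul_sub hU' hV' ξ),
    ← integral_add (integrable_mul_sub (hU.sub hU') hV ξ) (integrable_mul_sub hU' (hV.sub hV') ξ)]
  congr 1; ext t
  simp only [Pi.sub_apply]; ring

lemma eLpNorm_two_sq (f : Space3 → ℂ) :
    eLpNorm f 2 volume ^ 2 = ∫⁻ ξ, ‖f ξ‖ₑ ^ 2 := by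
  have := eLpNorm_nnreal_pow_eq_lintegral (f := f) (μ := (volume : Measure Space3)) (p := 2)
    two_ne_zero
  simpa using this

/-- By `wt_le` the weight falls on one of the two factors; Young's inequality L² ⋆ L¹ ⊂ L² bounds
each piece, the unweighted factor being in L¹ by `eLpNorm_one_le_of_wt`. -/
lemma eLpNorm_wt_conv_le {U V : Space3 → ℂ} (hU : MemLp (fun ξ => wt ξ * U ξ) 2 volume)
    (hV : MemLp (fun ξ => wt ξ * V ξ) 2 volume) :
    eLpNorm (fun ξ => wt ξ * conv U V ξ) 2 volume ≤ 4 * wtConst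
      * eLpNorm (fun ξ => wt ξ * U ξ) 2 volume * eLpNorm (fun ξ => wt ξ * V ξ) 2 volume := by
  have mU := aestronglyMeasurable_of_wt hU.1
  have mV := aestronglyMeasurable_of_wt hV.1
  set A : Space3 → ℝ≥0∞ := fun ξ => ∫⁻ t, ‖(wt t : ℂ) * U t‖ₑ * ‖V (ξ - t)‖ₑ with hA
  set B : Space3 → ℝ≥0∞ := fun ξ => ∫⁻ t, ‖(wt t : ℂ) * V t‖ₑ * ‖U (ξ - t)‖ₑ with hB
  have hsubV : ∀ ξ, AEMeasurable (fun t => ‖V (ξ - t)‖ₑ) volume := fun ξ =>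
    mV.enorm.comp_quasiMeasurePreserving (quasiMeasurePreserving_sub_left volume ξ)
  have hpt : ∀ ξ, ‖(wt ξ : ℂ) * conv U V ξ‖ₑ ≤ 2 * A ξ + 2 * B ξ := by
    intro ξ
    -- `B` is stated with the weighted factor at t, as Young's inequality wants it; the reflection t
    -- ↦ ξ − t brings it back to the integrand of the convolution.
    have hBc : B ξ = ∫⁻ t, ‖(wt (ξ - t) : ℂ) * V (ξ - t)‖ₑ * ‖U t‖ₑ := by
      rw [hB, ← lintegral_sub_left_eq_self _ ξ]
      simp
    rw [hBc, hA]
    simp only []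
    have hm : AEMeasurable (fun t => 2 * (‖(wt t : ℂ) * U t‖ₑ * ‖V (ξ - t)‖ₑ)) volume :=
      (hU.1.enorm.mul (hsubV ξ)).const_mul 2
    rw [← lintegral_const_mul' 2 _ (by norm_num), ← lintegral_const_mul' 2 _ (by norm_num),
      ← lintegral_add_left' hm, conv, ← integral_const_mul]
    refine (enorm_integral_le_lintegral_enorm _).trans (lintegral_mono fun t => ?_)
    have h2 : ENNReal.ofReal (wt ξ) ≤ 2 * (ENNReal.ofReal (wt t) + ENNReal.ofReal (wt (ξ - t))) := by
      refine (ENNReal.ofReal_le_ofReal (wt_le ξ t)).trans (le_of_eq ?_)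
      rw [ENNReal.ofReal_mul zero_le_two, ENNReal.ofReal_ofNat,
        ENNReal.ofReal_add (wt_pos _).le (wt_pos _).le]
    have hw : ∀ ζ, ‖(wt ζ : ℂ)‖ₑ = ENNReal.ofReal (wt ζ) := fun ζ => by
      rw [← ofReal_norm, Complex.norm_real, Real.norm_of_nonneg (wt_pos ζ).le]
    simp only [enorm_mul, hw]
    calc _ ≤ 2 * (ENNReal.ofReal (wt t) + ENNReal.ofReal (wt (ξ - t))) * (‖U t‖ₑ * ‖V (ξ - t)‖ₑ) := by
          gcongr
      _ = _ := by ring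
  have young : ∀ {f g : Space3 → ℂ}, AEStronglyMeasurable f volume → AEStronglyMeasurable g volume →
      (∫⁻ ξ, (∫⁻ t, ‖f t‖ₑ * ‖g (ξ - t)‖ₑ) ^ 2) ≤ (eLpNorm g 1 volume * eLpNorm f 2 volume) ^ 2 := by
    intro f g hf hg
    refine (lintegral_sq_convolution_le hf.enorm hg.enorm).trans (le_of_eq ?_)
    rw [mul_pow, eLpNorm_two_sq, eLpNorm_one_eq_lintegral_enorm]
  have hfin : (∫⁻ ξ, ‖(wt ξ : ℂ) * conv U V ξ‖ₑ ^ 2) ≤ (4 * wtConst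
      * eLpNorm (fun ξ => wt ξ * U ξ) 2 volume * eLpNorm (fun ξ => wt ξ * V ξ) 2 volume) ^ 2 := by
    have hAm : AEMeasurable A volume := by
      have : AEMeasurable (fun z : Space3 × Space3 => ‖(wt z.2 : ℂ) * U z.2‖ₑ * ‖V (z.1 - z.2)‖ₑ)
          (volume.prod volume) := by
        refine ((hU.1.enorm).comp_quasiMeasurePreserving
          Measure.quasiMeasurePreserving_snd).mul ?_
        exact mV.enorm.comp_quasiMeasurePreserving
          (quasiMeasurePreserving_sub_of_right_invariant _ _)
      exact this.lintegral_prod_right'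
    set P := eLpNorm (fun ξ => wt ξ * U ξ) 2 volume
    set Q := eLpNorm (fun ξ => wt ξ * V ξ) 2 volume
    have hA2 : ∫⁻ ξ, A ξ ^ 2 ≤ (wtConst * Q * P) ^ 2 :=
      (young hU.1 mV).trans (by gcongr; exact eLpNorm_one_le_of_wt mV)
    have hB2 : ∫⁻ ξ, B ξ ^ 2 ≤ (wtConst * P * Q) ^ 2 :=
      (young hV.1 mU).trans (by gcongr; exact eLpNorm_one_le_of_wt mU)
    -- (2A + 2B)² ≤ 2((2A)² + (2B)²) gives the two 8s, and 8 + 8 = 4² gives the constant of the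
    -- statement.
    calc ∫⁻ ξ, ‖(wt ξ : ℂ) * conv U V ξ‖ₑ ^ 2 ≤ ∫⁻ ξ, (8 * A ξ ^ 2 + 8 * B ξ ^ 2) := by
          refine lintegral_mono fun ξ => ?_
          calc _ ≤ (2 * A ξ + 2 * B ξ) ^ 2 := by gcongr; exact hpt ξ
            _ ≤ 2 * ((2 * A ξ) ^ 2 + (2 * B ξ) ^ 2) := by
              have := ENNReal.rpow_add_le_mul_rpow_add_rpow (2 * A ξ) (2 * B ξ) (p := 2)
                (by norm_num)
              simp only [ENNReal.rpow_two] at this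
              norm_num at this
              exact this
            _ = _ := by ring
      _ = 8 * (∫⁻ ξ, A ξ ^ 2) + 8 * ∫⁻ ξ, B ξ ^ 2 := by
          rw [lintegral_add_left' ((hAm.pow_const 2).const_mul _),
            lintegral_const_mul' _ _ (by norm_num), lintegral_const_mul' _ _ (by norm_num)]
      _ ≤ 8 * (wtConst * Q * P) ^ 2 + 8 * (wtConst * P * Q) ^ 2 := by gcongr
      _ = _ := by ring
  rw [← eLpNorm_two_sq] at hfin
  exact (ENNReal.pow_le_pow_left_iff two_ne_zero).1 hfin

lemma memLp_wt_conv {U V : Space3 → ℂ} (hU : MemLp (fun ξ => wt ξ * U ξ) 2 volume)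
    (hV : MemLp (fun ξ => wt ξ * V ξ) 2 volume) :
    MemLp (fun ξ => wt ξ * conv U V ξ) 2 volume := by
  have hc : Continuous fun ξ => (wt ξ : ℂ) := Complex.continuous_ofReal.comp continuous_wt
  refine ⟨hc.aestronglyMeasurable.mul (integrable_conv (integrable_of_wt hU)
    (integrable_of_wt hV)).1, (eLpNorm_wt_conv_le hU hV).trans_lt ?_⟩
  exact ENNReal.mul_lt_top (ENNReal.mul_lt_top (ENNReal.mul_lt_top (by norm_num)
    wtConst_ne_top.lt_top) hU.eLpNorm_lt_top) hV.eLpNorm_lt_top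

end Bardina

/-! ### Continuous curves in L² and the operations that preserve them. -/

namespace Bardina
open scoped FourierTransform SchwartzMap LineDeriv ENNReal NNReal ComplexConjugate

/-- Curves of complex functions which are continuous into `L²`. -/
def L2Curve (S : Set ℝ) (f : ℝ → Space3 → ℂ) : Prop :=
  ∀ t ∈ S, MemLp (f t) 2 volume ∧
    Tendsto (fun s => eLpNorm (f s - f t) 2 volume) (𝓝[S] t) (𝓝 0)

variable {S : Set ℝ}

lemma tendsto_zero_of_le_mul {f g : ℝ → ℝ≥0∞} {t : ℝ} {C : ℝ≥0∞} (hC : C ≠ ⊤)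
    (hf : Tendsto f (𝓝[S] t) (𝓝 0)) (h : ∀ s ∈ S, g s ≤ C * f s) :
    Tendsto g (𝓝[S] t) (𝓝 0) := by
  have h1 : Tendsto (fun s => C * f s) (𝓝[S] t) (𝓝 0) := by
    simpa using ENNReal.Tendsto.const_mul hf (Or.inr hC)
  refine tendsto_of_tendsto_of_tendsto_of_le_of_le' tendsto_const_nhds h1
    (Eventually.of_forall fun _ => zero_le) ?_
  filter_upwards [self_mem_nhdsWithin] with s hs using h s hs

/-- Most stability properties below are Lipschitz estimates between increments of curves and reduce
to this comparison. -/
lemma L2Curve.of_le {f g : ℝ → Space3 → ℂ} (hf : L2Curve S f) {C : ℝ≥0∞} (hC : C ≠ ⊤)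
    (hg : ∀ t ∈ S, MemLp (g t) 2 volume)
    (h : ∀ t ∈ S, ∀ s ∈ S, eLpNorm (g s - g t) 2 volume ≤ C * eLpNorm (f s - f t) 2 volume) :
    L2Curve S g := fun t ht =>
  ⟨hg t ht, tendsto_zero_of_le_mul hC (hf t ht).2 (h t ht)⟩

lemma L2Curve.congr {f g : ℝ → Space3 → ℂ} (hf : L2Curve S f)
    (h : ∀ t ∈ S, f t =ᵐ[volume] g t) : L2Curve S g :=
  hf.of_le ENNReal.one_ne_top (fun t ht => (memLp_congr_ae (h t ht)).1 (hf t ht).1)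
    fun t ht s hs => by
      rw [one_mul, eLpNorm_congr_ae ((h s hs).sub (h t ht))]

lemma L2Curve.mul_bdd {f : ℝ → Space3 → ℂ} (hf : L2Curve S f) {m : Space3 → ℂ}
    (hm : Measurable m) {C : ℝ} (hC : ∀ ξ, ‖m ξ‖ ≤ C) : L2Curve S (fun t ξ => m ξ * f t ξ) := by
  refine hf.of_le (C := ENNReal.ofReal C) ENNReal.ofReal_ne_top (fun t ht => ?_) fun t ht s hs => ?_
  · refine (hf t ht).1.of_le_mul (c := C) (hm.aestronglyMeasurable.mul (hf t ht).1.1)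
      (ae_of_all _ fun ξ => ?_)
    rw [norm_mul]
    exact mul_le_mul_of_nonneg_right (hC ξ) (norm_nonneg _)
  · refine eLpNorm_le_mul_eLpNorm_of_ae_le_mul (ae_of_all _ fun ξ => ?_) 2
    simp only [Pi.sub_apply, ← mul_sub, norm_mul]
    exact mul_le_mul_of_nonneg_right (hC ξ) (norm_nonneg _)

lemma L2Curve.const_mul {f : ℝ → Space3 → ℂ} (hf : L2Curve S f) (c : ℂ) :
    L2Curve S (fun t ξ => c * f t ξ) :=
  hf.mul_bdd (m := fun _ => c) measurable_const (C := ‖c‖) fun _ => le_rfl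

lemma L2Curve.add {f g : ℝ → Space3 → ℂ} (hf : L2Curve S f) (hg : L2Curve S g) :
    L2Curve S (fun t x => f t x + g t x) := by
  intro t ht
  refine ⟨(hf t ht).1.add (hg t ht).1, ?_⟩
  have h := (hf t ht).2.add (hg t ht).2
  rw [add_zero] at h
  refine tendsto_zero_of_le_mul ENNReal.one_ne_top h fun s hs => ?_
  rw [one_mul]
  refine le_trans (le_of_eq ?_) (eLpNorm_add_le ((hf s hs).1.sub (hf t ht).1).1
    ((hg s hs).1.sub (hg t ht).1).1 (by norm_num))
  congr 1; ext x
  simp only [Pi.sub_apply, Pi.add_apply]; ring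

lemma L2Curve.neg {f : ℝ → Space3 → ℂ} (hf : L2Curve S f) : L2Curve S (fun t x => -f t x) := by
  simpa using hf.const_mul (-1)

lemma L2Curve.sub {f g : ℝ → Space3 → ℂ} (hf : L2Curve S f) (hg : L2Curve S g) :
    L2Curve S (fun t x => f t x - g t x) := by
  simpa [sub_eq_add_neg] using hf.add hg.neg

lemma L2Curve.zero : L2Curve S (fun _ _ => 0) := fun t _ =>
  ⟨MemLp.zero, by simpa [Pi.sub_def] using tendsto_const_nhds⟩

lemma L2Curve.sum {ι : Type*} (s : Finset ι) {f : ι → ℝ → Space3 → ℂ}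
    (h : ∀ i ∈ s, L2Curve S (f i)) : L2Curve S (fun t x => ∑ i ∈ s, f i t x) := by
  classical
  induction s using Finset.induction_on with
  | empty => simpa using L2Curve.zero
  | insert a s ha ih =>
    simp only [Finset.sum_insert ha]
    exact (h a (by simp)).add (ih fun i hi => h i (by simp [hi]))

lemma L2Curve.ft {f U : ℝ → Space3 → ℂ} (hf : L2Curve S f) (h : ∀ t ∈ S, IsFT (f t) (U t)) :
    L2Curve S U :=
  hf.of_le ENNReal.one_ne_top (fun t ht => (h t ht).memLp_ft) fun t ht s hs => by
    rw [one_mul]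
    exact ((h s hs).sub (h t ht)).eLpNorm_eq.ge

lemma L2Curve.inv_ft {f U : ℝ → Space3 → ℂ} (hU : L2Curve S U) (h : ∀ t ∈ S, IsFT (f t) (U t)) :
    L2Curve S f :=
  hU.of_le ENNReal.one_ne_top (fun t ht => (h t ht).memLp) fun t ht s hs => by
    rw [one_mul]
    exact ((h s hs).sub (h t ht)).eLpNorm_eq.le

lemma l2Curve_ofReal {f : ℝ → Space3 → ℝ} (hf : ContinuousIntoL2 S f) :
    L2Curve S (fun t x => (f t x : ℂ)) := fun t ht =>
  ⟨(hf t ht).1.ofReal, (hf t ht).2.congr fun s => by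
    refine eLpNorm_congr_norm_ae (ae_of_all _ fun x => ?_)
    simp only [Pi.sub_apply, ← Complex.ofReal_sub, Complex.norm_real]⟩

lemma L2Curve.re {f : ℝ → Space3 → ℂ} (hf : L2Curve S f) :
    ContinuousIntoL2 S (fun t x => (f t x).re) := fun t ht =>
  ⟨(hf t ht).1.re, tendsto_zero_of_le_mul ENNReal.one_ne_top (hf t ht).2 fun s hs => by
    rw [one_mul]
    refine eLpNorm_mono fun x => ?_
    simp only [Pi.sub_apply, ← Complex.sub_re]
    exact Complex.abs_re_le_norm _⟩

lemma measurable_inv_wt : Measurable fun ξ => (wt ξ : ℂ)⁻¹ :=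
  ((Complex.continuous_ofReal.comp continuous_wt).inv₀ wt_ne_zero).measurable

lemma L2Curve.of_wt {U : ℝ → Space3 → ℂ} (h : L2Curve S fun t ξ => wt ξ * U t ξ) :
    L2Curve S U := by
  have := h.mul_bdd measurable_inv_wt (C := 1) fun ξ => by
    rw [norm_inv, Complex.norm_real, Real.norm_of_nonneg (wt_pos ξ).le]
    exact inv_le_one_of_one_le₀ (one_le_wt ξ)
  refine this.congr fun t _ => ae_of_all _ fun ξ => ?_
  exact inv_mul_cancel_left₀ (wt_ne_zero ξ) _

/-- A multiplier bounded by the weight may be applied to weighted curves. -/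
lemma L2Curve.mul_of_wt {U : ℝ → Space3 → ℂ} (h : L2Curve S fun t ξ => wt ξ * U t ξ)
    {m : Space3 → ℂ} (hm : Measurable m) {C : ℝ} (hC : ∀ ξ, ‖m ξ‖ ≤ C * wt ξ) :
    L2Curve S fun t ξ => m ξ * U t ξ := by
  have := h.mul_bdd (m := fun ξ => m ξ * (wt ξ : ℂ)⁻¹) (hm.mul measurable_inv_wt) (C := C)
    fun ξ => by
      rw [norm_mul, norm_inv, Complex.norm_real, Real.norm_of_nonneg (wt_pos ξ).le,
        ← div_eq_mul_inv, div_le_iff₀ (wt_pos ξ)]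
      exact hC ξ
  refine this.congr fun t _ => ae_of_all _ fun ξ => ?_
  simp only [mul_assoc]
  rw [inv_mul_cancel_left₀ (wt_ne_zero ξ)]

/-- The inverse Fourier integrals of a weighted curve depend continuously on time. -/
lemma L2Curve.continuousOn_fourierInv {U : ℝ → Space3 → ℂ}
    (h : L2Curve S fun t ξ => wt ξ * U t ξ) (x : Space3) :
    ContinuousOn (fun t => (𝓕⁻ (U t) : Space3 → ℂ) x) S := by
  intro t ht
  have hI : ∀ s ∈ S, Integrable (U s) := fun s hs => integrable_of_wt (h s hs).1
  have h1 : Tendsto (fun s => eLpNorm (U s - U t) 1 volume) (𝓝[S] t) (𝓝 0) := by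
    refine tendsto_zero_of_le_mul wtConst_ne_top (h t ht).2 fun s hs => ?_
    refine (eLpNorm_one_le_of_wt ((hI s hs).1.sub (hI t ht).1)).trans (le_of_eq ?_)
    congr 2; ext ξ
    simp only [Pi.sub_apply]; ring
  rw [ContinuousWithinAt, tendsto_iff_edist_tendsto_0]
  refine tendsto_zero_of_le_mul ENNReal.one_ne_top h1 fun s hs => ?_
  rw [one_mul, edist_eq_enorm_sub, ← fourierInv_sub (hI s hs) (hI t ht),
    eLpNorm_one_eq_lintegral_enorm, ← ofReal_integral_norm_eq_lintegral_enorm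
      ((hI s hs).sub (hI t ht)), ← ofReal_norm]
  exact ENNReal.ofReal_le_ofReal (norm_fourierInv_le _ x)

/-- Continuity of a bounded bilinear map: the increment splits by `conv_sub_conv`, and each part is
estimated by `eLpNorm_wt_conv_le`. -/
lemma L2Curve.wt_conv {U V : ℝ → Space3 → ℂ} (hU : L2Curve S fun t ξ => wt ξ * U t ξ)
    (hV : L2Curve S fun t ξ => wt ξ * V t ξ) :
    L2Curve S fun t ξ => wt ξ * conv (U t) (V t) ξ := by
  intro t ht
  refine ⟨memLp_wt_conv (hU t ht).1 (hV t ht).1, ?_⟩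
  have key : ∀ s ∈ S, eLpNorm ((fun ξ => wt ξ * conv (U s) (V s) ξ)
      - fun ξ => wt ξ * conv (U t) (V t) ξ) 2 volume
      ≤ 4 * wtConst * (eLpNorm ((fun ξ => wt ξ * U s ξ) - fun ξ => wt ξ * U t ξ) 2 volume
          * (eLpNorm (fun ξ => wt ξ * V t ξ) 2 volume
            + eLpNorm ((fun ξ => wt ξ * V s ξ) - fun ξ => wt ξ * V t ξ) 2 volume)
        + eLpNorm (fun ξ => wt ξ * U t ξ) 2 volume
          * eLpNorm ((fun ξ => wt ξ * V s ξ) - fun ξ => wt ξ * V t ξ) 2 volume) := by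
    intro s hs
    have eU : ((fun ξ => (wt ξ : ℂ) * U s ξ) - fun ξ => (wt ξ : ℂ) * U t ξ)
        = fun ξ => wt ξ * (U s - U t) ξ := by ext ξ; simp only [Pi.sub_apply]; ring
    have eV : ((fun ξ => (wt ξ : ℂ) * V s ξ) - fun ξ => (wt ξ : ℂ) * V t ξ)
        = fun ξ => wt ξ * (V s - V t) ξ := by ext ξ; simp only [Pi.sub_apply]; ring
    have mU : MemLp (fun ξ => wt ξ * (U s - U t) ξ) 2 volume := eU ▸ (hU s hs).1.sub (hU t ht).1
    have mV : MemLp (fun ξ => wt ξ * (V s - V t) ξ) 2 volume := eV ▸ (hV s hs).1.sub (hV t ht).1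
    -- The norm at time s is bounded by the norm at t plus an increment, so that the final bound has
    -- limit zero as s → t.
    have hVs : eLpNorm (fun ξ => wt ξ * V s ξ) 2 volume
        ≤ eLpNorm (fun ξ => wt ξ * V t ξ) 2 volume
          + eLpNorm (fun ξ => wt ξ * (V s - V t) ξ) 2 volume := by
      refine le_trans (le_of_eq ?_) (eLpNorm_add_le (hV t ht).1.1 mV.1 (by norm_num))
      congr 1; ext ξ; simp only [Pi.sub_apply, Pi.add_apply]; ring
    rw [eU, eV]
    have e : ((fun ξ => (wt ξ : ℂ) * conv (U s) (V s) ξ) - fun ξ => (wt ξ : ℂ) * conv (U t) (V t) ξ)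
        = (fun ξ => wt ξ * conv (U s - U t) (V s) ξ) + fun ξ => wt ξ * conv (U t) (V s - V t) ξ := by
      ext ξ
      simp only [Pi.sub_apply, Pi.add_apply, ← mul_sub, ← mul_add]
      rw [conv_sub_conv (memLp_of_wt (hU s hs).1) (memLp_of_wt (hV s hs).1)
        (memLp_of_wt (hU t ht).1) (memLp_of_wt (hV t ht).1)]
    rw [e]
    refine (eLpNorm_add_le (memLp_wt_conv mU (hV s hs).1).1 (memLp_wt_conv (hU t ht).1 mV).1
      (by norm_num)).trans ?_
    refine (add_le_add (eLpNorm_wt_conv_le mU (hV s hs).1)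
      (eLpNorm_wt_conv_le (hU t ht).1 mV)).trans ?_
    rw [mul_add, ← mul_assoc, ← mul_assoc]
    gcongr
  have hCt : 4 * wtConst ≠ ⊤ := ENNReal.mul_ne_top (by norm_num) wtConst_ne_top
  refine tendsto_zero_of_le_mul hCt ?_ key
  have nU := (hU t ht).1.eLpNorm_ne_top
  have nV := (hV t ht).1.eLpNorm_ne_top
  have l1 := ENNReal.Tendsto.mul (hU t ht).2 (Or.inr (by simpa using nV))
    ((tendsto_const_nhds (x := eLpNorm (fun ξ => wt ξ * V t ξ) 2 volume)).add (hV t ht).2)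
    (Or.inr ENNReal.zero_ne_top)
  have l2 := ENNReal.Tendsto.const_mul (hV t ht).2 (Or.inr nU)
  simpa using l1.add l2

end Bardina

/-! ### Classical partial derivatives, weak derivatives, and their transforms. -/

namespace Bardina
open scoped FourierTransform SchwartzMap LineDeriv ENNReal NNReal ComplexConjugate

/-- The partial derivative `∂ⱼ f` of a scalar function. -/
noncomputable def pd (j : Fin 3) (f : Space3 → ℝ) (x : Space3) : ℝ := fderiv ℝ f x (basisVec j)

lemma contDiff_pd {f : Space3 → ℝ} {m n : WithTop ℕ∞} (hf : ContDiff ℝ n f) (h : m + 1 ≤ n)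
    (j : Fin 3) : ContDiff ℝ m (pd j f) :=
  (hf.fderiv_right h).clm_apply contDiff_const

lemma hasCompactSupport_pd {f : Space3 → ℝ} (hf : HasCompactSupport f) (j : Fin 3) :
    HasCompactSupport (pd j f) :=
  (hf.fderiv (𝕜 := ℝ)).comp_left (g := fun L : Space3 →L[ℝ] ℝ => L (basisVec j)) rfl

lemma continuous_pd {f : Space3 → ℝ} (hf : ContDiff ℝ 1 f) (j : Fin 3) : Continuous (pd j f) :=
  (contDiff_pd (m := 0) hf (by simp) j).continuous

lemma integral_mul_pd {f g : Space3 → ℝ} (hf : ContDiff ℝ 1 f) (hg : ContDiff ℝ 1 g) (j : Fin 3)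
    (h1 : Integrable fun x => pd j f x * g x) (h2 : Integrable fun x => f x * pd j g x)
    (h3 : Integrable fun x => f x * g x) :
    ∫ x, f x * pd j g x = -∫ x, pd j f x * g x :=
  integral_mul_fderiv_eq_neg_fderiv_mul_of_integrable h1 h2 h3
    (fun x _ => hf.differentiable (by simp) x) (fun x _ => hg.differentiable (by simp) x)

lemma integral_mul_pd_of_hasCompactSupport {f φ : Space3 → ℝ} (hf : ContDiff ℝ 1 f)
    (hφ : ContDiff ℝ 1 φ) (hc : HasCompactSupport φ) (j : Fin 3) :
    ∫ x, f x * pd j φ x = -∫ x, pd j f x * φ x :=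
  integral_mul_pd hf hφ j
    (((continuous_pd hf j).mul hφ.continuous).integrable_of_hasCompactSupport hc.mul_left)
    ((hf.continuous.mul (continuous_pd hφ j)).integrable_of_hasCompactSupport
      (hasCompactSupport_pd hc j).mul_left)
    ((hf.continuous.mul hφ.continuous).integrable_of_hasCompactSupport hc.mul_left)

lemma iteratedFDeriv_two_basis {φ : Space3 → ℝ} (hφ : ContDiff ℝ 2 φ) (x : Space3)
    (I : Fin 2 → Fin 3) :
    iteratedFDeriv ℝ 2 φ x (fun k => basisVec (I k)) = pd (I 0) (pd (I 1) φ) x := by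
  rw [iteratedFDeriv_two_apply, pd]
  have hd : DifferentiableAt ℝ (fderiv ℝ φ) x :=
    (hφ.fderiv_right (m := 1) (by norm_num)).differentiable (by simp) x
  have := hd.hasFDerivAt.clm_apply (hasFDerivAt_const (basisVec (I 1)) x)
  have e : pd (I 1) φ = fun y => fderiv ℝ φ y (basisVec (I 1)) := rfl
  rw [e, this.fderiv]
  simp

lemma pd_comm {φ : Space3 → ℝ} (hφ : ContDiff ℝ 2 φ) (i j : Fin 3) (x : Space3) :
    pd i (pd j φ) x = pd j (pd i φ) x := by
  have h1 := iteratedFDeriv_two_basis hφ x ![i, j]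
  have h2 := iteratedFDeriv_two_basis hφ x ![j, i]
  simp only [Matrix.cons_val_zero, Matrix.cons_val_one] at h1 h2
  rw [← h1, ← h2, iteratedFDeriv_two_apply, iteratedFDeriv_two_apply]
  have hs : IsSymmSndFDerivAt ℝ φ x := hφ.contDiffAt.isSymmSndFDerivAt (by simp)
  exact hs _ _

lemma ae_eq_of_forall_integral_mul {g f : Space3 → ℝ} (hg : LocallyIntegrable g)
    (hf : LocallyIntegrable f) (h : ∀ φ : Space3 → ℝ, ContDiff ℝ ∞ φ → HasCompactSupport φ →
      ∫ x, g x * φ x = ∫ x, f x * φ x) : g =ᵐ[volume] f := by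
  refine ae_eq_of_integral_contDiff_smul_eq hg hf fun φ h1 h2 => ?_
  simpa only [smul_eq_mul, mul_comm] using h φ h1 h2

lemma HasWeakDeriv.ae_eq_zero_order {I : Fin 0 → Fin 3} {f g : Space3 → ℝ}
    (h : HasWeakDeriv I f g) : g =ᵐ[volume] f := by
  refine ae_eq_of_forall_integral_mul h.2.1 h.1 fun φ h1 h2 => ?_
  have := h.2.2 φ h1 h2
  simpa using this.symm

lemma HasWeakDeriv.ae_eq_pd {I : Fin 1 → Fin 3} {f g : Space3 → ℝ} (hf : ContDiff ℝ 1 f)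
    (h : HasWeakDeriv I f g) : g =ᵐ[volume] pd (I 0) f := by
  refine ae_eq_of_forall_integral_mul h.2.1 (continuous_pd hf _).locallyIntegrable
    fun φ h1 h2 => ?_
  have := h.2.2 φ h1 h2
  simp only [iteratedFDeriv_one_basis] at this
  have e := integral_mul_pd_of_hasCompactSupport hf (h1.of_le (by simp)) h2 (I 0)
  simp only [pd] at e ⊢
  rw [e] at this
  linarith

/-- Two integrations by parts move the derivatives onto `f` one at a time, outermost first, which
reverses their order. -/
lemma HasWeakDeriv.ae_eq_pd_pd {I : Fin 2 → Fin 3} {f g : Space3 → ℝ} (hf : ContDiff ℝ 2 f)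
    (h : HasWeakDeriv I f g) : g =ᵐ[volume] pd (I 1) (pd (I 0) f) := by
  have hf1 : ContDiff ℝ 1 f := hf.of_le (by norm_num)
  have hpf : ContDiff ℝ 1 (pd (I 0) f) := contDiff_pd hf (by norm_num) _
  refine ae_eq_of_forall_integral_mul h.2.1 (continuous_pd hpf _).locallyIntegrable
    fun φ h1 h2 => ?_
  have := h.2.2 φ h1 h2
  have hφ2 : ContDiff ℝ 2 φ := h1.of_le (WithTop.coe_le_coe.2 (le_top : (2 : ℕ∞) ≤ ⊤))
  simp only [iteratedFDeriv_two_basis hφ2] at this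
  rw [integral_mul_pd_of_hasCompactSupport hf1 (contDiff_pd hφ2 (by norm_num) _)
    (hasCompactSupport_pd h2 _), integral_mul_pd_of_hasCompactSupport hpf
      (hφ2.of_le (by norm_num)) h2] at this
  linarith

lemma ContinuousIntoL2.congr {S : Set ℝ} {f g : ℝ → Space3 → ℝ} (hf : ContinuousIntoL2 S f)
    (h : ∀ t ∈ S, f t =ᵐ[volume] g t) : ContinuousIntoL2 S g := fun t ht =>
  ⟨(memLp_congr_ae (h t ht)).1 (hf t ht).1, by
    refine (hf t ht).2.congr' ?_
    filter_upwards [self_mem_nhdsWithin] with s hs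
    exact eLpNorm_congr_ae ((h s hs).sub (h t ht))⟩

/-- Weak derivatives are unique almost everywhere, so for C² functions those supplied by the Sobolev
hypothesis are the classical ones. Everything after this uses classical derivatives. -/
lemma ContinuousIntoSobolev.pd_pd {S : Set ℝ} {f : ℝ → Space3 → ℝ} (h : ContinuousIntoSobolev 2 S f)
    (hf : ∀ t ∈ S, ContDiff ℝ 2 (f t)) :
    ContinuousIntoL2 S f ∧ (∀ j, ContinuousIntoL2 S fun t => pd j (f t)) ∧
      ∀ j k, ContinuousIntoL2 S fun t => pd j (pd k (f t)) := by
  refine ⟨?_, fun j => ?_, fun j k => ?_⟩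
  · obtain ⟨g, hg, hc⟩ := h 0 (by norm_num) ![]
    exact hc.congr fun t ht => (hg t ht).ae_eq_zero_order
  · obtain ⟨g, hg, hc⟩ := h 1 (by norm_num) ![j]
    exact hc.congr fun t ht => (hg t ht).ae_eq_pd ((hf t ht).of_le (by norm_num))
  · obtain ⟨g, hg, hc⟩ := h 2 (by norm_num) ![k, j]
    exact hc.congr fun t ht => (hg t ht).ae_eq_pd_pd (hf t ht)

lemma fderiv_ofReal_comp {f : Space3 → ℝ} {x : Space3} (hf : DifferentiableAt ℝ f x) (v : Space3) :
    fderiv ℝ (fun y => (f y : ℂ)) x v = ((fderiv ℝ f x v : ℝ) : ℂ) := by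
  have := (Complex.ofRealCLM.hasFDerivAt.comp x hf.hasFDerivAt).fderiv
  simp only [Function.comp_def, Complex.ofRealCLM_apply] at this
  rw [this]; rfl

/-- The Fourier transform of a classical partial derivative in `L²`. -/
lemma IsFT.pd {f : Space3 → ℝ} {U : Space3 → ℂ} (h : IsFT (fun x => (f x : ℂ)) U)
    (hf : ContDiff ℝ 1 f) {j : Fin 3} (hj : MemLp (pd j f) 2 volume) :
    IsFT (fun x => (Bardina.pd j f x : ℂ)) (fun ξ => symb j ξ * U ξ) := by
  have hjc : MemLp (fun x => (Bardina.pd j f x : ℂ)) 2 volume := hj.ofReal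
  obtain ⟨B, hB⟩ := hjc.exists_isFT
  -- `B` exists because the derivative is in L²; integration by parts against Schwartz functions
  -- identifies it with the symbol times `U`. Square integrability replaces any decay condition at
  -- infinity.
  refine hB.congr (ae_eq_refl _) ?_
  have hBl : LocallyIntegrable B := hB.memLp_ft.locallyIntegrable (by norm_num)
  have hUl : LocallyIntegrable fun ξ => symb j ξ * U ξ := by
    have := (h.memLp_ft.locallyIntegrable (by norm_num)).smul_continuous (continuous_symb j)
    refine this.congr (ae_of_all _ fun ξ => ?_)
    simp [mul_comm]
  have := ae_eq_zero_of_forall_integral_schwartz (hBl.sub hUl) fun ψ => by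
    have hd : ∀ x, DifferentiableAt ℝ f x := fun x => hf.differentiable (by simp) x
    have hfd : Differentiable ℝ fun x => (f x : ℂ) := fun x =>
      Complex.ofRealCLM.differentiableAt.comp x (hd x)
    have hψd : Differentiable ℝ (𝓕 ψ : 𝓢(Space3, ℂ)) := (𝓕 ψ).differentiable
    have hpd : ∀ x, fderiv ℝ (fun y => (f y : ℂ)) x (basisVec j) = (Bardina.pd j f x : ℂ) :=
      fun x => fderiv_ofReal_comp (hd x) _
    have hψ' : ∀ x, fderiv ℝ (𝓕 ψ : 𝓢(Space3, ℂ)) x (basisVec j)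
        = (∂_{basisVec j} (𝓕 ψ)) x := fun x => rfl
    have i1 : Integrable fun x => (Bardina.pd j f x : ℂ) * (𝓕 ψ) x :=
      hjc.integrable_mul (SchwartzMap.memLp (𝓕 ψ) 2 volume)
    have i2 : Integrable fun x => (f x : ℂ) * (∂_{basisVec j} (𝓕 ψ)) x :=
      h.memLp.integrable_mul (SchwartzMap.memLp (∂_{basisVec j} (𝓕 ψ)) 2 volume)
    have i3 : Integrable fun x => (f x : ℂ) * (𝓕 ψ) x :=
      h.memLp.integrable_mul (SchwartzMap.memLp (𝓕 ψ) 2 volume)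
    have ibp := integral_mul_fderiv_eq_neg_fderiv_mul_of_integrable (μ := (volume : Measure Space3))
      (f := fun x => (f x : ℂ)) (g := (𝓕 ψ : 𝓢(Space3, ℂ))) (v := basisVec j)
      (by simpa only [hpd] using i1) (by simpa only [hψ'] using i2) i3
      (fun x _ => hfd x) (fun x _ => hψd x)
    simp only [hpd, hψ'] at ibp
    have e1 := h.integral_schwartz_mul (∂_{basisVec j} (𝓕 ψ))
    have e2 := hB.integral_schwartz_mul (𝓕 ψ)
    simp only [fourierInv_lineDeriv_apply, FourierTransform.fourierInv_fourier_eq] at e1 e2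
    have j1 : Integrable fun ξ => ψ ξ * B ξ :=
      (SchwartzMap.memLp ψ 2 volume).integrable_mul hB.memLp_ft
    have j2 : Integrable fun ξ => -symb j ξ * ψ ξ * U ξ := by
      have := (SchwartzMap.memLp (𝓕⁻ (∂_{basisVec j} (𝓕 ψ))) 2 volume).integrable_mul h.memLp_ft
      refine this.congr (ae_of_all _ fun ξ => ?_)
      simp only [Pi.mul_apply, fourierInv_lineDeriv_apply, FourierTransform.fourierInv_fourier_eq]
    calc ∫ ξ, ψ ξ * (B - fun ξ => symb j ξ * U ξ) ξ
        = ∫ ξ, (ψ ξ * B ξ + -symb j ξ * ψ ξ * U ξ) := by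
          congr 1; ext ξ; simp only [Pi.sub_apply]; ring
      _ = 0 := by
          rw [integral_add j1 j2, ← e1, ← e2]
          simp only [mul_comm ((𝓕 ψ : 𝓢(Space3, ℂ)) _), mul_comm ((∂_{basisVec j} (𝓕 ψ)) _)]
          rw [ibp]; ring
  filter_upwards [this] with ξ hξ
  exact sub_eq_zero.1 hξ

end Bardina

/-! ### Fourier side of the convection term and of the canonical pressure. -/

namespace Bardina
open scoped FourierTransform SchwartzMap LineDeriv ENNReal NNReal ComplexConjugate

lemma helmholtzSymb_pos (α : ℝ) (ξ : Space3) : 0 < helmholtzSymb α ξ := by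
  unfold helmholtzSymb; positivity

lemma continuous_helmholtzSymb (α : ℝ) : Continuous (helmholtzSymb α) := by
  unfold helmholtzSymb
  exact continuous_const.div (by fun_prop) fun ξ => by positivity

/-- The filter gains two derivatives: its multiplier absorbs a full weight 1 + |ξ|². -/
lemma wt_mul_helmholtzSymb_le {α : ℝ} (hα : 0 < α) (ξ : Space3) :
    wt ξ * helmholtzSymb α ξ ≤ 1 + 1 / (4 * Real.pi ^ 2 * α ^ 2) := by
  have hκ : 0 < 4 * Real.pi ^ 2 * α ^ 2 := by positivity
  rw [helmholtzSymb, mul_one_div, div_le_iff₀ (by positivity), wt]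
  have : (1 + 1 / (4 * Real.pi ^ 2 * α ^ 2)) * (1 + 4 * Real.pi ^ 2 * α ^ 2 * ‖ξ‖ ^ 2)
      = 1 + ‖ξ‖ ^ 2 + (1 / (4 * Real.pi ^ 2 * α ^ 2) + 4 * Real.pi ^ 2 * α ^ 2 * ‖ξ‖ ^ 2) := by
    field_simp; ring
  rw [this]
  have : 0 ≤ 1 / (4 * Real.pi ^ 2 * α ^ 2) + 4 * Real.pi ^ 2 * α ^ 2 * ‖ξ‖ ^ 2 := by positivity
  linarith

lemma measurable_helmholtzSymb (α : ℝ) : Measurable fun ξ => (helmholtzSymb α ξ : ℂ) :=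
  (Complex.continuous_ofReal.comp (continuous_helmholtzSymb α)).measurable

lemma measurable_wt : Measurable fun ξ => (wt ξ : ℂ) :=
  (Complex.continuous_ofReal.comp continuous_wt).measurable

lemma norm_helmholtzSymb (α : ℝ) (ξ : Space3) : ‖(helmholtzSymb α ξ : ℂ)‖ = helmholtzSymb α ξ := by
  rw [Complex.norm_real, Real.norm_of_nonneg (helmholtzSymb_pos α ξ).le]

lemma norm_wt (ξ : Space3) : ‖(wt ξ : ℂ)‖ = wt ξ := by
  rw [Complex.norm_real, Real.norm_of_nonneg (wt_pos ξ).le]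

/-- The symbol `ξᵢ ξⱼ / |ξ|²` of a product of Riesz transforms. -/
noncomputable def rieszSymb (i j : Fin 3) (ξ : Space3) : ℝ := ξ i * ξ j / ‖ξ‖ ^ 2

lemma measurable_rieszSymb (i j : Fin 3) : Measurable fun ξ => (rieszSymb i j ξ : ℂ) := by
  unfold rieszSymb; fun_prop

lemma norm_rieszSymb_le (i j : Fin 3) (ξ : Space3) : ‖(rieszSymb i j ξ : ℂ)‖ ≤ 1 := by
  have hi : ‖ξ i‖ ≤ ‖ξ‖ := PiLp.norm_apply_le ξ i
  have hj : ‖ξ j‖ ≤ ‖ξ‖ := PiLp.norm_apply_le ξ j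
  rw [Complex.norm_real, rieszSymb, norm_div, norm_mul, norm_pow, norm_norm]
  refine div_le_one_of_le₀ ?_ (by positivity)
  rw [sq]; gcongr

/-- The Fourier transform of the `i`-th component of the divergence of the filtered tensor. -/
noncomputable def convectionFT (α : ℝ) (U : Fin 3 → Space3 → ℂ) (i : Fin 3) (ξ : Space3) : ℂ :=
  ∑ j, symb j ξ * (helmholtzSymb α ξ * conv (U i) (U j) ξ)

/-- The Fourier transform of the pressure. -/
noncomputable def pressureFT (α : ℝ) (U : Fin 3 → Space3 → ℂ) (ξ : Space3) : ℂ :=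
  -∑ i, ∑ j, (rieszSymb i j ξ : ℂ) * (helmholtzSymb α ξ * conv (U i) (U j) ξ)

section Curves

variable {S : Set ℝ} {α : ℝ} {U : Fin 3 → ℝ → Space3 → ℂ}

/-- One weight comes from the algebra property, the second from the filter; two weights mean H⁴. -/
lemma L2Curve.helmholtz_conv (hα : 0 < α) (hU : ∀ i, L2Curve S fun t ξ => wt ξ * U i t ξ)
    (i j : Fin 3) :
    L2Curve S fun t ξ => wt ξ * (wt ξ * (helmholtzSymb α ξ * conv (U i t) (U j t) ξ)) := by
  have h := ((hU i).wt_conv (hU j)).mul_bdd (m := fun ξ => (wt ξ : ℂ) * helmholtzSymb α ξ)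
    (measurable_wt.mul (measurable_helmholtzSymb α)) fun ξ => by
      rw [norm_mul, norm_wt, norm_helmholtzSymb]
      exact wt_mul_helmholtzSymb_le hα ξ
  refine h.congr fun t _ => ae_of_all _ fun ξ => ?_
  ring

/-- The symbols ξᵢξⱼ/|ξ|² are bounded by 1, so the pressure keeps the H⁴ regularity of the filtered
tensor. -/
lemma L2Curve.pressureFT (hα : 0 < α) (hU : ∀ i, L2Curve S fun t ξ => wt ξ * U i t ξ) :
    L2Curve S fun t ξ => wt ξ * (wt ξ * Bardina.pressureFT α (fun k => U k t) ξ) := by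
  have h := (L2Curve.sum Finset.univ fun i _ => L2Curve.sum Finset.univ fun j _ =>
    (L2Curve.helmholtz_conv hα hU i j).mul_bdd (measurable_rieszSymb i j)
      (norm_rieszSymb_le i j)).neg
  refine h.congr fun t _ => ae_of_all _ fun ξ => ?_
  simp only [Bardina.pressureFT, mul_neg, Finset.mul_sum]
  congr 1
  refine Finset.sum_congr rfl fun i _ => Finset.sum_congr rfl fun j _ => ?_
  ring

lemma norm_symb_le_wt (j : Fin 3) (ξ : Space3) : ‖symb j ξ‖ ≤ 2 * Real.pi * wt ξ :=
  (norm_symb_le j ξ).trans (by gcongr; exact norm_le_wt ξ)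

lemma L2Curve.wt_symb_mul {q : ℝ → Space3 → ℂ} (hq : L2Curve S fun t ξ => wt ξ * (wt ξ * q t ξ))
    (j : Fin 3) : L2Curve S fun t ξ => wt ξ * (symb j ξ * q t ξ) := by
  refine (hq.mul_of_wt (continuous_symb j).measurable (norm_symb_le_wt j)).congr
    fun t _ => ae_of_all _ fun ξ => ?_
  ring

lemma L2Curve.convectionFT (hα : 0 < α) (hU : ∀ i, L2Curve S fun t ξ => wt ξ * U i t ξ)
    (i : Fin 3) :
    L2Curve S fun t ξ => wt ξ * Bardina.convectionFT α (fun k => U k t) i ξ := by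
  have h := L2Curve.sum Finset.univ fun j _ => (L2Curve.helmholtz_conv hα hU i j).wt_symb_mul j
  refine h.congr fun t _ => ae_of_all _ fun ξ => ?_
  simp only [Bardina.convectionFT, Finset.mul_sum]

end Curves

lemma l2Curve_const {S : Set ℝ} {f : Space3 → ℂ} (h : MemLp f 2 volume) :
    L2Curve S fun _ => f := fun _ _ => ⟨h, by simpa using tendsto_const_nhds⟩

lemma integrable_norm_mul_of_wt_wt {q : Space3 → ℂ}
    (hq : MemLp (fun ξ => wt ξ * (wt ξ * q ξ)) 2 volume) :
    Integrable q ∧ Integrable fun ξ => ‖ξ‖ * ‖q ξ‖ := by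
  have h1 := integrable_of_wt hq
  have h0 := integrable_of_wt (memLp_of_wt hq)
  refine ⟨h0, h1.mono (continuous_norm.aestronglyMeasurable.mul h0.1.norm)
    (ae_of_all _ fun ξ => ?_)⟩
  rw [norm_mul, norm_mul, norm_norm, norm_norm, norm_wt]
  exact mul_le_mul_of_nonneg_right (norm_le_wt ξ) (norm_nonneg _)

section Static

variable {α : ℝ} {U : Fin 3 → Space3 → ℂ}

lemma memLp_helmholtz_conv (hα : 0 < α) (hU : ∀ i, MemLp (fun ξ => wt ξ * U i ξ) 2 volume)
    (i j : Fin 3) :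
    MemLp (fun ξ => wt ξ * (wt ξ * (helmholtzSymb α ξ * conv (U i) (U j) ξ))) 2 volume :=
  have h : ∀ i, L2Curve Set.univ fun _ ξ => wt ξ * U i ξ := fun i => l2Curve_const (hU i)
  (L2Curve.helmholtz_conv hα h i j 0 (Set.mem_univ _)).1

lemma memLp_wt_symb_mul {q : Space3 → ℂ}
    (hq : MemLp (fun ξ => wt ξ * (wt ξ * q ξ)) 2 volume) (j : Fin 3) :
    MemLp (fun ξ => wt ξ * (symb j ξ * q ξ)) 2 volume :=
  have h : L2Curve Set.univ fun _ ξ => wt ξ * (wt ξ * q ξ) := l2Curve_const hq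
  (h.wt_symb_mul j 0 (Set.mem_univ _)).1

/-- The filtered convection term is given by its Fourier integral. -/
lemma divFilteredTensor_eq (hα : 0 < α) (hU : ∀ i, MemLp (fun ξ => wt ξ * U i ξ) 2 volume)
    {v : Space3 → Space3} (hv : ∀ i x, (v x i : ℂ) = (𝓕⁻ (U i) : Space3 → ℂ) x) (i : Fin 3)
    (x : Space3) :
    ((divFilteredTensor α v i x : ℝ) : ℂ) = (𝓕⁻ (convectionFT α U i) : Space3 → ℂ) x := by
  have hI : ∀ i, Integrable (U i) := fun i => integrable_of_wt (hU i)
  have hw := memLp_helmholtz_conv hα hU i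
  have hs : ∀ j, Integrable fun ξ => symb j ξ * (helmholtzSymb α ξ * conv (U i) (U j) ξ) :=
    fun j => integrable_of_wt (memLp_wt_symb_mul (hw j) j)
  unfold convectionFT
  rw [fourierInv_sum _ fun j _ => hs j, divFilteredTensor, Complex.ofReal_sum]
  refine Finset.sum_congr rfl fun j _ => ?_
  obtain ⟨h0, h1⟩ := integrable_norm_mul_of_wt_wt (hw j)
  have hprod : ∀ x, ((v x i * v x j : ℝ) : ℂ) = (𝓕⁻ (conv (U i) (U j)) : Space3 → ℂ) x := by
    intro x
    rw [fourierInv_conv (hI i) (hI j), Complex.ofReal_mul, hv, hv]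
  have hf := filtered_eq_fourierInv hα (integrable_conv (hI i) (hI j)) hprod
  obtain ⟨hd, hj⟩ := hasFDerivAt_fourierInv h0 h1 x
  have hdr : DifferentiableAt ℝ (filtered α fun y => v y i * v y j) x := by
    have e : (filtered α fun y => v y i * v y j)
        = Complex.reCLM ∘ (𝓕⁻ (fun ξ => (helmholtzSymb α ξ : ℂ) * conv (U i) (U j) ξ)) := by
      ext y
      simp only [Function.comp_apply, Complex.reCLM_apply, ← hf y, Complex.ofReal_re]
    rw [e]
    exact Complex.reCLM.differentiableAt.comp x hd
  rw [← hj j, ← fderiv_ofReal_comp hdr]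
  congr 2
  ext y
  exact hf y

lemma sum_symb_sq (ξ : Space3) :
    ∑ j, symb j ξ * symb j ξ = ((-(4 * Real.pi ^ 2 * ‖ξ‖ ^ 2) : ℝ) : ℂ) := by
  simp only [symb_mul_symb]
  rw [← Complex.ofReal_sum]
  congr 1
  rw [EuclideanSpace.real_norm_sq_eq, Finset.mul_sum, Finset.sum_neg_distrib]
  simp only [sq]

/-- It also holds at ξ = 0, where the quotient takes the default value 0. -/
lemma norm_sq_mul_rieszSymb (i j : Fin 3) (ξ : Space3) :
    ‖ξ‖ ^ 2 * rieszSymb i j ξ = ξ i * ξ j := by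
  by_cases h : ξ = 0
  · simp [h]
  · have : ‖ξ‖ ≠ 0 := norm_ne_zero_iff.2 h
    rw [rieszSymb]; field_simp

/-- The pressure solves the Poisson equation on the Fourier side. -/
lemma sum_symb_convectionFT_add (ξ : Space3) :
    ∑ k, symb k ξ * (convectionFT α U k ξ + symb k ξ * pressureFT α U ξ) = 0 := by
  simp only [mul_add, Finset.sum_add_distrib, ← mul_assoc]
  rw [← Finset.sum_mul, sum_symb_sq, pressureFT, mul_neg, Finset.mul_sum, ← sub_eq_add_neg,
    ← Finset.sum_sub_distrib]
  refine Finset.sum_eq_zero fun i _ => ?_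
  rw [convectionFT, Finset.mul_sum, Finset.mul_sum, ← Finset.sum_sub_distrib]
  refine Finset.sum_eq_zero fun j _ => ?_
  have e : ((-(4 * Real.pi ^ 2 * ‖ξ‖ ^ 2) : ℝ) : ℂ) * rieszSymb i j ξ
      = ((-(4 * Real.pi ^ 2 * (ξ i * ξ j)) : ℝ) : ℂ) := by
    rw [← Complex.ofReal_mul, ← norm_sq_mul_rieszSymb]; congr 1; ring
  rw [← mul_assoc, symb_mul_symb, ← e]
  ring

end Static

end Bardina

/-! ### Coordinates, the time interval, and the Fourier data of the velocity. -/

namespace Bardina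
open scoped FourierTransform SchwartzMap LineDeriv ENNReal NNReal ComplexConjugate

/-- The coordinate of index `i`, as a continuous linear map. -/
noncomputable def coordCLM (i : Fin 3) : Space3 →L[ℝ] ℝ := EuclideanSpace.proj i

lemma contDiff_coord {v : Space3 → Space3} {n : WithTop ℕ∞} (hv : ContDiff ℝ n v) (i : Fin 3) :
    ContDiff ℝ n fun x => v x i :=
  (coordCLM i).contDiff.comp hv

lemma fderiv_coord {v : Space3 → Space3} (hv : ContDiff ℝ 1 v) (i j : Fin 3) (x : Space3) :
    fderiv ℝ v x (basisVec j) i = pd j (fun y => v y i) x := by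
  have := ((coordCLM i).hasFDerivAt.comp x (hv.differentiable (by simp) x).hasFDerivAt).fderiv
  have e : (coordCLM i ∘ v) = fun y => v y i := rfl
  rw [e] at this
  rw [pd, this]; rfl

lemma divergence_eq {v : Space3 → Space3} (hv : ContDiff ℝ 1 v) (x : Space3) :
    divergence v x = ∑ j, pd j (fun y => v y j) x :=
  Finset.sum_congr rfl fun j _ => fderiv_coord hv j j x

lemma gradSq_eq {v : Space3 → Space3} (hv : ContDiff ℝ 1 v) (x : Space3) :
    gradSq v x = ∑ i, ∑ j, pd j (fun y => v y i) x ^ 2 := by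
  rw [gradSq, Finset.sum_comm]
  refine Finset.sum_congr rfl fun j _ => ?_
  rw [EuclideanSpace.real_norm_sq_eq]
  exact Finset.sum_congr rfl fun i _ => by rw [fderiv_coord hv]

lemma laplacian_coord {v : Space3 → Space3} (hv : ContDiff ℝ 2 v) (i : Fin 3) (x : Space3) :
    (Laplacian.laplacian v x) i = ∑ j, pd j (pd j fun y => v y i) x := by
  have h := (hv.contDiffAt (x := x)).laplacian_CLM_comp_left (l := coordCLM i)
  have e : (coordCLM i ∘ v) = fun y => v y i := rfl
  rw [e] at h
  have h' : (Laplacian.laplacian v x) i = Laplacian.laplacian (fun y => v y i) x := h.symm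
  rw [h', InnerProductSpace.laplacian_eq_iteratedFDeriv_orthonormalBasis _
    (EuclideanSpace.basisFun (Fin 3) ℝ)]
  refine Finset.sum_congr rfl fun j _ => ?_
  have := iteratedFDeriv_two_basis (contDiff_coord hv i) x ![j, j]
  simp only [Matrix.cons_val_zero, Matrix.cons_val_one] at this
  rw [← this]
  congr 1
  ext k
  fin_cases k <;> simp [basisVec]

lemma gradient_coord {f : Space3 → ℝ} (x : Space3) (i : Fin 3) :
    gradient f x i = pd i f x := by
  rw [← inner_basisVec, gradient, InnerProductSpace.toDual_symm_apply, pd]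

lemma Icc_subset_timeInterval {T : EReal} {a b : ℝ} (ha : 0 ≤ a) (hb : (b : EReal) < T) :
    Set.Icc a b ⊆ timeInterval T := fun _ hs =>
  ⟨ha.trans hs.1, (EReal.coe_le_coe_iff.2 hs.2).trans_lt hb⟩

/-- Continuity on [0, T) is local, so hypotheses on the compact intervals [0, τ] suffice, also when
T = +∞. -/
lemma timeInterval_exists_Icc {T : EReal} {t : ℝ} (ht : t ∈ timeInterval T) :
    ∃ τ : ℝ, t < τ ∧ 0 < τ ∧ (τ : EReal) < T ∧ Set.Icc 0 τ ∈ 𝓝[timeInterval T] t := by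
  obtain ⟨τ, h1, h2⟩ := EReal.lt_iff_exists_real_btwn.1 ht.2
  have h1' : t < τ := EReal.coe_lt_coe_iff.1 h1
  refine ⟨τ, h1', ht.1.trans_lt h1', h2, ?_⟩
  filter_upwards [self_mem_nhdsWithin, mem_nhdsWithin_of_mem_nhds (Iio_mem_nhds h1')] with s hs hs'
  exact ⟨hs.1, le_of_lt hs'⟩

lemma ContinuousIntoL2.of_Icc {T : EReal} {f : ℝ → Space3 → ℝ}
    (h : ∀ τ : ℝ, 0 < τ → (τ : EReal) < T → ContinuousIntoL2 (Set.Icc 0 τ) f) :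
    ContinuousIntoL2 (timeInterval T) f := fun t ht => by
  obtain ⟨τ, h1, h2, h3, h4⟩ := timeInterval_exists_Icc ht
  obtain ⟨h5, h6⟩ := h τ h2 h3 t ⟨ht.1, h1.le⟩
  exact ⟨h5, h6.mono_left (nhdsWithin_le_of_mem h4)⟩

lemma ContinuousIntoL2.mono {S S' : Set ℝ} {f : ℝ → Space3 → ℝ} (hf : ContinuousIntoL2 S f)
    (h : S' ⊆ S) : ContinuousIntoL2 S' f := fun t ht =>
  ⟨(hf t (h ht)).1, (hf t (h ht)).2.mono_left (nhdsWithin_mono t h)⟩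

/-- The Fourier side of a scalar function of class `C²` which is in `C(S; H²)`. -/
lemma exists_fourier_curve {S : Set ℝ} {f : ℝ → Space3 → ℝ} (hf : ∀ t ∈ S, ContDiff ℝ 2 (f t))
    (h0 : ContinuousIntoL2 S f) (h1 : ∀ j, ContinuousIntoL2 S fun t => pd j (f t))
    (h2 : ∀ j k, ContinuousIntoL2 S fun t => pd j (pd k (f t))) :
    ∃ U : ℝ → Space3 → ℂ, L2Curve S (fun t ξ => wt ξ * U t ξ) ∧ ∀ t ∈ S,
      (∀ x, (f t x : ℂ) = (𝓕⁻ (U t) : Space3 → ℂ) x) ∧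
      IsFT (fun x => (f t x : ℂ)) (U t) ∧
      (∀ j, IsFT (fun x => (pd j (f t) x : ℂ)) fun ξ => symb j ξ * U t ξ) ∧
      ∀ j k, IsFT (fun x => (pd j (pd k (f t)) x : ℂ)) fun ξ => symb j ξ * (symb k ξ * U t ξ) := by
  have hex : ∀ t, ∃ V, t ∈ S → IsFT (fun x => (f t x : ℂ)) V := fun t => by
    by_cases ht : t ∈ S
    · obtain ⟨V, hV⟩ := (h0 t ht).1.ofReal (K := ℂ) |>.exists_isFT
      exact ⟨V, fun _ => hV⟩
    · exact ⟨0, fun h => (ht h).elim⟩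
  choose U hU using hex
  have g1 : ∀ t ∈ S, ∀ j, IsFT (fun x => (pd j (f t) x : ℂ)) fun ξ => symb j ξ * U t ξ :=
    fun t ht j => (hU t ht).pd ((hf t ht).of_le (by norm_num)) (h1 j t ht).1
  have g2 : ∀ t ∈ S, ∀ j k, IsFT (fun x => (pd j (pd k (f t)) x : ℂ))
      fun ξ => symb j ξ * (symb k ξ * U t ξ) :=
    fun t ht j k => (g1 t ht k).pd (contDiff_pd (hf t ht) (by norm_num) k) (h2 j k t ht).1
  have hc : L2Curve S fun t ξ => wt ξ * U t ξ := by
    have c0 : L2Curve S U := (l2Curve_ofReal h0).ft hU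
    have c2 : ∀ j, L2Curve S fun t ξ => symb j ξ * (symb j ξ * U t ξ) := fun j =>
      (l2Curve_ofReal (h2 j j)).ft fun t ht => g2 t ht j j
    -- The symbol of Δ is −4π²|ξ|², so (1 + |ξ|²) U is the transform of f − Δf/(4π²); only pure
    -- second derivatives are needed.
    have c := c0.sub ((L2Curve.sum Finset.univ fun j _ => c2 j).const_mul
      ((1 / (4 * Real.pi ^ 2) : ℝ) : ℂ))
    refine c.congr fun t _ => ae_of_all _ fun ξ => ?_
    have e : ∑ j, symb j ξ * (symb j ξ * U t ξ)
        = ((-(4 * Real.pi ^ 2 * ‖ξ‖ ^ 2) : ℝ) : ℂ) * U t ξ := by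
      rw [← sum_symb_sq, Finset.sum_mul]
      exact Finset.sum_congr rfl fun j _ => (mul_assoc _ _ _).symm
    simp only [e]
    rw [← mul_assoc, ← Complex.ofReal_mul, wt]
    have : (1 / (4 * Real.pi ^ 2) : ℝ) * (-(4 * Real.pi ^ 2 * ‖ξ‖ ^ 2)) = -‖ξ‖ ^ 2 := by
      have := Real.pi_ne_zero
      field_simp
    rw [this]
    push_cast; ring
  refine ⟨U, hc, fun t ht => ⟨fun x => ?_, hU t ht, g1 t ht, g2 t ht⟩⟩
  exact congrFun ((hU t ht).eq_fourierInv (Complex.continuous_ofReal.comp (hf t ht).continuous)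
    (integrable_of_wt (hc t ht).1)) x

/-- The Fourier side `U` of a solenoidal vector field `u` in `C(S; H²)`. -/
structure FourierData (S : Set ℝ) (u : ℝ → Space3 → Space3) (U : Fin 3 → ℝ → Space3 → ℂ) :
    Prop where
  contDiff : ∀ t ∈ S, ContDiff ℝ 2 (u t)
  curve : ∀ i, L2Curve S fun t ξ => wt ξ * U i t ξ
  eq_fourierInv : ∀ t ∈ S, ∀ i x, (u t x i : ℂ) = (𝓕⁻ (U i t) : Space3 → ℂ) x
  isFT : ∀ t ∈ S, ∀ i, IsFT (fun x => (u t x i : ℂ)) (U i t)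
  isFT_pd : ∀ t ∈ S, ∀ i j, IsFT (fun x => (pd j (fun y => u t y i) x : ℂ))
    fun ξ => symb j ξ * U i t ξ
  isFT_pd_pd : ∀ t ∈ S, ∀ i j k, IsFT (fun x => (pd j (pd k fun y => u t y i) x : ℂ))
    fun ξ => symb j ξ * (symb k ξ * U i t ξ)
  divergence_eq_zero : ∀ t ∈ S, ∀ x, divergence (u t) x = 0

lemma FourierData.sum_symb_mul {S : Set ℝ} {u : ℝ → Space3 → Space3}
    {U : Fin 3 → ℝ → Space3 → ℂ} (h : FourierData S u U) {t : ℝ} (ht : t ∈ S) :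
    ∀ᵐ ξ, ∑ k, symb k ξ * U k t ξ = 0 := by
  have h1 := IsFT.sum Finset.univ fun k _ => h.isFT_pd t ht k k
  have e : (fun x => ∑ k, (pd k (fun y => u t y k) x : ℂ)) = fun _ => 0 := by
    ext x
    rw [← Complex.ofReal_sum, ← divergence_eq ((h.contDiff t ht).of_le (by norm_num)),
      h.divergence_eq_zero t ht x, Complex.ofReal_zero]
  rw [e] at h1
  exact h1.unique IsFT.zero

/-- The equations are assumed for t > 0 only; density of the positive times extends them to t = 0 by
continuity. -/
lemma mem_closure_timeInterval_pos {T : EReal} {t : ℝ} (ht : t ∈ timeInterval T) :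
    t ∈ closure (timeInterval T ∩ Set.Ioi 0) := by
  obtain ⟨τ, h1, h2, h3, -⟩ := timeInterval_exists_Icc ht
  have hsub : Set.Ioo t τ ⊆ timeInterval T ∩ Set.Ioi 0 := fun s hs =>
    ⟨Icc_subset_timeInterval ht.1 h3 ⟨hs.1.le, hs.2.le⟩, ht.1.trans_lt hs.1⟩
  refine closure_mono hsub ?_
  rw [closure_Ioo h1.ne]
  exact ⟨le_rfl, h1.le⟩

/-- A continuous function on `[0, T)` which vanishes on `(0, T)` vanishes. -/
lemma eq_zero_of_timeInterval_pos {F : Type*} [TopologicalSpace F] [T2Space F] [Zero F] {T : EReal}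
    {g : ℝ → F} (hg : ContinuousOn g (timeInterval T))
    (h : ∀ t ∈ timeInterval T, 0 < t → g t = 0) : ∀ t ∈ timeInterval T, g t = 0 := by
  intro t ht
  have hne : (𝓝[timeInterval T ∩ Set.Ioi 0] t).NeBot :=
    mem_closure_iff_nhdsWithin_neBot.1 (mem_closure_timeInterval_pos ht)
  have h1 := (hg t ht).mono_left (nhdsWithin_mono t (Set.inter_subset_left (t := Set.Ioi 0)))
  have h2 : Tendsto g (𝓝[timeInterval T ∩ Set.Ioi 0] t) (𝓝 0) := by
    refine tendsto_const_nhds.congr' ?_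
    filter_upwards [self_mem_nhdsWithin] with s hs using (h s hs.1 hs.2).symm
  exact tendsto_nhds_unique h1 h2

lemma ContinuousOn.of_uncurry_left {F : Type*} [TopologicalSpace F] {S : Set ℝ}
    {g : ℝ → Space3 → F}
    (h : ContinuousOn (fun z : ℝ × Space3 => g z.1 z.2) (S ×ˢ Set.univ)) (x : Space3) :
    ContinuousOn (fun t => g t x) S :=
  h.comp (f := fun t => (t, x)) (by fun_prop) fun t ht => ⟨ht, Set.mem_univ _⟩

lemma IsRegularSolution.exists_fourierData {α ν : ℝ} {T : EReal} {u₀ : Space3 → Space3}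
    {u : ℝ → Space3 → Space3} {p : ℝ → Space3 → ℝ} (h : IsRegularSolution α ν T u₀ u p) :
    ∃ U, FourierData (timeInterval T) u U := by
  have hC : ∀ t ∈ timeInterval T, ∀ i, ContDiff ℝ 2 fun x => u t x i :=
    fun t ht i => contDiff_coord (h.spaceDiff_u t ht) i
  have key : ∀ i, ∀ τ : ℝ, 0 < τ → (τ : EReal) < T → _ := fun i τ h1 h2 =>
    (h.sobolev τ h1 h2 i).pd_pd fun t ht => hC t (Icc_subset_timeInterval le_rfl h2 ht) i
  have hex := fun i => exists_fourier_curve (S := timeInterval T) (fun t ht => hC t ht i)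
    (.of_Icc fun τ h1 h2 => (key i τ h1 h2).1)
    (fun j => .of_Icc fun τ h1 h2 => (key i τ h1 h2).2.1 j)
    (fun j k => .of_Icc fun τ h1 h2 => (key i τ h1 h2).2.2 j k)
  choose U hU hU' using hex
  refine ⟨U, h.spaceDiff_u, hU, fun t ht i => (hU' i t ht).1, fun t ht i => (hU' i t ht).2.1,
    fun t ht i => (hU' i t ht).2.2.1, fun t ht i => (hU' i t ht).2.2.2, fun t ht x => ?_⟩
  -- Incompressibility at t = 0 follows from the continuity of the gradient in time.
  refine eq_zero_of_timeInterval_pos (g := fun t => divergence (u t) x) ?_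
    (fun t ht h0 => h.incompressible t ht h0 x) t ht
  have hc := ContinuousOn.of_uncurry_left (g := fun t x => fderiv ℝ (u t) x) h.cont_grad_u x
  refine continuousOn_finsetSum _ fun j _ => ?_
  exact (coordCLM j).continuous.comp_continuousOn (hc.clm_apply continuousOn_const)

end Bardina

/-! ### The div-curl argument that removes the unknown gradient. -/

namespace Bardina
open scoped FourierTransform SchwartzMap LineDeriv ENNReal NNReal ComplexConjugate

/-- A solenoidal and irrotational field in `L²` vanishes. -/
lemma ae_eq_zero_of_div_curl {a : Fin 3 → Space3 → ℂ} (ha : ∀ k, MemLp (a k) 2 volume)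
    (hdiv : ∀ φ : Space3 → ℝ, ContDiff ℝ ∞ φ → HasCompactSupport φ →
      ∑ k, ∫ x, a k x * (pd k φ x : ℝ) = 0)
    (hcurl : ∀ φ : Space3 → ℝ, ContDiff ℝ ∞ φ → HasCompactSupport φ → ∀ i j,
      ∫ x, a i x * (pd j φ x : ℝ) = ∫ x, a j x * (pd i φ x : ℝ)) (i : Fin 3) :
    ∀ᵐ x, a i x = 0 := by
  choose A hA using fun k => (ha k).exists_isFT
  have hd := sum_symb_mul_eq_zero hA hdiv
  have hc : ∀ j, ∀ᵐ ξ, symb j ξ * A i ξ = symb i ξ * A j ξ := fun j => by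
    -- The curl component ∂ⱼaᵢ − ∂ᵢaⱼ is the divergence of the field with components δₖⱼ aᵢ − δₖᵢ
    -- aⱼ, so the divergence lemma also handles the curl.
    have hb : ∀ k, IsFT
        (fun x => (if k = j then (1 : ℂ) else 0) * a i x - (if k = i then (1 : ℂ) else 0) * a j x)
        (fun x => (if k = j then (1 : ℂ) else 0) * A i x - (if k = i then (1 : ℂ) else 0) * A j x) :=
      fun k => ((hA i).const_mul _).sub ((hA j).const_mul _)
    have := sum_symb_mul_eq_zero hb fun φ h1 h2 => by
      have hI : ∀ k l, Integrable fun x => a l x * (pd k φ x : ℂ) := fun k l => by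
        have hφ : MemLp (fun x => (pd k φ x : ℂ)) 2 volume :=
          ((continuous_pd (h1.of_le (by simp)) k).memLp_of_hasCompactSupport
            (hasCompactSupport_pd h2 k)).ofReal
        exact (ha l).integrable_mul hφ
      have e : ∀ k, ∫ x, ((if k = j then (1 : ℂ) else 0) * a i x
            - (if k = i then (1 : ℂ) else 0) * a j x) * (fderiv ℝ φ x (basisVec k) : ℝ)
          = (if k = j then (1 : ℂ) else 0) * (∫ x, a i x * (pd k φ x : ℂ))
            - (if k = i then (1 : ℂ) else 0) * ∫ x, a j x * (pd k φ x : ℂ) := fun k => by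
        rw [← integral_const_mul, ← integral_const_mul,
          ← integral_sub ((hI k i).const_mul _) ((hI k j).const_mul _)]
        congr 1; ext x; rw [pd]; ring
      rw [Finset.sum_congr rfl fun k _ => e k]
      simp only [Finset.sum_sub_distrib, ite_mul, one_mul, zero_mul, Finset.sum_ite_eq',
        Finset.mem_univ, if_true]
      exact sub_eq_zero.2 (hcurl φ h1 h2 i j)
    filter_upwards [this] with ξ hξ
    simp only [mul_sub, Finset.sum_sub_distrib, ite_mul, one_mul, zero_mul, mul_ite, mul_zero,
      Finset.sum_ite_eq', Finset.mem_univ, if_true] at hξ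
    exact sub_eq_zero.1 hξ
  have hA0 : A i =ᵐ[volume] fun _ => 0 := by
    have h0 : ∀ᵐ ξ : Space3, ξ ≠ 0 := by simp [ae_iff]
    filter_upwards [hd, ae_all_iff.2 hc, h0] with ξ h1 h2 h3
    -- |ξ|² Aᵢ = ξᵢ (ξ·A) by the curl relations, and ξ·A = 0 by the divergence relation.
    have : (∑ j, symb j ξ * symb j ξ) * A i ξ = 0 := by
      calc (∑ j, symb j ξ * symb j ξ) * A i ξ = ∑ j, symb j ξ * (symb j ξ * A i ξ) := by
            rw [Finset.sum_mul]; simp only [mul_assoc]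
        _ = symb i ξ * ∑ j, symb j ξ * A j ξ := by
            rw [Finset.mul_sum]
            exact Finset.sum_congr rfl fun j _ => by rw [h2 j]; ring
        _ = 0 := by rw [h1, mul_zero]
    rw [sum_symb_sq] at this
    refine (mul_eq_zero.1 this).resolve_left ?_
    have : (0 : ℝ) < 4 * Real.pi ^ 2 * ‖ξ‖ ^ 2 := by
      have := norm_pos_iff.2 h3
      positivity
    exact_mod_cast (neg_neg_of_pos this).ne
  exact ((hA i).congr (ae_eq_refl _) hA0).unique_inv IsFT.zero

/-! ### Curves in the Hilbert space `L²` -/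

/-- The class in `L²` of a function. -/
noncomputable def toL2 (f : Space3 → ℂ) : Lp ℂ 2 (volume : Measure Space3) :=
  open Classical in if h : MemLp f 2 volume then h.toLp f else 0

lemma toL2_eq {f : Space3 → ℂ} (h : MemLp f 2 volume) : toL2 f = h.toLp f := dif_pos h

lemma coeFn_toL2 {f : Space3 → ℂ} (h : MemLp f 2 volume) : toL2 f =ᵐ[volume] f := by
  rw [toL2_eq h]; exact h.coeFn_toLp

lemma L2Curve.continuousOn_toL2 {S : Set ℝ} {f : ℝ → Space3 → ℂ} (hf : L2Curve S f) :
    ContinuousOn (fun t => toL2 (f t)) S := by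
  intro t ht
  rw [ContinuousWithinAt, tendsto_iff_edist_tendsto_0]
  refine (hf t ht).2.congr' ?_
  filter_upwards [self_mem_nhdsWithin] with s hs
  rw [toL2_eq (hf s hs).1, toL2_eq (hf t ht).1, Lp.edist_toLp_toLp]

lemma inner_toL2 {f g : Space3 → ℂ} (hf : MemLp f 2 volume) (hg : MemLp g 2 volume) :
    inner ℂ (toL2 f) (toL2 g) = ∫ x, g x * conj (f x) := by
  rw [L2.inner_def]
  refine integral_congr_ae ?_
  filter_upwards [coeFn_toL2 hf, coeFn_toL2 hg] with x h1 h2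
  rw [h1, h2]; rfl

/-- The pairing with a real test function, as a continuous linear form on `L²`. -/
noncomputable def pairing (φ : Space3 → ℝ) : Lp ℂ 2 (volume : Measure Space3) →L[ℂ] ℂ :=
  innerSL ℂ (toL2 fun x => (φ x : ℂ))

lemma pairing_apply {φ : Space3 → ℝ} (hφ : MemLp φ 2 volume)
    (F : Lp ℂ 2 (volume : Measure Space3)) : pairing φ F = ∫ x, F x * (φ x : ℂ) := by
  rw [pairing, innerSL_apply_apply, L2.inner_def]
  have hφc : MemLp (fun x => (φ x : ℂ)) 2 volume := hφ.ofReal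
  refine integral_congr_ae ?_
  filter_upwards [coeFn_toL2 hφc] with x h1
  rw [h1, RCLike.inner_apply]
  simp

lemma pairing_toL2 {φ : Space3 → ℝ} (hφ : MemLp φ 2 volume) {f : Space3 → ℂ}
    (hf : MemLp f 2 volume) : pairing φ (toL2 f) = ∫ x, f x * (φ x : ℂ) := by
  rw [pairing_apply hφ]
  refine integral_congr_ae ?_
  filter_upwards [coeFn_toL2 hf] with x h1
  rw [h1]

/-- Fubini. `D` is only continuous, but the compact support of φ confines the double integral to a
compact set. -/
lemma integral_mul_integral_swap {a b : ℝ} (hab : a ≤ b) {D : ℝ → Space3 → ℂ}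
    (hD : ContinuousOn (fun z : ℝ × Space3 => D z.1 z.2) (Set.Icc a b ×ˢ Set.univ))
    {φ : Space3 → ℝ} (h1 : Continuous φ) (h2 : HasCompactSupport φ) :
    ∫ x, (∫ s in a..b, D s x) * (φ x : ℂ) = ∫ s in a..b, ∫ x, D s x * (φ x : ℂ) := by
  have hc : ContinuousOn (fun z : ℝ × Space3 => D z.1 z.2 * (φ z.2 : ℂ))
      (Set.Icc a b ×ˢ Set.univ) :=
    hD.mul (Complex.continuous_ofReal.comp (h1.comp continuous_snd)).continuousOn
  have hI : IntegrableOn (fun z : ℝ × Space3 => D z.1 z.2 * (φ z.2 : ℂ))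
      (Set.Icc a b ×ˢ tsupport φ) (volume.prod volume) :=
    (hc.mono (Set.prod_mono_right (Set.subset_univ _))).integrableOn_compact
      (isCompact_Icc.prod h2)
  have hI2 : IntegrableOn (fun z : ℝ × Space3 => D z.1 z.2 * (φ z.2 : ℂ))
      (Set.Icc a b ×ˢ Set.univ) (volume.prod volume) := by
    refine hI.of_forall_sdiff_eq_zero (measurableSet_Icc.prod MeasurableSet.univ) fun z hz => ?_
    have : z.2 ∉ tsupport φ := fun hz' => hz.2 ⟨hz.1.1, hz'⟩
    rw [image_eq_zero_of_notMem_tsupport this, Complex.ofReal_zero, mul_zero]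
  have hI3 : Integrable (Function.uncurry fun (s : ℝ) (x : Space3) => D s x * (φ x : ℂ))
      ((volume.restrict (Set.Ioc a b)).prod volume) := by
    have := hI2.mono_set (Set.prod_mono_left (t := Set.univ) Set.Ioc_subset_Icc_self)
    rwa [IntegrableOn, ← Measure.prod_restrict, Measure.restrict_univ] at this
  simp only [intervalIntegral.integral_of_le hab]
  rw [integral_integral_swap hI3]
  simp only [integral_mul_const]

/-- Right derivatives are used throughout, so that t = 0 needs no separate treatment. -/
lemma hasDerivWithinAt_integral_of_continuousOn {E : Type*} [NormedAddCommGroup E]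
    [NormedSpace ℝ E] [CompleteSpace E] {T : EReal} {g : ℝ → E}
    (hg : ContinuousOn g (timeInterval T)) {t : ℝ} (ht : t ∈ timeInterval T) :
    HasDerivWithinAt (fun b => ∫ s in t..b, g s) (g t) (Set.Ici t) t := by
  obtain ⟨τ, h1, -, h3, -⟩ := timeInterval_exists_Icc ht
  have hc : ContinuousOn g (Set.Icc t τ) := hg.mono (Icc_subset_timeInterval ht.1 h3)
  have hmem : Set.Icc t τ ∈ 𝓝[>] t := by
    filter_upwards [Ioo_mem_nhdsGT h1] with s hs using ⟨hs.1.le, hs.2.le⟩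
  refine intervalIntegral.integral_hasDerivWithinAt_right IntervalIntegrable.refl
    (t := Set.Ioi t) ?_ ?_
  · exact ⟨Set.Icc t τ, hmem, hc.aestronglyMeasurable measurableSet_Icc⟩
  · exact (hc t ⟨le_rfl, h1.le⟩).mono_of_mem_nhdsWithin hmem

lemma intervalIntegrable_of_continuousOn {E : Type*} [NormedAddCommGroup E] {T : EReal}
    {g : ℝ → E} (hg : ContinuousOn g (timeInterval T)) {a b : ℝ} (ha : a ∈ timeInterval T)
    (hb : b ∈ timeInterval T) (hab : a ≤ b) : IntervalIntegrable g volume a b :=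
  ContinuousOn.intervalIntegrable_of_Icc hab (hg.mono (Icc_subset_timeInterval ha.1 hb.2))

lemma continuousOn_integral_mul {S : Set ℝ} {D : ℝ → Space3 → ℂ}
    (hD : ContinuousOn (fun z : ℝ × Space3 => D z.1 z.2) (S ×ˢ Set.univ))
    {φ : Space3 → ℝ} (h1 : Continuous φ) (h2 : HasCompactSupport φ) :
    ContinuousOn (fun s => ∫ x, D s x * (φ x : ℂ)) S := by
  refine continuousOn_integral_of_compact_support (k := tsupport φ) h2 ?_ fun s x _ hx => ?_
  · exact hD.mul (Complex.continuous_ofReal.comp (h1.comp continuous_snd)).continuousOn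
  · rw [image_eq_zero_of_notMem_tsupport hx, Complex.ofReal_zero, mul_zero]

/-- Integration by parts of a gradient against a partial derivative of a test function. -/
lemma integral_fderiv_mul_pd_comm {h : Space3 → ℂ} (hh : ContDiff ℝ 1 h) {φ : Space3 → ℝ}
    (h1 : ContDiff ℝ ∞ φ) (h2 : HasCompactSupport φ) (i j : Fin 3) :
    ∫ x, fderiv ℝ h x (basisVec i) * (pd j φ x : ℂ)
      = ∫ x, fderiv ℝ h x (basisVec j) * (pd i φ x : ℂ) := by
  have hφ2 : ContDiff ℝ 2 φ := h1.of_le (WithTop.coe_le_coe.2 (le_top : (2 : ℕ∞) ≤ ⊤))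
  have key : ∀ i j, ∫ x, fderiv ℝ h x (basisVec i) * (pd j φ x : ℂ)
      = -∫ x, h x * (pd i (pd j φ) x : ℂ) := fun i j => by
    have hp : ContDiff ℝ 1 (pd j φ) := contDiff_pd hφ2 (by norm_num) j
    have hpc : HasCompactSupport fun x => (pd j φ x : ℂ) :=
      (hasCompactSupport_pd h2 j).comp_left Complex.ofReal_zero
    have hppc : HasCompactSupport fun x => (pd i (pd j φ) x : ℂ) :=
      (hasCompactSupport_pd (hasCompactSupport_pd h2 j) i).comp_left Complex.ofReal_zero
    have hpk : Continuous fun x => (pd j φ x : ℂ) := Complex.continuous_ofReal.comp hp.continuous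
    have hppk : Continuous fun x => (pd i (pd j φ) x : ℂ) :=
      Complex.continuous_ofReal.comp (continuous_pd hp i)
    have hpd : ∀ x, fderiv ℝ (fun y => (pd j φ y : ℂ)) x (basisVec i) = (pd i (pd j φ) x : ℂ) :=
      fun x => fderiv_ofReal_comp (hp.differentiable (by simp) x) _
    have hk : Continuous fun x => fderiv ℝ h x (basisVec i) :=
      (hh.continuous_fderiv (by simp)).clm_apply continuous_const
    have := integral_mul_fderiv_eq_neg_fderiv_mul_of_integrable (μ := (volume : Measure Space3))
      (f := h) (g := fun x => (pd j φ x : ℂ)) (v := basisVec i)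
      ((hk.mul hpk).integrable_of_hasCompactSupport hpc.mul_left)
      (by
        simp only [hpd]
        exact (hh.continuous.mul hppk).integrable_of_hasCompactSupport hppc.mul_left)
      ((hh.continuous.mul hpk).integrable_of_hasCompactSupport hpc.mul_left)
      (fun x _ => hh.differentiable (by simp) x)
      (fun x _ => Complex.ofRealCLM.differentiableAt.comp x (hp.differentiable (by simp) x))
    simp only [hpd] at this
    rw [this, neg_neg]
  rw [key, key]
  simp only [pd_comm hφ2 i j]

/-- If the time derivative of a solenoidal field differs from a solenoidal `L²` field by a
gradient, then this gradient vanishes. -/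
theorem fderiv_eq_zero_and_integral_eq {T : EReal} {f D V : Fin 3 → ℝ → Space3 → ℂ}
    {h : ℝ → Space3 → ℂ}
    (hD : ∀ i, ContinuousOn (fun z : ℝ × Space3 => D i z.1 z.2) (timeInterval T ×ˢ Set.univ))
    (hfD : ∀ i, ∀ a ∈ timeInterval T, ∀ b ∈ timeInterval T, a ≤ b → ∀ x,
      f i b x - f i a x = ∫ s in a..b, D i s x)
    (hf : ∀ i, ∀ t ∈ timeInterval T, MemLp (f i t) 2 volume)
    (hfdiv : ∀ t ∈ timeInterval T, ∀ φ : Space3 → ℝ, ContDiff ℝ ∞ φ → HasCompactSupport φ →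
      ∑ k, ∫ x, f k t x * (pd k φ x : ℝ) = 0)
    (hV : ∀ i, L2Curve (timeInterval T) (V i))
    (hVdiv : ∀ t ∈ timeInterval T, ∀ φ : Space3 → ℝ, ContDiff ℝ ∞ φ → HasCompactSupport φ →
      ∑ k, ∫ x, V k t x * (pd k φ x : ℝ) = 0)
    (hh : ∀ t ∈ timeInterval T, ContDiff ℝ 1 (h t))
    (hm : ∀ t ∈ timeInterval T, ∀ i x, D i t x = V i t x - fderiv ℝ (h t) x (basisVec i)) :
    (∀ t ∈ timeInterval T, ∀ i x, fderiv ℝ (h t) x (basisVec i) = 0) ∧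
    ∀ i, ∀ a ∈ timeInterval T, ∀ b ∈ timeInterval T, a ≤ b →
      toL2 (f i b) - toL2 (f i a) = ∫ s in a..b, toL2 (V i s) := by
  have mφ : ∀ φ : Space3 → ℝ, Continuous φ → HasCompactSupport φ → MemLp φ 2 volume :=
    fun φ h1 h2 => h1.memLp_of_hasCompactSupport h2
  have cV : ∀ i, ContinuousOn (fun t => toL2 (V i t)) (timeInterval T) :=
    fun i => (hV i).continuousOn_toL2
  have pV : ∀ i, ∀ a ∈ timeInterval T, ∀ b ∈ timeInterval T, a ≤ b → ∀ φ : Space3 → ℝ,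
      Continuous φ → HasCompactSupport φ → pairing φ (∫ s in a..b, toL2 (V i s))
        = ∫ s in a..b, ∫ x, V i s x * (φ x : ℂ) := by
    intro i a ha b hb hab φ h1 h2
    rw [← ContinuousLinearMap.intervalIntegral_comp_comm _
      (intervalIntegrable_of_continuousOn (cV i) ha hb hab)]
    refine intervalIntegral.integral_congr fun s hs => ?_
    rw [Set.uIcc_of_le hab] at hs
    exact pairing_toL2 (mφ φ h1 h2) ((hV i) s (Icc_subset_timeInterval ha.1 hb.2 hs)).1
  have cpV : ∀ i, ∀ φ : Space3 → ℝ, Continuous φ → HasCompactSupport φ →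
      ContinuousOn (fun s => ∫ x, V i s x * (φ x : ℂ)) (timeInterval T) := by
    intro i φ h1 h2
    refine ((pairing φ).continuous.comp_continuousOn (cV i)).congr fun s hs => ?_
    exact (pairing_toL2 (mφ φ h1 h2) ((hV i) s hs).1).symm
  have iV : ∀ i, ∀ s ∈ timeInterval T, ∀ φ : Space3 → ℝ, Continuous φ → HasCompactSupport φ →
      Integrable fun x => V i s x * (φ x : ℂ) := fun i s hs φ h1 h2 =>
    ((hV i) s hs).1.integrable_mul (mφ φ h1 h2).ofReal
  have iD : ∀ i, ∀ s ∈ timeInterval T, ∀ φ : Space3 → ℝ, Continuous φ → HasCompactSupport φ →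
      Integrable fun x => D i s x * (φ x : ℂ) := fun i s hs φ h1 h2 => by
    have hc : Continuous (D i s) := continuousOn_univ.1
      ((hD i).comp (f := fun x => (s, x)) (by fun_prop) fun x _ => ⟨hs, Set.mem_univ _⟩)
    exact (hc.mul (Complex.continuous_ofReal.comp h1)).integrable_of_hasCompactSupport
      (h2.comp_left Complex.ofReal_zero).mul_left
  have iVD : ∀ i, ∀ s ∈ timeInterval T, ∀ φ : Space3 → ℝ, Continuous φ → HasCompactSupport φ →
      (∫ x, V i s x * (φ x : ℂ)) - ∫ x, D i s x * (φ x : ℂ)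
        = ∫ x, fderiv ℝ (h s) x (basisVec i) * (φ x : ℂ) := by
    intro i s hs φ h1 h2
    rw [← integral_sub (iV i s hs φ h1 h2) (iD i s hs φ h1 h2)]
    congr 1; ext x
    rw [hm s hs]; ring
  -- pairing of the defect `f a - f b + ∫ V` with test functions
  have pw : ∀ i, ∀ a ∈ timeInterval T, ∀ b ∈ timeInterval T, a ≤ b → ∀ φ : Space3 → ℝ,
      Continuous φ → HasCompactSupport φ →
      pairing φ (toL2 (f i a) - toL2 (f i b) + ∫ s in a..b, toL2 (V i s))
        = ∫ s in a..b, ∫ x, fderiv ℝ (h s) x (basisVec i) * (φ x : ℂ) := by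
    intro i a ha b hb hab φ h1 h2
    have hsub := Icc_subset_timeInterval ha.1 hb.2
    have iF : ∀ t ∈ timeInterval T, Integrable fun x => f i t x * (φ x : ℂ) := fun t ht =>
      (hf i t ht).integrable_mul (mφ φ h1 h2).ofReal
    have e1 : pairing φ (toL2 (f i b)) - pairing φ (toL2 (f i a))
        = ∫ s in a..b, ∫ x, D i s x * (φ x : ℂ) := by
      rw [pairing_toL2 (mφ φ h1 h2) (hf i a ha), pairing_toL2 (mφ φ h1 h2) (hf i b hb),
        ← integral_sub (iF b hb) (iF a ha),
        ← integral_mul_integral_swap hab ((hD i).mono (Set.prod_mono_left hsub)) h1 h2]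
      congr 1; ext x
      rw [← hfD i a ha b hb hab x]; ring
    have e2 : pairing φ (toL2 (f i a) - toL2 (f i b) + ∫ s in a..b, toL2 (V i s))
        = (∫ s in a..b, ∫ x, V i s x * (φ x : ℂ)) - ∫ s in a..b, ∫ x, D i s x * (φ x : ℂ) := by
      rw [map_add, map_sub, pV i a ha b hb hab φ h1 h2, ← e1]; ring
    rw [e2, ← intervalIntegral.integral_sub
      (intervalIntegrable_of_continuousOn (cpV i φ h1 h2) ha hb hab)
      (intervalIntegrable_of_continuousOn (continuousOn_integral_mul (hD i) h1 h2) ha hb hab)]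
    refine intervalIntegral.integral_congr fun s hs => ?_
    rw [Set.uIcc_of_le hab] at hs
    exact iVD i s (hsub hs) φ h1 h2
  -- The defect is an L² field although its integrand, the gradient of `h`, is not known to be one.
  -- It is solenoidal because `f` and `V` are, and curl free because by `pw` it pairs with test
  -- functions as a time integral of gradients.
  have w0 : ∀ i, ∀ a ∈ timeInterval T, ∀ b ∈ timeInterval T, a ≤ b →
      toL2 (f i a) - toL2 (f i b) + ∫ s in a..b, toL2 (V i s) = 0 := by
    intro i a ha b hb hab
    have hsub := Icc_subset_timeInterval ha.1 hb.2
    rw [Lp.eq_zero_iff_ae_eq_zero]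
    refine ae_eq_zero_of_div_curl
      (a := fun k => ⇑(toL2 (f k a) - toL2 (f k b) + ∫ s in a..b, toL2 (V k s)))
      (fun k => Lp.memLp _) (fun φ h1 h2 => ?_) (fun φ h1 h2 i j => ?_) i
    · have hp : ∀ k, Continuous (pd k φ) := fun k => continuous_pd (h1.of_le (by simp)) k
      have hpc : ∀ k, HasCompactSupport (pd k φ) := fun k => hasCompactSupport_pd h2 k
      have e : ∀ k, ∫ x, (toL2 (f k a) - toL2 (f k b) + ∫ s in a..b, toL2 (V k s) :
            Lp ℂ 2 (volume : Measure Space3)) x * (pd k φ x : ℂ)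
          = (∫ x, f k a x * (pd k φ x : ℂ)) - (∫ x, f k b x * (pd k φ x : ℂ))
            + ∫ s in a..b, ∫ x, V k s x * (pd k φ x : ℂ) := fun k => by
        rw [← pairing_apply (mφ _ (hp k) (hpc k)), map_add, map_sub,
          pV k a ha b hb hab _ (hp k) (hpc k), pairing_toL2 (mφ _ (hp k) (hpc k)) (hf k a ha),
          pairing_toL2 (mφ _ (hp k) (hpc k)) (hf k b hb)]
      simp only [e, Finset.sum_add_distrib, Finset.sum_sub_distrib]
      rw [hfdiv a ha φ h1 h2, hfdiv b hb φ h1 h2, ← intervalIntegral.integral_finsetSum fun k _ =>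
        intervalIntegrable_of_continuousOn (cpV k _ (hp k) (hpc k)) ha hb hab,
        intervalIntegral.integral_congr (g := fun _ => 0) fun s hs => ?_]
      · simp
      · rw [Set.uIcc_of_le hab] at hs
        exact hVdiv s (hsub hs) φ h1 h2
    · have hp : ∀ k, Continuous (pd k φ) := fun k => continuous_pd (h1.of_le (by simp)) k
      have hpc : ∀ k, HasCompactSupport (pd k φ) := fun k => hasCompactSupport_pd h2 k
      rw [← pairing_apply (mφ _ (hp j) (hpc j)), ← pairing_apply (mφ _ (hp i) (hpc i)),
        pw i a ha b hb hab _ (hp j) (hpc j), pw j a ha b hb hab _ (hp i) (hpc i)]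
      refine intervalIntegral.integral_congr fun s hs => ?_
      rw [Set.uIcc_of_le hab] at hs
      exact integral_fderiv_mul_pd_comm (hh s (hsub hs)) h1 h2 i j
  refine ⟨fun t ht i => ?_, fun i a ha b hb hab => ?_⟩
  · have hk : Continuous fun x => fderiv ℝ (h t) x (basisVec i) :=
      ((hh t ht).continuous_fderiv (by simp)).clm_apply continuous_const
    have h0 : ∀ φ : Space3 → ℝ, ContDiff ℝ ∞ φ → HasCompactSupport φ →
        ∫ x, fderiv ℝ (h t) x (basisVec i) * (φ x : ℂ) = 0 := by
      intro φ h1 h2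
      -- No continuity of `h` in time is assumed; the pairing is continuous as the difference of
      -- those of `V` and `D`.
      have hG : ContinuousOn (fun s => ∫ x, fderiv ℝ (h s) x (basisVec i) * (φ x : ℂ))
          (timeInterval T) :=
        ((cpV i φ h1.continuous h2).sub (continuousOn_integral_mul (hD i) h1.continuous h2)).congr
          fun s hs => (iVD i s hs φ h1.continuous h2).symm
      have d1 := hasDerivWithinAt_integral_of_continuousOn hG ht
      -- By `w0` the integral vanishes for every b slightly to the right of t, so its right
      -- derivative, which is the integrand at t, is zero.
      have d2 : HasDerivWithinAt
          (fun b => ∫ s in t..b, ∫ x, fderiv ℝ (h s) x (basisVec i) * (φ x : ℂ)) 0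
          (Set.Ici t) t := by
        refine (hasDerivWithinAt_const t _ (0 : ℂ)).congr_of_eventuallyEq ?_ (by simp)
        obtain ⟨τ, l1, -, l3, -⟩ := timeInterval_exists_Icc ht
        filter_upwards [Ico_mem_nhdsGE l1] with b hb
        have hbS := Icc_subset_timeInterval ht.1 l3 ⟨hb.1, hb.2.le⟩
        rw [← pw i t ht b hbS hb.1 φ h1.continuous h2, w0 i t ht b hbS hb.1, map_zero]
      exact (uniqueDiffWithinAt_Ici t).eq_deriv _ d1 d2
    have hz : (fun x => fderiv ℝ (h t) x (basisVec i)) =ᵐ[volume] fun _ => 0 :=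
      ae_eq_zero_of_integral_contDiff_smul_eq_zero hk.locallyIntegrable fun φ h1 h2 => by
        simpa [mul_comm, Complex.real_smul] using h0 φ h1 h2
    exact congrFun ((hk.ae_eq_iff_eq volume continuous_const).1 hz)
  · have := w0 i a ha b hb hab
    rw [← sub_eq_zero, ← neg_eq_zero, ← this]
    abel

end Bardina

/-! ### The acceleration, and the identification of the pressure up to a constant. -/

namespace Bardina
open scoped FourierTransform SchwartzMap LineDeriv ENNReal NNReal ComplexConjugate

/-- The acceleration `ν Δ vᵢ - ∂ⱼ(filtered (vᵢ vⱼ)) - ∂ᵢ π` of the velocity field `v` with Fourier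
transform `U`, where `π` is the pressure vanishing at infinity. -/
noncomputable def accel (α ν : ℝ) (U : Fin 3 → Space3 → ℂ) (v : Space3 → Space3) (i : Fin 3)
    (x : Space3) : ℂ :=
  (ν : ℂ) * ∑ j, (pd j (pd j fun y => v y i) x : ℂ) - (𝓕⁻ (convectionFT α U i) : Space3 → ℂ) x
    - (𝓕⁻ (fun ξ => symb i ξ * pressureFT α U ξ) : Space3 → ℂ) x

/-- The Fourier transform of the acceleration. -/
noncomputable def accelFT (α ν : ℝ) (U : Fin 3 → Space3 → ℂ) (i : Fin 3) (ξ : Space3) : ℂ :=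
  (ν : ℂ) * ∑ j, symb j ξ * (symb j ξ * U i ξ) - convectionFT α U i ξ
    - symb i ξ * pressureFT α U ξ

section

variable {S : Set ℝ} {α : ℝ} {u : ℝ → Space3 → Space3} {U : Fin 3 → ℝ → Space3 → ℂ}

lemma FourierData.isFT_convection (h : FourierData S u U) (hα : 0 < α) {t : ℝ} (ht : t ∈ S)
    (i : Fin 3) :
    IsFT (𝓕⁻ (convectionFT α (fun k => U k t) i)) (convectionFT α (fun k => U k t) i) :=
  have hc := (L2Curve.convectionFT hα h.curve i t ht).1
  isFT_fourierInv (integrable_of_wt hc) (memLp_of_wt hc)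

lemma FourierData.isFT_pressure_grad (h : FourierData S u U) (hα : 0 < α) {t : ℝ} (ht : t ∈ S)
    (i : Fin 3) :
    IsFT (𝓕⁻ (fun ξ => symb i ξ * pressureFT α (fun k => U k t) ξ))
      (fun ξ => symb i ξ * pressureFT α (fun k => U k t) ξ) :=
  have hc := ((L2Curve.pressureFT hα h.curve).wt_symb_mul i t ht).1
  isFT_fourierInv (integrable_of_wt hc) (memLp_of_wt hc)

lemma FourierData.isFT_accel (h : FourierData S u U) (hα : 0 < α) (ν : ℝ) {t : ℝ} (ht : t ∈ S)
    (i : Fin 3) :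
    IsFT (accel α ν (fun k => U k t) (u t) i) (accelFT α ν (fun k => U k t) i) :=
  (((IsFT.sum Finset.univ fun j _ => h.isFT_pd_pd t ht i j j).const_mul (ν : ℂ)).sub
    (h.isFT_convection hα ht i)).sub (h.isFT_pressure_grad hα ht i)

lemma FourierData.l2Curve_symb_sq (h : FourierData S u U) (i j : Fin 3) :
    L2Curve S fun t ξ => symb j ξ * (symb j ξ * U i t ξ) := by
  have hb : ∀ ξ, ‖symb j ξ * symb j ξ‖ ≤ (2 * Real.pi) ^ 2 * wt ξ := fun ξ => by
    rw [norm_mul, ← sq]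
    calc ‖symb j ξ‖ ^ 2 ≤ (2 * Real.pi * ‖ξ‖) ^ 2 := by gcongr; exact norm_symb_le j ξ
      _ ≤ _ := by
        rw [mul_pow, wt]; gcongr; linarith
  exact ((h.curve i).mul_of_wt ((continuous_symb j).mul (continuous_symb j)).measurable hb).congr
    fun t _ => ae_of_all _ fun ξ => mul_assoc _ _ _

lemma FourierData.l2Curve_accel (h : FourierData S u U) (hα : 0 < α) (ν : ℝ) (i : Fin 3) :
    L2Curve S fun t => accel α ν (fun k => U k t) (u t) i := by
  have hFT : L2Curve S fun t => accelFT α ν (fun k => U k t) i :=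
    (((L2Curve.sum Finset.univ fun j _ => h.l2Curve_symb_sq i j).const_mul (ν : ℂ)).sub
      (L2Curve.convectionFT hα h.curve i).of_wt).sub
        ((L2Curve.pressureFT hα h.curve).wt_symb_mul i).of_wt
  exact hFT.inv_ft fun t ht => h.isFT_accel hα ν ht i

/-- The viscous part is solenoidal with u, and the pressure is chosen so that its gradient cancels
the divergence of the convection term. -/
lemma FourierData.sum_symb_mul_accelFT (h : FourierData S u U) (ν : ℝ) {t : ℝ} (ht : t ∈ S) :
    ∀ᵐ ξ, ∑ k, symb k ξ * accelFT α ν (fun k => U k t) k ξ = 0 := by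
  filter_upwards [h.sum_symb_mul ht] with ξ hξ
  have e := sum_symb_convectionFT_add (α := α) (U := fun k => U k t) ξ
  have e2 : ∀ k, symb k ξ * accelFT α ν (fun k => U k t) k ξ
      = ν * (∑ j, symb j ξ * symb j ξ) * (symb k ξ * U k t ξ)
        - symb k ξ * (convectionFT α (fun k => U k t) k ξ
          + symb k ξ * pressureFT α (fun k => U k t) ξ) := fun k => by
    have : ∑ j, symb j ξ * (symb j ξ * U k t ξ) = (∑ j, symb j ξ * symb j ξ) * U k t ξ := by
      rw [Finset.sum_mul]; simp only [mul_assoc]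
    rw [accelFT, this]; ring
  rw [Finset.sum_congr rfl fun k _ => e2 k, Finset.sum_sub_distrib, e, ← Finset.mul_sum, hξ]
  simp

end

section

variable {α ν : ℝ} {T : EReal} {u₀ : Space3 → Space3} {u : ℝ → Space3 → Space3}
  {p : ℝ → Space3 → ℝ} {U : Fin 3 → ℝ → Space3 → ℂ}

lemma continuousOn_laplacian (h : IsRegularSolution α ν T u₀ u p) (x : Space3) :
    ContinuousOn (fun t => Laplacian.laplacian (u t) x) (timeInterval T) := by
  have hc := ContinuousOn.of_uncurry_left (g := fun t x => iteratedFDeriv ℝ 2 (u t) x)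
    h.cont_hess_u x
  simp only [InnerProductSpace.laplacian_eq_iteratedFDeriv_stdOrthonormalBasis]
  refine continuousOn_finsetSum _ fun j _ => ?_
  exact (ContinuousMultilinearMap.apply ℝ (fun _ : Fin 2 => Space3) Space3
    _).continuous.comp_continuousOn hc

/-- The momentum equation holds up to the initial time. -/
lemma IsRegularSolution.momentum_complex (h : IsRegularSolution α ν T u₀ u p) (hα : 0 < α)
    (hU : FourierData (timeInterval T) u U) {t : ℝ} (ht : t ∈ timeInterval T) (i : Fin 3)
    (x : Space3) :
    (timeDeriv u t x i : ℂ) = (ν : ℂ) * ∑ j, (pd j (pd j fun y => u t y i) x : ℂ)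
      - (𝓕⁻ (convectionFT α (fun k => U k t) i) : Space3 → ℂ) x - (pd i (p t) x : ℂ) := by
  have hL : ∀ t ∈ timeInterval T, ∑ j, (pd j (pd j fun y => u t y i) x : ℂ)
      = ((Laplacian.laplacian (u t) x i : ℝ) : ℂ) := fun t ht => by
    rw [laplacian_coord (hU.contDiff t ht), Complex.ofReal_sum]
  have hcont : ContinuousOn (fun t => (timeDeriv u t x i : ℂ)
      - (ν : ℂ) * ((Laplacian.laplacian (u t) x i : ℝ) : ℂ)
      + (𝓕⁻ (convectionFT α (fun k => U k t) i) : Space3 → ℂ) x + (gradient (p t) x i : ℂ))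
      (timeInterval T) := by
    have hco : Continuous fun y : Space3 => ((y i : ℝ) : ℂ) :=
      Complex.continuous_ofReal.comp (coordCLM i).continuous
    refine ContinuousOn.add (ContinuousOn.add (ContinuousOn.sub ?_ (continuousOn_const.mul ?_)) ?_) ?_
    · exact hco.comp_continuousOn
        (ContinuousOn.of_uncurry_left (g := fun t x => timeDeriv u t x) h.cont_timeDeriv x)
    · exact hco.comp_continuousOn (continuousOn_laplacian h x)
    · exact (L2Curve.convectionFT hα hU.curve i).continuousOn_fourierInv x
    · exact hco.comp_continuousOn
        (ContinuousOn.of_uncurry_left (g := fun t x => gradient (p t) x) h.cont_grad_p x)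
  have := eq_zero_of_timeInterval_pos hcont (fun t ht h0 => by
    rw [← divFilteredTensor_eq hα (fun i => (hU.curve i t ht).1) (hU.eq_fourierInv t ht)]
    have := h.momentum t ht h0 x i
    norm_cast
    linarith) t ht
  rw [hL t ht, ← gradient_coord]
  linear_combination this

/-- Fundamental theorem of calculus at a fixed point x, with continuity of the derivative up to t =
0. -/
lemma IsRegularSolution.sub_eq_integral (h : IsRegularSolution α ν T u₀ u p) {a b : ℝ}
    (ha : a ∈ timeInterval T) (hb : b ∈ timeInterval T) (hab : a ≤ b) (i : Fin 3) (x : Space3) :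
    (u b x i : ℂ) - u a x i = ∫ s in a..b, (timeDeriv u s x i : ℂ) := by
  have hsub := Icc_subset_timeInterval ha.1 hb.2
  have c1 : ContinuousOn (fun s => u s x i) (timeInterval T) :=
    (coordCLM i).continuous.comp_continuousOn
      (ContinuousOn.of_uncurry_left (g := fun t x => u t x) h.cont_u x)
  have c2 : ContinuousOn (fun s => timeDeriv u s x i) (timeInterval T) :=
    (coordCLM i).continuous.comp_continuousOn
      (ContinuousOn.of_uncurry_left (g := fun t x => timeDeriv u t x) h.cont_timeDeriv x)
  rw [intervalIntegral.integral_ofReal, ← Complex.ofReal_sub]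
  congr 1
  refine (intervalIntegral.integral_eq_sub_of_hasDeriv_right (f := fun s => u s x i)
    (by rw [Set.uIcc_of_le hab]; exact c1.mono hsub) (fun s hs => ?_)
    (intervalIntegrable_of_continuousOn c2 ha hb hab)).symm
  rw [min_eq_left hab, max_eq_right hab] at hs
  have hsS := hsub ⟨hs.1.le, hs.2.le⟩
  have hd := (h.timeDiff s hsS x).hasDerivWithinAt
  have := (coordCLM i).hasFDerivAt.comp_hasDerivWithinAt s hd
  exact this.mono fun r hr => hsS.1.trans (le_of_lt hr)

/-- The difference of the given and the canonical pressure is the potential whose gradient the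
div-curl argument annihilates. -/
lemma contDiff_potential (h : IsRegularSolution α ν T u₀ u p) (hα : 0 < α)
    (hU : FourierData (timeInterval T) u U) {t : ℝ} (ht : t ∈ timeInterval T) :
    ContDiff ℝ 1 (fun x => (p t x : ℂ)
      - (𝓕⁻ (pressureFT α (fun k => U k t)) : Space3 → ℂ) x) ∧
    ∀ i x, fderiv ℝ (fun x => (p t x : ℂ)
      - (𝓕⁻ (pressureFT α (fun k => U k t)) : Space3 → ℂ) x) x (basisVec i)
      = (pd i (p t) x : ℂ)
        - (𝓕⁻ (fun ξ => symb i ξ * pressureFT α (fun k => U k t) ξ) : Space3 → ℂ) x := by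
  obtain ⟨h0, h1⟩ := integrable_norm_mul_of_wt_wt (L2Curve.pressureFT hα hU.curve t ht).1
  have hp := h.spaceDiff_p t ht
  refine ⟨(Complex.ofRealCLM.contDiff.comp hp).sub (contDiff_one_fourierInv h0 h1), fun i x => ?_⟩
  obtain ⟨hd, hj⟩ := hasFDerivAt_fourierInv h0 h1 x
  have hpx : DifferentiableAt ℝ (p t) x := hp.differentiable (by simp) x
  have hpc : DifferentiableAt ℝ (fun x => (p t x : ℂ)) x :=
    Complex.ofRealCLM.differentiableAt.comp x hpx
  rw [fderiv_fun_sub hpc hd,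
    _root_.sub_apply, hj i, fderiv_ofReal_comp hpx, pd]

lemma eq_of_fderiv_basisVec_eq_zero {f : Space3 → ℂ} (hf : Differentiable ℝ f)
    (h : ∀ i x, fderiv ℝ f x (basisVec i) = 0) (x y : Space3) : f x = f y := by
  refine is_const_of_fderiv_eq_zero hf (fun x => ?_) x y
  refine ContinuousLinearMap.coe_injective
    ((EuclideanSpace.basisFun (Fin 3) ℝ).toBasis.ext fun i => ?_)
  simpa [basisVec] using h i x

/-- The pressure is determined up to a constant, and the equation holds in `L²`. -/
theorem IsRegularSolution.pressure_and_timeDeriv (h : IsRegularSolution α ν T u₀ u p) (hα : 0 < α)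
    (hU : FourierData (timeInterval T) u U) :
    (∀ t ∈ timeInterval T, ∀ x, (p t x : ℂ) - (𝓕⁻ (pressureFT α (fun k => U k t)) : Space3 → ℂ) x
      = (p t 0 : ℂ) - (𝓕⁻ (pressureFT α (fun k => U k t)) : Space3 → ℂ) 0) ∧
    (∀ t ∈ timeInterval T, ∀ i x,
      (timeDeriv u t x i : ℂ) = accel α ν (fun k => U k t) (u t) i x) ∧
    ∀ i, ∀ a ∈ timeInterval T, ∀ b ∈ timeInterval T, a ≤ b →
      toL2 (fun x => (u b x i : ℂ)) - toL2 (fun x => (u a x i : ℂ))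
        = ∫ s in a..b, toL2 (accel α ν (fun k => U k s) (u s) i) := by
  have hm : ∀ t ∈ timeInterval T, ∀ i x,
      (timeDeriv u t x i : ℂ) = accel α ν (fun k => U k t) (u t) i x
        - fderiv ℝ (fun x => (p t x : ℂ)
          - (𝓕⁻ (pressureFT α (fun k => U k t)) : Space3 → ℂ) x) x (basisVec i) :=
    fun t ht i x => by
      rw [h.momentum_complex hα hU ht, (contDiff_potential h hα hU ht).2, accel]; ring
  obtain ⟨h1, h2⟩ := fderiv_eq_zero_and_integral_eq
    (f := fun i t x => (u t x i : ℂ)) (D := fun i t x => (timeDeriv u t x i : ℂ))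
    (V := fun i t => accel α ν (fun k => U k t) (u t) i)
    (h := fun t x => (p t x : ℂ) - (𝓕⁻ (pressureFT α (fun k => U k t)) : Space3 → ℂ) x)
    (fun i => (Complex.continuous_ofReal.comp (coordCLM i).continuous).comp_continuousOn
      h.cont_timeDeriv)
    (fun i a ha b hb hab x => h.sub_eq_integral ha hb hab i x)
    (fun i t ht => (hU.isFT t ht i).memLp)
    (fun t ht φ g1 g2 => sum_integral_mul_fderiv_eq_zero (hU.isFT t ht) (hU.sum_symb_mul ht) g1 g2)
    (fun i => hU.l2Curve_accel hα ν i)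
    (fun t ht φ g1 g2 => sum_integral_mul_fderiv_eq_zero (fun k => hU.isFT_accel hα ν ht k)
      (hU.sum_symb_mul_accelFT ν ht) g1 g2)
    (fun t ht => (contDiff_potential h hα hU ht).1) hm
  refine ⟨fun t ht x => ?_, fun t ht i x => ?_, h2⟩
  · exact eq_of_fderiv_basisVec_eq_zero
      ((contDiff_potential h hα hU ht).1.differentiable (by simp)) (h1 t ht) x 0
  · rw [hm t ht, h1 t ht, sub_zero]

end

end Bardina

/-! ### Regularity of the pressure and of the time derivative. -/

namespace Bardina
open scoped FourierTransform SchwartzMap LineDeriv ENNReal NNReal ComplexConjugate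

/-- Each symbol costs at most 2π times the square root of the weight, so up to four of them cost at
most two weights. -/
lemma norm_prod_symb_le {n : ℕ} (hn : n ≤ 4) (I : Fin n → Fin 3) (ξ : Space3) :
    ‖∏ k, symb (I k) ξ‖ ≤ (2 * Real.pi) ^ n * (wt ξ * wt ξ) := by
  have h1 : 1 ≤ √(wt ξ) := Real.one_le_sqrt.2 (one_le_wt ξ)
  have h2 : ‖ξ‖ ≤ √(wt ξ) := Real.le_sqrt_of_sq_le (by rw [wt]; linarith)
  rw [norm_prod]
  calc ∏ k, ‖symb (I k) ξ‖ ≤ ∏ _k : Fin n, 2 * Real.pi * √(wt ξ) := by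
        refine Finset.prod_le_prod (fun _ _ => norm_nonneg _) fun k _ => ?_
        exact (norm_symb_le _ ξ).trans (by gcongr)
    _ = (2 * Real.pi) ^ n * √(wt ξ) ^ n := by simp [mul_pow]
    _ ≤ (2 * Real.pi) ^ n * √(wt ξ) ^ 4 := by gcongr
    _ = _ := by
        rw [show √(wt ξ) ^ 4 = √(wt ξ) ^ 2 * √(wt ξ) ^ 2 by ring, Real.sq_sqrt (wt_pos ξ).le]

/-- The real part of the inverse transform of a curve with weight of order four is in
`C(S; H⁴)`. -/
lemma L2Curve.continuousIntoSobolev_fourierInv {S : Set ℝ} {q : ℝ → Space3 → ℂ}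
    (hq : L2Curve S fun t ξ => wt ξ * (wt ξ * q t ξ)) :
    ContinuousIntoSobolev 4 S fun t x => ((𝓕⁻ (q t) : Space3 → ℂ) x).re := by
  intro n hn I
  have hmeas : Measurable fun ξ => ∏ k, symb (I k) ξ :=
    (continuous_finsetProd _ fun k _ => continuous_symb (I k)).measurable
  have hM : L2Curve S fun t ξ => (∏ k, symb (I k) ξ) * q t ξ := by
    -- One of the two weights is divided off inside the multiplier; the other is the one that
    -- `mul_of_wt` absorbs.
    have := hq.mul_of_wt (U := fun t ξ => wt ξ * q t ξ)
      (m := fun ξ => (∏ k, symb (I k) ξ) * (wt ξ : ℂ)⁻¹) (hmeas.mul measurable_inv_wt)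
      (C := (2 * Real.pi) ^ n) fun ξ => by
        rw [norm_mul, norm_inv, norm_wt, ← div_eq_mul_inv, div_le_iff₀ (wt_pos ξ), mul_assoc]
        exact norm_prod_symb_le hn I ξ
    refine this.congr fun t _ => ae_of_all _ fun ξ => ?_
    simp only [mul_assoc]
    rw [inv_mul_cancel_left₀ (wt_ne_zero ξ)]
  have hex : ∀ t, ∃ g, t ∈ S → IsFT g fun ξ => (∏ k, symb (I k) ξ) * q t ξ := fun t => by
    by_cases ht : t ∈ S
    · obtain ⟨g, hg⟩ := (hM t ht).1.exists_isFT_inv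
      exact ⟨g, fun _ => hg⟩
    · exact ⟨0, fun h => (ht h).elim⟩
  choose g hg using hex
  refine ⟨fun t x => (g t x).re, fun t ht => ?_, (hM.inv_ft hg).re⟩
  have h0 : IsFT (𝓕⁻ (q t)) (q t) :=
    isFT_fourierInv (integrable_of_wt (memLp_of_wt (hq t ht).1))
      (memLp_of_wt (memLp_of_wt (hq t ht).1))
  refine ⟨h0.memLp.re.locallyIntegrable (by norm_num),
    (hg t ht).memLp.re.locallyIntegrable (by norm_num), fun φ h1 h2 => ?_⟩
  have key := h0.integral_mul_iteratedFDeriv (hg t ht) h1 h2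
  have hre : ∀ {f : Space3 → ℂ} {ψ : Space3 → ℝ}, MemLp f 2 volume → Continuous ψ →
      HasCompactSupport ψ → ∫ x, (f x).re * ψ x = (∫ x, f x * (ψ x : ℂ)).re := by
    intro f ψ hf hψ hψc
    have hψm : MemLp (fun x => (ψ x : ℂ)) 2 volume := (hψ.memLp_of_hasCompactSupport hψc).ofReal
    have := integral_re (𝕜 := ℂ) (f := fun x => f x * (ψ x : ℂ)) (hf.integrable_mul hψm)
    simpa using this
  rw [hre (hg t ht).memLp h1.continuous h2, hre h0.memLp
    (ψ := fun x => iteratedFDeriv ℝ n φ x fun k => basisVec (I k)) ?_ ?_, key]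
  · rw [show ((-1 : ℂ)) ^ n = (((-1 : ℝ) ^ n : ℝ) : ℂ) by push_cast; rfl, Complex.re_ofReal_mul]
  · exact (ContinuousMultilinearMap.apply ℝ (fun _ : Fin n => Space3) ℝ
      fun k => basisVec (I k)).continuous.comp
        (h1.continuous_iteratedFDeriv (m := n) (by exact_mod_cast le_top))
  · exact (h2.iteratedFDeriv (𝕜 := ℝ) n).comp_left
      (g := fun L : ContinuousMultilinearMap ℝ (fun _ : Fin n => Space3) ℝ =>
        L fun k => basisVec (I k)) rfl

lemma ContinuousIntoSobolev.congr {m : ℕ} {S : Set ℝ} {f g : ℝ → Space3 → ℝ}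
    (hf : ContinuousIntoSobolev m S f) (h : ∀ t ∈ S, f t = g t) : ContinuousIntoSobolev m S g := by
  intro n hn I
  obtain ⟨k, hk, hk'⟩ := hf n hn I
  exact ⟨k, fun t ht => h t ht ▸ hk t ht, hk'⟩

lemma ContinuousIntoSobolev.mono {m : ℕ} {S S' : Set ℝ} {f : ℝ → Space3 → ℝ}
    (hf : ContinuousIntoSobolev m S f) (h : S' ⊆ S) : ContinuousIntoSobolev m S' f := by
  intro n hn I
  obtain ⟨k, hk, hk'⟩ := hf n hn I
  exact ⟨k, fun t ht => hk t (h ht), hk'.mono h⟩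

section

variable {α ν : ℝ} {T : EReal} {u₀ : Space3 → Space3} {u : ℝ → Space3 → Space3}
  {p : ℝ → Space3 → ℝ}

theorem IsRegularSolution.exists_pressure_limit (h : IsRegularSolution α ν T u₀ u p) (hα : 0 < α) :
    ∃ c : ℝ → ℝ, ContinuousOn c (timeInterval T) ∧
      (∀ t ∈ timeInterval T, Tendsto (p t) (cocompact Space3) (𝓝 (c t))) ∧
      (∀ t ∈ timeInterval T, MemLp (fun x => p t x - c t) 2 volume) ∧
      ContinuousIntoSobolev 4 (timeInterval T) (fun t x => p t x - c t) := by
  obtain ⟨U, hU⟩ := h.exists_fourierData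
  obtain ⟨h1, -⟩ := h.pressure_and_timeDeriv hα hU
  have hq := L2Curve.pressureFT hα hU.curve
  set q : ℝ → Space3 → ℂ := fun t => pressureFT α (fun k => U k t) with hqdef
  -- The difference of the two pressures is constant in x; evaluating it at the origin shows that it
  -- is continuous in t.
  set c : ℝ → ℝ := fun t => p t 0 - ((𝓕⁻ (q t) : Space3 → ℂ) 0).re with hc
  have hp : ∀ t ∈ timeInterval T, ∀ x, p t x - c t = ((𝓕⁻ (q t) : Space3 → ℂ) x).re :=
    fun t ht x => by
      have := congrArg Complex.re (h1 t ht x)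
      simp only [Complex.sub_re, Complex.ofReal_re] at this
      simp only [hc]
      linarith
  refine ⟨c, ?_, fun t ht => ?_, fun t ht => ?_, ?_⟩
  · exact (ContinuousOn.of_uncurry_left (g := fun t x => p t x) h.cont_p 0).sub
      (Complex.continuous_re.comp_continuousOn (hq.of_wt.continuousOn_fourierInv 0))
  · have := ((Complex.continuous_re.tendsto 0).comp
      (tendsto_fourierInv_cocompact (q t))).add_const (c t)
    simp only [Complex.zero_re, zero_add] at this
    refine this.congr fun x => ?_
    simp only [Function.comp_apply, ← hp t ht x]
    ring
  · simp only [hp t ht]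
    have hI := memLp_of_wt (hq t ht).1
    exact (isFT_fourierInv (integrable_of_wt hI) (memLp_of_wt hI)).memLp.re
  · exact hq.continuousIntoSobolev_fourierInv.congr fun t ht => funext fun x => (hp t ht x).symm

theorem IsRegularSolution.continuousIntoL2_timeDeriv (h : IsRegularSolution α ν T u₀ u p)
    (hα : 0 < α) (i : Fin 3) : ContinuousIntoL2 (timeInterval T) fun t x => timeDeriv u t x i := by
  obtain ⟨U, hU⟩ := h.exists_fourierData
  obtain ⟨-, h1, -⟩ := h.pressure_and_timeDeriv hα hU
  refine (hU.l2Curve_accel hα ν i).re.congr fun t ht => ae_of_all _ fun x => ?_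
  simp only [← h1 t ht i x, Complex.ofReal_re]

/-- A nonzero constant is not square integrable on ℝ³, and limits along the cocompact filter are
unique. -/
lemma eq_zero_of_memLp_or_tendsto {f : Space3 → ℝ} {c : ℝ}
    (h1 : Tendsto f (cocompact Space3) (𝓝 c)) (h2 : MemLp (fun x => f x - c) 2 volume)
    (h3 : MemLp f 2 volume ∨ Tendsto f (cocompact Space3) (𝓝 0)) : c = 0 := by
  rcases h3 with h3 | h3
  · have : MemLp (fun _ : Space3 => c) 2 volume :=
      (h3.sub h2).congr_norm aestronglyMeasurable_const (ae_of_all _ fun x => by simp)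
    rw [memLp_const_iff (by norm_num) (by norm_num)] at this
    refine this.resolve_right ?_
    simp
  · exact tendsto_nhds_unique h1 h3

end

end Bardina

/-! ### The operator 1 − α²Δ and the work of each term against it. -/

namespace Bardina
open scoped FourierTransform SchwartzMap LineDeriv ENNReal NNReal ComplexConjugate

/-- Functions of class `C²` which are in `H²`. -/
structure ClassicalH2 (f : Space3 → ℝ) : Prop where
  contDiff : ContDiff ℝ 2 f
  memLp : MemLp f 2 volume
  memLp_pd : ∀ j, MemLp (pd j f) 2 volume
  memLp_pd_pd : ∀ j k, MemLp (pd j (pd k f)) 2 volume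

/-- The Laplacian of a scalar function. -/
noncomputable def lapl (f : Space3 → ℝ) (x : Space3) : ℝ := ∑ j, pd j (pd j f) x

/-- The operator `1 - α² Δ`. -/
noncomputable def helm (α : ℝ) (f : Space3 → ℝ) (x : Space3) : ℝ := f x - α ^ 2 * lapl f x

lemma integrable_fun_mul {𝕜 : Type*} [RCLike 𝕜] {f g : Space3 → 𝕜} (hf : MemLp f 2 volume)
    (hg : MemLp g 2 volume) : Integrable fun x => f x * g x :=
  hf.integrable_mul hg

section

variable {f g : Space3 → ℝ}

lemma ClassicalH2.contDiff_one (hf : ClassicalH2 f) : ContDiff ℝ 1 f :=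
  hf.contDiff.of_le (by norm_num)

lemma ClassicalH2.memLp_lapl (hf : ClassicalH2 f) : MemLp (lapl f) 2 volume :=
  memLp_finsetSum _ fun j _ => hf.memLp_pd_pd j j

lemma ClassicalH2.memLp_helm (hf : ClassicalH2 f) (α : ℝ) : MemLp (helm α f) 2 volume :=
  hf.memLp.sub (hf.memLp_lapl.const_mul _)

lemma ClassicalH2.integral_mul_lapl (hf : ClassicalH2 f) (hg : ClassicalH2 g) :
    ∫ x, f x * lapl g x = -∑ j, ∫ x, pd j f x * pd j g x := by
  have h1 : ∀ j, Integrable fun x => f x * pd j (pd j g) x := fun j =>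
    hf.memLp.integrable_mul (hg.memLp_pd_pd j j)
  have e : ∀ x, f x * lapl g x = ∑ j, f x * pd j (pd j g) x := fun x => Finset.mul_sum _ _ _
  simp only [e]
  rw [integral_finsetSum _ fun j _ => h1 j, ← Finset.sum_neg_distrib]
  exact Finset.sum_congr rfl fun j _ => integral_mul_pd hf.contDiff_one
    (contDiff_pd hg.contDiff (by norm_num) j) j ((hf.memLp_pd j).integrable_mul (hg.memLp_pd j))
    (h1 j) (hf.memLp.integrable_mul (hg.memLp_pd j))

/-- For f = g this is the energy density of one component; the symmetry of the right-hand side makes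
the operator self-adjoint. -/
lemma ClassicalH2.integral_mul_helm (hf : ClassicalH2 f) (hg : ClassicalH2 g) (α : ℝ) :
    ∫ x, f x * helm α g x = (∫ x, f x * g x) + α ^ 2 * ∑ j, ∫ x, pd j f x * pd j g x := by
  have e : ∀ x, f x * helm α g x = f x * g x - α ^ 2 * (f x * lapl g x) := fun x => by
    rw [helm]; ring
  simp only [e]
  rw [integral_sub (integrable_fun_mul hf.memLp hg.memLp)
    ((integrable_fun_mul hf.memLp hg.memLp_lapl).const_mul _), integral_const_mul,
    hf.integral_mul_lapl hg]
  ring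

lemma ClassicalH2.integral_mul_helm_comm (hf : ClassicalH2 f) (hg : ClassicalH2 g) (α : ℝ) :
    ∫ x, f x * helm α g x = ∫ x, g x * helm α f x := by
  rw [hf.integral_mul_helm hg, hg.integral_mul_helm hf]
  simp only [mul_comm]

lemma ClassicalH2.integral_lapl_mul_helm (hf : ClassicalH2 f) (α : ℝ) :
    ∫ x, lapl f x * helm α f x
      = -((∑ j, ∫ x, pd j f x ^ 2) + α ^ 2 * ∫ x, lapl f x ^ 2) := by
  have e : ∀ x, lapl f x * helm α f x = f x * lapl f x - α ^ 2 * lapl f x ^ 2 := fun x => by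
    rw [helm]; ring
  simp only [e]
  rw [integral_sub (integrable_fun_mul hf.memLp hf.memLp_lapl)
    (hf.memLp_lapl.integrable_sq.const_mul _), integral_const_mul, hf.integral_mul_lapl hf]
  simp only [sq]
  ring

end

lemma pd_mul {f g : Space3 → ℝ} (hf : ContDiff ℝ 1 f) (hg : ContDiff ℝ 1 g) (j : Fin 3)
    (x : Space3) : pd j (fun y => f y * g y) x = pd j f x * g x + f x * pd j g x := by
  rw [pd, fderiv_fun_mul (hf.differentiable (by simp) x) (hg.differentiable (by simp) x)]
  simp only [_root_.add_apply, _root_.smul_apply, smul_eq_mul, pd]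
  ring

section

variable {S : Set ℝ} {α : ℝ} {u : ℝ → Space3 → Space3} {U : Fin 3 → ℝ → Space3 → ℂ}

lemma FourierData.classicalH2 (h : FourierData S u U) {t : ℝ} (ht : t ∈ S) (i : Fin 3) :
    ClassicalH2 fun x => u t x i where
  contDiff := contDiff_coord (h.contDiff t ht) i
  memLp := by simpa using (h.isFT t ht i).memLp.re
  memLp_pd j := by
    have := (h.isFT_pd t ht i j).memLp.re
    simpa using this
  memLp_pd_pd j k := by
    have := (h.isFT_pd_pd t ht i j k).memLp.re
    simpa using this

/-- The velocity is bounded because its transform is integrable, so products of L² functions with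
its components remain in L². -/
lemma FourierData.exists_norm_le (h : FourierData S u U) {t : ℝ} (ht : t ∈ S) (i : Fin 3) :
    ∃ C, ∀ x, ‖u t x i‖ ≤ C :=
  ⟨_, fun x => by
    rw [← Complex.norm_real, h.eq_fourierInv t ht]
    exact norm_fourierInv_le _ x⟩

/-- Products with a component of the velocity, which is bounded. -/
lemma FourierData.memLp_mul (h : FourierData S u U) {t : ℝ} (ht : t ∈ S) (i : Fin 3)
    {f : Space3 → ℝ} (hf : MemLp f 2 volume) : MemLp (fun x => u t x i * f x) 2 volume := by
  obtain ⟨C, hC⟩ := h.exists_norm_le ht i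
  refine hf.of_le_mul (c := C)
    ((h.classicalH2 ht i).contDiff.continuous.aestronglyMeasurable.mul hf.1)
    (ae_of_all _ fun x => ?_)
  rw [norm_mul]
  exact mul_le_mul_of_nonneg_right (hC x) (norm_nonneg _)

lemma FourierData.memLp_pd_mul (h : FourierData S u U) {t : ℝ} (ht : t ∈ S) (i j k : Fin 3) :
    MemLp (pd k fun x => u t x i * u t x j) 2 volume := by
  have e : (pd k fun x => u t x i * u t x j) = fun x => u t x j * pd k (fun y => u t y i) x
      + u t x i * pd k (fun y => u t y j) x := by
    ext x
    rw [pd_mul (h.classicalH2 ht i).contDiff_one (h.classicalH2 ht j).contDiff_one]; ring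
  rw [e]
  exact (h.memLp_mul ht j ((h.classicalH2 ht i).memLp_pd k)).add
    (h.memLp_mul ht i ((h.classicalH2 ht j).memLp_pd k))

lemma FourierData.isFT_pd_mul (h : FourierData S u U) {t : ℝ} (ht : t ∈ S) (i j k : Fin 3) :
    IsFT (fun x => (pd k (fun x => u t x i * u t x j) x : ℂ))
      fun ξ => symb k ξ * conv (U i t) (U j t) ξ := by
  have hi := (h.curve i t ht).1
  have hj := (h.curve j t ht).1
  have h0 : IsFT (fun x => ((u t x i * u t x j : ℝ) : ℂ)) (conv (U i t) (U j t)) := by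
    have hc := memLp_wt_conv hi hj
    refine (isFT_fourierInv (integrable_of_wt hc) (memLp_of_wt hc)).congr
      (ae_of_all _ fun x => ?_) (ae_eq_refl _)
    dsimp only
    rw [fourierInv_conv (integrable_of_wt hi) (integrable_of_wt hj), Complex.ofReal_mul,
      h.eq_fourierInv t ht, h.eq_fourierInv t ht]
  exact h0.pd ((h.classicalH2 ht i).contDiff_one.mul (h.classicalH2 ht j).contDiff_one)
    (h.memLp_pd_mul ht i j k)

/-- The convection term does no work on the velocity. -/
lemma FourierData.sum_integral_convection (h : FourierData S u U) {t : ℝ} (ht : t ∈ S) :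
    ∑ i, ∑ j, ∫ x, pd j (fun y => u t y i * u t y j) x * u t x i = 0 := by
  have hC := fun i => (h.classicalH2 ht i).contDiff_one
  have i1 : ∀ i j, Integrable fun x => pd j (fun y => u t y i * u t y j) x * u t x i :=
    fun i j => (h.memLp_pd_mul ht i j j).integrable_mul (h.classicalH2 ht i).memLp
  have i2 : ∀ i j, Integrable fun x => u t x i * u t x j * pd j (fun y => u t y i) x :=
    fun i j => (h.memLp_mul ht i (h.classicalH2 ht j).memLp).integrable_mul
      ((h.classicalH2 ht i).memLp_pd j)
  have i3 : ∀ i j, Integrable fun x => u t x i * u t x j * u t x i :=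
    fun i j => (h.memLp_mul ht i (h.classicalH2 ht j).memLp).integrable_mul
      (h.classicalH2 ht i).memLp
  have e1 : ∀ i j, ∫ x, u t x i * u t x j * pd j (fun y => u t y i) x
      = -∫ x, pd j (fun y => u t y i * u t y j) x * u t x i := fun i j =>
    integral_mul_pd (f := fun x => u t x i * u t x j) ((hC i).mul (hC j)) (hC i) j
      (i1 i j) (i2 i j) (i3 i j)
  -- In the product rule the terms with ∂ⱼuⱼ sum to zero. Integration by parts (`e1`) shows that the
  -- remaining sum is also minus the original one, so both vanish.
  have e2 : ∑ i, ∑ j, ∫ x, pd j (fun y => u t y i * u t y j) x * u t x i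
      = ∑ i, ∑ j, ∫ x, u t x i * u t x j * pd j (fun y => u t y i) x := by
    refine Finset.sum_congr rfl fun i _ => ?_
    rw [← integral_finsetSum _ fun j _ => i1 i j, ← integral_finsetSum _ fun j _ => i2 i j]
    congr 1; ext x
    have hd : ∑ j, pd j (fun y => u t y j) x = 0 := by
      rw [← divergence_eq ((h.contDiff t ht).of_le (by norm_num)), h.divergence_eq_zero t ht]
    have e3 : ∀ j, pd j (fun y => u t y i * u t y j) x * u t x i
        = u t x i * u t x j * pd j (fun y => u t y i) x
          + u t x i ^ 2 * pd j (fun y => u t y j) x := fun j => by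
      rw [pd_mul (hC i) (hC j)]; ring
    simp only [e3, Finset.sum_add_distrib, ← Finset.mul_sum, hd, mul_zero, add_zero]
  simp only [e1, Finset.sum_neg_distrib] at e2
  linarith

/-- The filter inverts 1 − α²Δ. Testing with (1 − α²Δ)u therefore removes it from the convection
term. -/
lemma helmholtzSymb_mul (α : ℝ) (ξ : Space3) :
    (helmholtzSymb α ξ : ℂ) * ((1 + 4 * Real.pi ^ 2 * α ^ 2 * ‖ξ‖ ^ 2 : ℝ) : ℂ) = 1 := by
  rw [← Complex.ofReal_mul, helmholtzSymb, one_div, inv_mul_cancel₀ (by positivity),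
    Complex.ofReal_one]

lemma FourierData.isFT_helm (h : FourierData S u U) (α : ℝ) {t : ℝ} (ht : t ∈ S) (i : Fin 3) :
    IsFT (fun x => (helm α (fun y => u t y i) x : ℂ))
      fun ξ => ((1 + 4 * Real.pi ^ 2 * α ^ 2 * ‖ξ‖ ^ 2 : ℝ) : ℂ) * U i t ξ := by
  refine ((h.isFT t ht i).sub ((IsFT.sum Finset.univ fun j _ =>
    h.isFT_pd_pd t ht i j j).const_mul ((α ^ 2 : ℝ) : ℂ))).congr
      (ae_of_all _ fun x => ?_) (ae_of_all _ fun ξ => ?_)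
  · simp only [helm, lapl]; push_cast; ring
  · have : ∑ j, symb j ξ * (symb j ξ * U i t ξ)
        = ((-(4 * Real.pi ^ 2 * ‖ξ‖ ^ 2) : ℝ) : ℂ) * U i t ξ := by
      rw [← sum_symb_sq, Finset.sum_mul]; simp only [mul_assoc]
    simp only [this]
    push_cast; ring

/-- The filtered convection term does no work on `(1 - α² Δ) u`. -/
lemma FourierData.sum_integral_convection_helm (h : FourierData S u U) (hα : 0 < α) {t : ℝ}
    (ht : t ∈ S) :
    ∑ i, ∫ x, (𝓕⁻ (convectionFT α (fun k => U k t) i) : Space3 → ℂ) x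
      * (helm α (fun y => u t y i) x : ℂ) = 0 := by
  have key : ∀ i, ∫ x, (𝓕⁻ (convectionFT α (fun k => U k t) i) : Space3 → ℂ) x
      * (helm α (fun y => u t y i) x : ℂ)
      = ((∑ j, ∫ x, pd j (fun y => u t y i * u t y j) x * u t x i : ℝ) : ℂ) := fun i => by
    have h1 := (h.isFT_convection hα ht i).integral_mul_conj (h.isFT_helm α ht i)
    have h2 := (IsFT.sum Finset.univ fun j _ => h.isFT_pd_mul ht i j j).integral_mul_conj
      (h.isFT t ht i)
    have e : ∀ ξ, convectionFT α (fun k => U k t) i ξ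
        * conj (((1 + 4 * Real.pi ^ 2 * α ^ 2 * ‖ξ‖ ^ 2 : ℝ) : ℂ) * U i t ξ)
        = (∑ j, symb j ξ * conv (U i t) (U j t) ξ) * conj (U i t ξ) := fun ξ => by
      rw [map_mul, Complex.conj_ofReal, ← mul_assoc, convectionFT, Finset.sum_mul]
      congr 1
      refine Finset.sum_congr rfl fun j _ => ?_
      linear_combination (symb j ξ * conv (U i t) (U j t) ξ) * helmholtzSymb_mul α ξ
    simp only [e] at h1
    simp only [Complex.conj_ofReal] at h1 h2
    rw [h1, ← h2, ← integral_finsetSum _ fun j _ =>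
      integrable_fun_mul (h.memLp_pd_mul ht i j j) (h.classicalH2 ht i).memLp]
    have e2 : ∀ x, (∑ j, (pd j (fun y => u t y i * u t y j) x : ℂ)) * (u t x i : ℂ)
        = ((∑ j, pd j (fun y => u t y i * u t y j) x * u t x i : ℝ) : ℂ) := fun x => by
      rw [← Finset.sum_mul]; push_cast; rfl
    simp only [e2]
    exact integral_ofReal
  rw [Finset.sum_congr rfl fun i _ => key i, ← Complex.ofReal_sum, h.sum_integral_convection ht,
    Complex.ofReal_zero]

/-- The pressure gradient does no work on `(1 - α² Δ) u`. -/
lemma FourierData.sum_integral_pressure_helm (h : FourierData S u U) (hα : 0 < α) {t : ℝ}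
    (ht : t ∈ S) :
    ∑ i, ∫ x, (𝓕⁻ (fun ξ => symb i ξ * pressureFT α (fun k => U k t) ξ) : Space3 → ℂ) x
      * (helm α (fun y => u t y i) x : ℂ) = 0 := by
  have key : ∀ i, ∫ x, (𝓕⁻ (fun ξ => symb i ξ * pressureFT α (fun k => U k t) ξ) : Space3 → ℂ) x
      * (helm α (fun y => u t y i) x : ℂ)
      = ∫ ξ, (symb i ξ * pressureFT α (fun k => U k t) ξ)
        * conj (((1 + 4 * Real.pi ^ 2 * α ^ 2 * ‖ξ‖ ^ 2 : ℝ) : ℂ) * U i t ξ) := fun i => by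
    rw [← (h.isFT_pressure_grad hα ht i).integral_mul_conj (h.isFT_helm α ht i)]
    simp only [Complex.conj_ofReal]
  have hI : ∀ i, Integrable fun ξ => (symb i ξ * pressureFT α (fun k => U k t) ξ)
      * conj (((1 + 4 * Real.pi ^ 2 * α ^ 2 * ‖ξ‖ ^ 2 : ℝ) : ℂ) * U i t ξ) := fun i =>
    (h.isFT_pressure_grad hα ht i).memLp_ft.integrable_mul (h.isFT_helm α ht i).memLp_ft.star
  rw [Finset.sum_congr rfl fun i _ => key i, ← integral_finsetSum _ fun i _ => hI i]
  refine integral_eq_zero_of_ae ?_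
  filter_upwards [h.sum_symb_mul ht] with ξ hξ
  -- The symbols are purely imaginary, so conjugating the divergence relation only changes its sign.
  have hc : ∑ i, symb i ξ * conj (U i t ξ) = 0 := by
    have := congrArg conj hξ
    simp only [map_sum, map_mul, conj_symb, map_zero, neg_mul, Finset.sum_neg_distrib,
      neg_eq_zero] at this
    exact this
  have e : ∀ i, (symb i ξ * pressureFT α (fun k => U k t) ξ)
      * conj (((1 + 4 * Real.pi ^ 2 * α ^ 2 * ‖ξ‖ ^ 2 : ℝ) : ℂ) * U i t ξ)
      = pressureFT α (fun k => U k t) ξ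
        * ((1 + 4 * Real.pi ^ 2 * α ^ 2 * ‖ξ‖ ^ 2 : ℝ) : ℂ) * (symb i ξ * conj (U i t ξ)) :=
    fun i => by rw [map_mul, Complex.conj_ofReal]; ring
  rw [Finset.sum_congr rfl fun i _ => e i, ← Finset.mul_sum, hc, mul_zero]
  rfl

/-- The power of the acceleration against `(1 - α² Δ) u`. -/
lemma FourierData.sum_integral_accel_helm (h : FourierData S u U) (hα : 0 < α) (ν : ℝ) {t : ℝ}
    (ht : t ∈ S) :
    ∑ i, ∫ x, accel α ν (fun k => U k t) (u t) i x * (helm α (fun y => u t y i) x : ℂ)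
      = ((-(ν * ∑ i, ((∑ j, ∫ x, pd j (fun y => u t y i) x ^ 2)
          + α ^ 2 * ∫ x, lapl (fun y => u t y i) x ^ 2)) : ℝ) : ℂ) := by
  have hA := fun i => (h.isFT_helm α ht i).memLp
  have hL : ∀ i, MemLp (fun x => (lapl (fun y => u t y i) x : ℂ)) 2 volume := fun i =>
    (h.classicalH2 ht i).memLp_lapl.ofReal
  have e : ∀ i x, accel α ν (fun k => U k t) (u t) i x * (helm α (fun y => u t y i) x : ℂ)
      = (ν : ℂ) * ((lapl (fun y => u t y i) x : ℂ) * (helm α (fun y => u t y i) x : ℂ))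
        - (𝓕⁻ (convectionFT α (fun k => U k t) i) : Space3 → ℂ) x
          * (helm α (fun y => u t y i) x : ℂ)
        - (𝓕⁻ (fun ξ => symb i ξ * pressureFT α (fun k => U k t) ξ) : Space3 → ℂ) x
          * (helm α (fun y => u t y i) x : ℂ) := fun i x => by
    rw [accel, ← Complex.ofReal_sum]
    change ((ν : ℂ) * (lapl (fun y => u t y i) x : ℂ) - _ - _) * _ = _
    ring
  have i1 : ∀ i, Integrable fun x =>
      (lapl (fun y => u t y i) x : ℂ) * (helm α (fun y => u t y i) x : ℂ) := fun i =>
    (hL i).integrable_mul (hA i)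
  have i2 : ∀ i, Integrable fun x => (𝓕⁻ (convectionFT α (fun k => U k t) i) : Space3 → ℂ) x
      * (helm α (fun y => u t y i) x : ℂ) := fun i =>
    (h.isFT_convection hα ht i).memLp.integrable_mul (hA i)
  have i3 : ∀ i, Integrable fun x =>
      (𝓕⁻ (fun ξ => symb i ξ * pressureFT α (fun k => U k t) ξ) : Space3 → ℂ) x
      * (helm α (fun y => u t y i) x : ℂ) := fun i =>
    (h.isFT_pressure_grad hα ht i).memLp.integrable_mul (hA i)
  have e2 : ∀ i, ∫ x, (lapl (fun y => u t y i) x : ℂ) * (helm α (fun y => u t y i) x : ℂ)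
      = ((-((∑ j, ∫ x, pd j (fun y => u t y i) x ^ 2)
          + α ^ 2 * ∫ x, lapl (fun y => u t y i) x ^ 2) : ℝ) : ℂ) := fun i => by
    rw [← (h.classicalH2 ht i).integral_lapl_mul_helm]
    simp only [← Complex.ofReal_mul]
    exact integral_ofReal
  have e3 : ∀ i, ∫ x, accel α ν (fun k => U k t) (u t) i x * (helm α (fun y => u t y i) x : ℂ)
      = (ν : ℂ) * ((-((∑ j, ∫ x, pd j (fun y => u t y i) x ^ 2)
          + α ^ 2 * ∫ x, lapl (fun y => u t y i) x ^ 2) : ℝ) : ℂ)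
        - (∫ x, (𝓕⁻ (convectionFT α (fun k => U k t) i) : Space3 → ℂ) x
          * (helm α (fun y => u t y i) x : ℂ))
        - ∫ x, (𝓕⁻ (fun ξ => symb i ξ * pressureFT α (fun k => U k t) ξ) : Space3 → ℂ) x
          * (helm α (fun y => u t y i) x : ℂ) := fun i => by
    have i12 : Integrable fun x => (ν : ℂ) * ((lapl (fun y => u t y i) x : ℂ)
        * (helm α (fun y => u t y i) x : ℂ))
        - (𝓕⁻ (convectionFT α (fun k => U k t) i) : Space3 → ℂ) x
          * (helm α (fun y => u t y i) x : ℂ) := ((i1 i).const_mul _).sub (i2 i)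
    simp only [e]
    rw [integral_sub i12 (i3 i), integral_sub ((i1 i).const_mul _) (i2 i), integral_const_mul, e2]
  rw [Finset.sum_congr rfl fun i _ => e3 i, Finset.sum_sub_distrib, Finset.sum_sub_distrib,
    h.sum_integral_convection_helm hα ht, h.sum_integral_pressure_helm hα ht, sub_zero, sub_zero,
    ← Finset.mul_sum, ← Complex.ofReal_sum, ← Complex.ofReal_mul, Finset.sum_neg_distrib,
    mul_neg]

end

end Bardina

/-! ### Differentiation of the energy and the energy equality. -/

namespace Bardina
open scoped FourierTransform SchwartzMap LineDeriv ENNReal NNReal ComplexConjugate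

lemma re_inner_toL2_ofReal {f g : Space3 → ℝ} (hf : MemLp f 2 volume) (hg : MemLp g 2 volume) :
    (inner ℂ (toL2 fun x => (f x : ℂ)) (toL2 fun x => (g x : ℂ))).re = ∫ x, g x * f x := by
  have h1 : MemLp (fun x => (f x : ℂ)) 2 volume := hf.ofReal
  have h2 : MemLp (fun x => (g x : ℂ)) 2 volume := hg.ofReal
  rw [inner_toL2 h1 h2]
  simp only [Complex.conj_ofReal, ← Complex.ofReal_mul]
  rw [show (∫ x, ((g x * f x : ℝ) : ℂ)) = ((∫ x, g x * f x : ℝ) : ℂ) from integral_ofReal,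
    Complex.ofReal_re]

lemma L2Curve.continuousOn_integral_sq {S : Set ℝ} {f : ℝ → Space3 → ℝ}
    (hf : L2Curve S fun t x => (f t x : ℂ)) : ContinuousOn (fun t => ∫ x, f t x ^ 2) S := by
  have hc := hf.continuousOn_toL2
  refine (Complex.continuous_re.comp_continuousOn (hc.inner hc)).congr fun t ht => ?_
  have hm : MemLp (f t) 2 volume := by simpa using (hf t ht).1.re
  simp only [Function.comp_apply, sq]
  exact (re_inner_toL2_ofReal hm hm).symm

/-- The derivative of an inner product, one factor of which vanishes while the other one is only
continuous. -/
lemma hasDerivWithinAt_re_inner {H : Type*} [NormedAddCommGroup H] [InnerProductSpace ℂ H]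
    {G K : ℝ → H} {s : Set ℝ} {t : ℝ} {k : H} (hG : ContinuousWithinAt G s t)
    (hK : HasDerivWithinAt K k s t) (h0 : K t = 0) :
    HasDerivWithinAt (fun r => (inner ℂ (G r) (K r)).re) (inner ℂ (G t) k).re s t := by
  rw [hasDerivWithinAt_iff_tendsto_slope] at hK ⊢
  have hG' : Tendsto G (𝓝[s \ {t}] t) (𝓝 (G t)) := hG.mono_left (nhdsWithin_mono t Set.sdiff_subset)
  -- Because K vanishes at t, the difference quotient is exactly the inner product of G(r) with the
  -- quotient of K, and G only needs a limit.
  refine ((Complex.continuous_re.tendsto _).comp (hG'.inner (𝕜 := ℂ) hK)).congr fun r => ?_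
  simp only [Function.comp_apply, slope, vsub_eq_sub, h0, sub_zero, inner_zero_right,
    Complex.zero_re, smul_eq_mul]
  rw [← Complex.coe_smul, inner_smul_right, Complex.re_ofReal_mul]

section

variable {S : Set ℝ} {α ν : ℝ} {u : ℝ → Space3 → Space3} {U : Fin 3 → ℝ → Space3 → ℂ}

lemma FourierData.l2Curve (h : FourierData S u U) (i : Fin 3) :
    L2Curve S fun t x => (u t x i : ℂ) :=
  (h.curve i).of_wt.inv_ft fun t ht => h.isFT t ht i

lemma FourierData.l2Curve_pd (h : FourierData S u U) (i j : Fin 3) :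
    L2Curve S fun t x => (pd j (fun y => u t y i) x : ℂ) :=
  ((h.curve i).mul_of_wt (continuous_symb j).measurable (norm_symb_le_wt j)).inv_ft
    fun t ht => h.isFT_pd t ht i j

lemma FourierData.l2Curve_lapl (h : FourierData S u U) (i : Fin 3) :
    L2Curve S fun t x => (lapl (fun y => u t y i) x : ℂ) := by
  refine (L2Curve.sum Finset.univ fun j _ => (h.l2Curve_symb_sq i j).inv_ft
    fun t ht => h.isFT_pd_pd t ht i j j).congr fun t _ => ae_of_all _ fun x => ?_
  simp only [lapl, Complex.ofReal_sum]

lemma FourierData.l2Curve_helm (h : FourierData S u U) (α : ℝ) (i : Fin 3) :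
    L2Curve S fun t x => (helm α (fun y => u t y i) x : ℂ) := by
  refine ((h.l2Curve i).sub ((h.l2Curve_lapl i).const_mul ((α ^ 2 : ℝ) : ℂ))).congr
    fun t _ => ae_of_all _ fun x => ?_
  simp only [helm, Complex.ofReal_sub, Complex.ofReal_mul]

lemma FourierData.integrable_norm_sq (h : FourierData S u U) {t : ℝ} (ht : t ∈ S) :
    Integrable (fun x => ‖u t x‖ ^ 2) ∧
      ∫ x, ‖u t x‖ ^ 2 = ∑ i, ∫ x, u t x i ^ 2 := by
  have hI : ∀ i, Integrable fun x => u t x i ^ 2 := fun i =>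
    (h.classicalH2 ht i).memLp.integrable_sq
  simp only [EuclideanSpace.real_norm_sq_eq]
  exact ⟨integrable_finsetSum _ fun i _ => hI i, integral_finsetSum _ fun i _ => hI i⟩

lemma FourierData.integrable_gradSq (h : FourierData S u U) {t : ℝ} (ht : t ∈ S) :
    Integrable (gradSq (u t)) ∧
      ∫ x, gradSq (u t) x = ∑ i, ∑ j, ∫ x, pd j (fun y => u t y i) x ^ 2 := by
  have hI : ∀ i j, Integrable fun x => pd j (fun y => u t y i) x ^ 2 := fun i j =>
    ((h.classicalH2 ht i).memLp_pd j).integrable_sq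
  have e : gradSq (u t) = fun x => ∑ i, ∑ j, pd j (fun y => u t y i) x ^ 2 :=
    funext fun x => gradSq_eq ((h.contDiff t ht).of_le (by norm_num)) x
  have hI2 : ∀ i, Integrable fun x => ∑ j, pd j (fun y => u t y i) x ^ 2 := fun i =>
    integrable_finsetSum _ fun j _ => hI i j
  rw [e]
  refine ⟨integrable_finsetSum _ fun i _ => hI2 i, ?_⟩
  rw [integral_finsetSum _ fun i _ => hI2 i]
  exact Finset.sum_congr rfl fun i _ => integral_finsetSum _ fun j _ => hI i j

lemma FourierData.integrable_laplacian_sq (h : FourierData S u U) {t : ℝ} (ht : t ∈ S) :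
    Integrable (fun x => ‖Laplacian.laplacian (u t) x‖ ^ 2) ∧
      ∫ x, ‖Laplacian.laplacian (u t) x‖ ^ 2 = ∑ i, ∫ x, lapl (fun y => u t y i) x ^ 2 := by
  have hI : ∀ i, Integrable fun x => lapl (fun y => u t y i) x ^ 2 := fun i =>
    (h.classicalH2 ht i).memLp_lapl.integrable_sq
  have e : ∀ x, ‖Laplacian.laplacian (u t) x‖ ^ 2 = ∑ i, lapl (fun y => u t y i) x ^ 2 :=
    fun x => by
      rw [EuclideanSpace.real_norm_sq_eq]
      exact Finset.sum_congr rfl fun i _ => by rw [laplacian_coord (h.contDiff t ht)]; rfl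
  simp only [e]
  exact ⟨integrable_finsetSum _ fun i _ => hI i, integral_finsetSum _ fun i _ => hI i⟩

lemma FourierData.continuousOn_integral_gradSq (h : FourierData S u U) :
    ContinuousOn (fun t => ∫ x, gradSq (u t) x) S :=
  ContinuousOn.congr (continuousOn_finsetSum _ fun i _ => continuousOn_finsetSum _ fun j _ =>
    (h.l2Curve_pd i j).continuousOn_integral_sq) fun _ ht => (h.integrable_gradSq ht).2

lemma FourierData.continuousOn_integral_laplacian_sq (h : FourierData S u U) :
    ContinuousOn (fun t => ∫ x, ‖Laplacian.laplacian (u t) x‖ ^ 2) S :=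
  ContinuousOn.congr (continuousOn_finsetSum _ fun i _ =>
    (h.l2Curve_lapl i).continuousOn_integral_sq) fun _ ht => (h.integrable_laplacian_sq ht).2

lemma FourierData.energy_eq (h : FourierData S u U) (α : ℝ) {t : ℝ} (ht : t ∈ S) :
    energy α (u t) = ∑ i, ∫ x, u t x i * helm α (fun y => u t y i) x := by
  rw [energy, (h.integrable_gradSq ht).2, (h.integrable_norm_sq ht).2, Finset.mul_sum,
    ← Finset.sum_add_distrib]
  refine Finset.sum_congr rfl fun i _ => ?_
  rw [(h.classicalH2 ht i).integral_mul_helm (h.classicalH2 ht i)]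
  simp only [sq]
  ring

lemma FourierData.re_inner_helm (h : FourierData S u U) (α : ℝ) {s t : ℝ} (hs : s ∈ S)
    (ht : t ∈ S) (i : Fin 3) :
    (inner ℂ (toL2 fun x => (helm α (fun y => u s y i) x : ℂ))
      (toL2 fun x => (u t x i : ℂ))).re = ∫ x, u t x i * helm α (fun y => u s y i) x :=
  re_inner_toL2_ofReal ((h.classicalH2 hs i).memLp_helm α) (h.classicalH2 ht i).memLp

/-- On expanding, the cross terms cancel by symmetry of 1 − α²Δ. This form avoids differentiating (1
− α²Δ)u in time, which is only continuous into L². -/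
lemma FourierData.energy_sub_eq (h : FourierData S u U) (α : ℝ) {s t : ℝ} (hs : s ∈ S)
    (ht : t ∈ S) :
    energy α (u s) - energy α (u t)
      = ∑ i, (inner ℂ ((toL2 fun x => (helm α (fun y => u s y i) x : ℂ))
          + toL2 fun x => (helm α (fun y => u t y i) x : ℂ))
        ((toL2 fun x => (u s x i : ℂ)) - toL2 fun x => (u t x i : ℂ))).re := by
  rw [h.energy_eq α hs, h.energy_eq α ht, ← Finset.sum_sub_distrib]
  refine Finset.sum_congr rfl fun i _ => ?_
  rw [inner_add_left, inner_sub_right, inner_sub_right]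
  simp only [Complex.add_re, Complex.sub_re]
  rw [h.re_inner_helm α hs hs, h.re_inner_helm α hs ht, h.re_inner_helm α ht hs,
    h.re_inner_helm α ht ht,
    (h.classicalH2 ht i).integral_mul_helm_comm (h.classicalH2 hs i)]
  ring

lemma FourierData.continuousOn_energy (h : FourierData S u U) (α : ℝ) :
    ContinuousOn (fun t => energy α (u t)) S := by
  refine ContinuousOn.congr (continuousOn_finsetSum Finset.univ fun i _ =>
    Complex.continuous_re.comp_continuousOn (((h.l2Curve_helm α i).continuousOn_toL2).inner
      (𝕜 := ℂ) (h.l2Curve i).continuousOn_toL2)) fun t ht => ?_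
  rw [h.energy_eq α ht]
  exact Finset.sum_congr rfl fun i _ => (h.re_inner_helm α ht ht i).symm

end

/-- Differential form of the energy equality, for the derivative from the right. -/
lemma FourierData.hasDerivWithinAt_energy {T : EReal} {α : ℝ} {u : ℝ → Space3 → Space3}
    {U : Fin 3 → ℝ → Space3 → ℂ} (h : FourierData (timeInterval T) u U) (hα : 0 < α) (ν : ℝ)
    (hint : ∀ i, ∀ a ∈ timeInterval T, ∀ b ∈ timeInterval T, a ≤ b →
      toL2 (fun x => (u b x i : ℂ)) - toL2 (fun x => (u a x i : ℂ))
        = ∫ s in a..b, toL2 (accel α ν (fun k => U k s) (u s) i)) {t : ℝ}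
    (ht : t ∈ timeInterval T) :
    HasDerivWithinAt (fun s => energy α (u s))
      (-2 * (ν * α ^ 2 * (∫ x, ‖Laplacian.laplacian (u t) x‖ ^ 2)
        + ν * ∫ x, gradSq (u t) x)) (Set.Ici t) t := by
  obtain ⟨τ, l1, -, l3, -⟩ := timeInterval_exists_Icc ht
  have hev : ∀ᶠ s in 𝓝[≥] t, s ∈ timeInterval T ∧ t ≤ s := by
    filter_upwards [Ico_mem_nhdsGE l1] with s hs
    exact ⟨Icc_subset_timeInterval ht.1 l3 ⟨hs.1, hs.2.le⟩, hs.1⟩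
  have hle : 𝓝[≥] t ≤ 𝓝[timeInterval T] t :=
    le_inf inf_le_left (le_principal_iff.2 (hev.mono fun s hs => hs.1))
  have hK : ∀ i, HasDerivWithinAt
      (fun s => (toL2 fun x => (u s x i : ℂ)) - toL2 fun x => (u t x i : ℂ))
      (toL2 (accel α ν (fun k => U k t) (u t) i)) (Set.Ici t) t := fun i => by
    refine (hasDerivWithinAt_integral_of_continuousOn
      (h.l2Curve_accel hα ν i).continuousOn_toL2 ht).congr_of_eventuallyEq ?_ (by simp)
    filter_upwards [hev] with s hs using hint i t ht s hs.1 hs.2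
  have hG : ∀ i, ContinuousWithinAt (fun s => (toL2 fun x => (helm α (fun y => u s y i) x : ℂ))
      + toL2 fun x => (helm α (fun y => u t y i) x : ℂ)) (Set.Ici t) t := fun i =>
    Tendsto.mono_left (((h.l2Curve_helm α i).continuousOn_toL2 t ht).add_const _) hle
  have hE := HasDerivWithinAt.fun_sum (u := Finset.univ) fun i _ =>
    hasDerivWithinAt_re_inner (hG i) (hK i) (sub_self _)
  -- At s = t the left factor is twice (1 − α²Δ)u, hence twice the power found in
  -- `sum_integral_accel_helm`.
  have hval : ∑ i, (inner ℂ ((toL2 fun x => (helm α (fun y => u t y i) x : ℂ))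
      + toL2 fun x => (helm α (fun y => u t y i) x : ℂ))
        (toL2 (accel α ν (fun k => U k t) (u t) i))).re
      = -2 * (ν * α ^ 2 * (∫ x, ‖Laplacian.laplacian (u t) x‖ ^ 2)
        + ν * ∫ x, gradSq (u t) x) := by
    have e : ∀ i, (inner ℂ ((toL2 fun x => (helm α (fun y => u t y i) x : ℂ))
      + toL2 fun x => (helm α (fun y => u t y i) x : ℂ))
        (toL2 (accel α ν (fun k => U k t) (u t) i)))
        = 2 * ∫ x, accel α ν (fun k => U k t) (u t) i x
          * (helm α (fun y => u t y i) x : ℂ) := fun i => by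
      rw [inner_add_left, ← two_mul,
        inner_toL2 (h.l2Curve_helm α i t ht).1 (h.l2Curve_accel hα ν i t ht).1]
      simp only [Complex.conj_ofReal]
    simp only [e]
    rw [← Complex.re_sum, ← Finset.mul_sum, h.sum_integral_accel_helm hα ν ht,
      (h.integrable_laplacian_sq ht).2, (h.integrable_gradSq ht).2, Finset.sum_add_distrib,
      ← Finset.mul_sum, ← Complex.ofReal_ofNat, ← Complex.ofReal_mul, Complex.ofReal_re]
    ring
  rw [hval] at hE
  refine (hE.const_add (energy α (u t))).congr_of_eventuallyEq ?_ (by simp)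
  filter_upwards [hev] with s hs
  rw [← h.energy_sub_eq α hs.1 ht]
  ring

/-- The energy equality. -/
theorem IsRegularSolution.energy_equality {α ν : ℝ} {T : EReal} {u₀ : Space3 → Space3}
    {u : ℝ → Space3 → Space3} {p : ℝ → Space3 → ℝ} (h : IsRegularSolution α ν T u₀ u p)
    (hα : 0 < α) {t : ℝ} (ht : t ∈ timeInterval T) :
    Integrable (fun x => ‖u t x‖ ^ 2) volume ∧
    Integrable (gradSq (u t)) volume ∧
    Integrable (fun x => ‖Laplacian.laplacian (u t) x‖ ^ 2) volume ∧
    IntervalIntegrable (fun s => ∫ x, ‖Laplacian.laplacian (u s) x‖ ^ 2) volume 0 t ∧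
    IntervalIntegrable (fun s => ∫ x, gradSq (u s) x) volume 0 t ∧
    1 / 2 * energy α (u t)
      + ∫ s in (0 : ℝ)..t, (ν * α ^ 2 * (∫ x, ‖Laplacian.laplacian (u s) x‖ ^ 2)
          + ν * ∫ x, gradSq (u s) x)
      = 1 / 2 * energy α (filtered α u₀) := by
  obtain ⟨U, hU⟩ := h.exists_fourierData
  obtain ⟨-, -, hint⟩ := h.pressure_and_timeDeriv hα hU
  have h0 : (0 : ℝ) ∈ timeInterval T :=
    Icc_subset_timeInterval le_rfl ht.2 (Set.left_mem_Icc.2 ht.1)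
  have i1 := intervalIntegrable_of_continuousOn hU.continuousOn_integral_laplacian_sq h0 ht ht.1
  have i2 := intervalIntegrable_of_continuousOn hU.continuousOn_integral_gradSq h0 ht ht.1
  refine ⟨(hU.integrable_norm_sq ht).1, (hU.integrable_gradSq ht).1,
    (hU.integrable_laplacian_sq ht).1, i1, i2, ?_⟩
  have hsub := Icc_subset_timeInterval le_rfl ht.2
  -- A right derivative suffices here, since the energy is continuous and that derivative is
  -- integrable.
  have hFTC := intervalIntegral.integral_eq_sub_of_hasDeriv_right
    (f := fun s => energy α (u s)) (a := 0) (b := t)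
    (by rw [Set.uIcc_of_le ht.1]; exact (hU.continuousOn_energy α).mono hsub)
    (fun s hs => by
      rw [min_eq_left ht.1, max_eq_right ht.1] at hs
      exact (hU.hasDerivWithinAt_energy hα ν hint (hsub ⟨hs.1.le, hs.2.le⟩)).mono
        Set.Ioi_subset_Ici_self)
    (((i1.const_mul (ν * α ^ 2)).add (i2.const_mul ν)).const_mul (-2))
  rw [intervalIntegral.integral_const_mul] at hFTC
  rw [← show u 0 = filtered α u₀ from funext h.initial]
  linarith

end Bardina

theorem mainTheorem2
    (α ν : ℝ) (hα : 0 < α) (hν : 0 < ν) (T : EReal) (hT : 0 < T)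
    (u₀ : Bardina.Space3 → Bardina.Space3) (hu₀ : MemLp u₀ 2 volume)
    (hdiv : Bardina.IsWeaklyDivFree u₀)
    (u : ℝ → Bardina.Space3 → Bardina.Space3) (p : ℝ → Bardina.Space3 → ℝ)
    (hreg : Bardina.IsRegularSolution α ν T u₀ u p) :
    -- regularity of the pressure, which is normalized by its value at infinity
    (∃ c : ℝ → ℝ, ContinuousOn c (Bardina.timeInterval T) ∧
      (∀ t ∈ Bardina.timeInterval T, Tendsto (p t) (cocompact Bardina.Space3) (𝓝 (c t))) ∧
      ∀ τ : ℝ, 0 < τ → (τ : EReal) < T →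
        Bardina.ContinuousIntoSobolev 4 (Set.Icc 0 τ) (fun t x => p t x - c t)) ∧
    ((∀ t ∈ Bardina.timeInterval T,
        MemLp (p t) 2 volume ∨ Tendsto (p t) (cocompact Bardina.Space3) (𝓝 0)) →
      ∀ τ : ℝ, 0 < τ → (τ : EReal) < T →
        Bardina.ContinuousIntoSobolev 4 (Set.Icc 0 τ) p) ∧
    -- regularity of the time derivative
    (∀ τ : ℝ, 0 < τ → (τ : EReal) < T → ∀ i,
      Bardina.ContinuousIntoL2 (Set.Icc 0 τ) (fun t x => Bardina.timeDeriv u t x i)) ∧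
    -- the energy equality; all the integrals in it converge
    (∀ t ∈ Bardina.timeInterval T,
      Integrable (fun x => ‖u t x‖ ^ 2) volume ∧
      Integrable (Bardina.gradSq (u t)) volume ∧
      Integrable (fun x => ‖Laplacian.laplacian (u t) x‖ ^ 2) volume ∧
      IntervalIntegrable (fun s => ∫ x, ‖Laplacian.laplacian (u s) x‖ ^ 2) volume 0 t ∧
      IntervalIntegrable (fun s => ∫ x, Bardina.gradSq (u s) x) volume 0 t ∧
      1 / 2 * Bardina.energy α (u t)
        + ∫ s in (0 : ℝ)..t,
            (ν * α ^ 2 * (∫ x, ‖Laplacian.laplacian (u s) x‖ ^ 2)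
              + ν * ∫ x, Bardina.gradSq (u s) x)
        = 1 / 2 * Bardina.energy α (Bardina.filtered α u₀)) := by
  have hsub : ∀ τ : ℝ, (τ : EReal) < T → Set.Icc 0 τ ⊆ Bardina.timeInterval T :=
    fun τ hτ => Bardina.Icc_subset_timeInterval le_rfl hτ
  obtain ⟨c, hc, hlim, hL2, hH4⟩ := hreg.exists_pressure_limit hα
  refine ⟨⟨c, hc, hlim, fun τ _ hτ => hH4.mono (hsub τ hτ)⟩, fun h τ _ hτ => ?_,
    fun τ _ hτ i => (hreg.continuousIntoL2_timeDeriv hα i).mono (hsub τ hτ),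
    fun t ht => hreg.energy_equality hα ht⟩
  refine (hH4.mono (hsub τ hτ)).congr fun t ht => funext fun x => ?_
  have ht' := hsub τ hτ ht
  rw [Bardina.eq_zero_of_memLp_or_tendsto (hlim t ht') (hL2 t ht') (h t ht'), sub_zero]
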